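/- Let $A=\mathbb F_q[T]$, let $A_+$ be the set of monic polynomials in $A$, let $K_\infty=\mathbb F_q((1/T))$, let $\mathbb C_\infty$ be the completion of an algebraic closure of $K_\infty$, and let $\Omega=\mathbb C_\infty\setminus K_\infty$. Let $\rho$ be the Carlitz module ($\rho_T=TX+X^q$), $e(z)=\sum_{i\ge 0} z^{q^i}/D_i$ with $D_i=\prod_{j<i}(T^{q^i}-T^{q^j})$ the Carlitz exponential, and $\widetilde\pi$ a fixed period, i.e. $\widetilde\pi\neq 0$ and $\ker e=\widetilde\pi A$. Put $t(z)=1/e(\widetilde\pi z)$; for $a\in A_+$ of degree $d$ let $t_a=t^{q^d}/(t^{q^d}\rho_a(t^{-1}))\in\mathbb C_\infty[[t]]$ be the expansion of $t(az)$; and let $G_n$ be the $n$-th Goss polynomial of $\widetilde\pi A$, so $\sum_{n\ge1}G_n(X)u^n=uX/(1-Xe(u))$. Let $S_{k,m}(\mathrm{GL}_2(A))$ be the space of Drinfeld cusp forms of weight $k\ge 0$ and type $m$: rigid analytic $f:\Omega\to\mathbb C_\infty$ with $f\left(\frac{az+b}{cz+d}\right)=(\det\gamma)^{-m}(cz+d)^kf(z)$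 for all $\gamma=\begin{pmatrix}a&b\\c&d\end{pmatrix}\in\mathrm{GL}_2(A)$, having an expansion $f=\sum_{i\ge 1}a_it^i$ near infinity. For a nonzero prime $\mathfrak p=(\wp)$ with $\wp$ monic, let $T_{\mathfrak p}f(z)=\wp^kf(\wp z)+\sum_{\deg\beta<\deg\wp}f\left(\frac{z+\beta}{\wp}\right)$. An eigenform with eigensystem $\{\lambda_{\mathfrak p}\}$ is a nonzero $f$ with $T_{\mathfrak p}f=\lambda_{\mathfrak p}f$ for all nonzero primes $\mathfrak p$. An $A$-expansion of $f$ with exponent $n\ge1$ is an identity $f=c_0+\sum_{a\in A_+}c_a\,G_n(t_a)$ in $\mathbb C_\infty[[t]]$ between the $t$-expansion of $f$ and the right-hand side, with $c_0,c_a\in\mathbb C_\infty$. Theorem (Multiplicity One for modular forms with $A$-expansions). (1) Let $f\in S_{k,m}(\mathrm{GL}_2(A))$ be an eigenform with eigensystem $\{\lambda_{\mathfrak p}\}$, and let $f=c_0+\sum_{a\in A_+}c_aG_n(t_a)$ be an $A$-expansion of $f$ with exponent $n$. Then $c_0=0$, $c_1\ne0$, $c_a=a^{k-n}c_1$ for all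 $a\in A_+$, so that $$c_1^{-1}f=\sum_{a\in A_+}a^{k-n}G_n(t_a),$$ and $\lambda_{\mathfrak p}=\wp^n$ for every nonzero prime $\mathfrak p=(\wp)$. (2) Consequently, $f$ is determined up to a scalar by its weight and its eigenvalues: if $f\in S_{k,m}(\mathrm{GL}_2(A))$ and $f'\in S_{k,m'}(\mathrm{GL}_2(A))$ are eigenforms of the same weight $k$ with the same eigensystem, and each of them has an $A$-expansion (with some exponent), then $f'=\mu f$ for some $\mu\in\mathbb C_\infty^\times$. -/

import Mathlib

open Polynomial
open scoped NNReal

noncomputable section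

namespace Drinfeld

universe u

section Fields

variable (F : Type u) [Field F] [Fintype F]

/-- The cardinality `q` of the finite field `F` of constants. -/
abbrev q : ℕ := Fintype.card F

lemma one_lt_q : (1 : ℝ≥0) < (q F : ℝ≥0) := by
  exact_mod_cast Fintype.one_lt_card

/-- `K_∞ = F((1/T))`, the completion of `K = F(T)` at the place `∞`. -/
abbrev KInf : Type u := @RatFunc.CompletionAtInfty F _ (Classical.decEq _)

instance : Valued (KInf F) (WithZero (Multiplicative ℤ)) :=
  @RatFunc.CompletionAtInfty.instValuedWithZeroMultiplicativeInt F _ (Classical.decEq _)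

/-- The absolute value of `K_∞` is normalized by `|T| = q`. -/
instance : (Valued.v (R := KInf F) (Γ₀ := WithZero (Multiplicative ℤ))).RankOne where
  hom' := (WithZeroMulInt.toNNReal (one_lt_q F).ne_zero).comp
    MonoidWithZeroHom.ValueGroup₀.embedding
  strictMono' := (WithZeroMulInt.toNNReal_strictMono (one_lt_q F)).comp
    MonoidWithZeroHom.ValueGroup₀.embedding_strictMono
  exists_val_nontrivial := by
    classical
    refine ⟨algebraMap (RatFunc F) (KInf F) RatFunc.X, ?_⟩
    have h : Valued.v (algebraMap (RatFunc F) (KInf F) RatFunc.X)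
        = @RatFunc.inftyValuation F _ (Classical.decEq _) RatFunc.X :=
      @Valued.extensionValuation_apply_coe _ _ _ _
        (@RatFunc.inftyValued F _ (Classical.decEq _)) RatFunc.X
    rw [h, RatFunc.inftyValuation.X]
    exact ⟨WithZero.coe_ne_zero, by decide⟩

instance : NontriviallyNormedField (KInf F) :=
  Valued.toNontriviallyNormedField (KInf F) (WithZero (Multiplicative ℤ))

instance : IsUltrametricDist (KInf F) :=
  Valued.instIsUltrametricDist _ _

instance : CompleteSpace (KInf F) :=
  @UniformSpace.Completion.completeSpace (RatFunc F)
    (@RatFunc.inftyValued F _ (Classical.decEq _)).toUniformSpace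

/-- An algebraic closure of `K_∞`, with the unique extension of the absolute value. -/
abbrev KInfAlg : Type u := AlgebraicClosure (KInf F)

instance : NontriviallyNormedField (KInfAlg F) :=
  spectralNorm.nontriviallyNormedField (KInf F) (KInfAlg F)

/-- `ℂ_∞`, the completion of an algebraic closure of `K_∞`. -/
abbrev CInf : Type u := UniformSpace.Completion (KInfAlg F)

/-- The embedding `K_∞ → ℂ_∞`. -/
def ofKInf : KInf F →+* CInf F :=
  (algebraMap (KInfAlg F) (CInf F)).comp (algebraMap (KInf F) (KInfAlg F))

/-- The embedding `A = F[T] → ℂ_∞`. -/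
def ofA : F[X] →+* CInf F :=
  (ofKInf F).comp ((algebraMap (RatFunc F) (KInf F)).comp (algebraMap F[X] (RatFunc F)))

end Fields

variable {F : Type u} [Field F] [Fintype F]

lemma ofA_injective : Function.Injective (ofA F) :=
  (ofKInf F).injective.comp ((algebraMap (RatFunc F) (KInf F)).injective.comp
    (RatFunc.algebraMap_injective F))

/-! ### The Carlitz module -/

/-- `A_+`, the set of monic elements of `A = F[T]`. -/
abbrev MonicPoly (F : Type u) [Field F] : Type u := {a : F[X] // a.Monic}

/-- `D_i = ∏_{j < i} (T^{q^i} - T^{q^j})`. -/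
def carlitzD (F : Type u) [Field F] [Fintype F] (i : ℕ) : CInf F :=
  ∏ j ∈ Finset.range i, (ofA F X ^ q F ^ i - ofA F X ^ q F ^ j)

/-- The Carlitz exponential `z ↦ ∑ z^{q^i} / D_i`. -/
def carlitzExp (z : CInf F) : CInf F :=
  ∑' i : ℕ, z ^ q F ^ i / carlitzD F i

/-- The Carlitz exponential as a formal power series: the coefficient of `u^{q^i}` is `1 / D_i`,
and all other coefficients vanish. -/
def carlitzExpSeries (F : Type u) [Field F] [Fintype F] : PowerSeries (CInf F) :=
  PowerSeries.mk fun n =>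
    if n = q F ^ Nat.log (q F) n then (carlitzD F (Nat.log (q F) n))⁻¹ else 0

/-- `ϖ` is a period of the Carlitz module: the kernel of the Carlitz exponential is the rank one
lattice `ϖ A`. -/
def IsCarlitzPeriod (ϖ : CInf F) : Prop :=
  ϖ ≠ 0 ∧ ∀ z : CInf F, carlitzExp z = 0 ↔ ∃ a : F[X], z = ϖ * ofA F a

/-- The polynomials `ρ_{T^i}` of the Carlitz module: `ρ_1 = X` and
`ρ_{T^{i+1}} = ρ_T(ρ_{T^i})`, where `ρ_T = T X + X^q`. -/
def carlitzTPow (F : Type u) [Field F] [Fintype F] : ℕ → (CInf F)[X]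
  | 0 => X
  | i + 1 => C (ofA F X) * carlitzTPow F i + carlitzTPow F i ^ q F

/-- The polynomial `ρ_a` of the Carlitz module, `F`-linear in `a`. -/
def carlitz (a : F[X]) : (CInf F)[X] :=
  a.sum fun i c => C (ofA F (C c)) * carlitzTPow F i

/-- The Goss polynomial `G_n` of the Carlitz lattice `ϖ A`, given by its generating function
`∑_{n ≥ 1} G_n(X) u^n = u X / (1 - X e(u)) = ∑_{j ≥ 0} X^{j+1} u e(u)^j`,
where `e` is the Carlitz exponential. -/
def goss (F : Type u) [Field F] [Fintype F] (n : ℕ) : (CInf F)[X] :=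
  ∑ j ∈ Finset.range n, C (PowerSeries.coeff (n - 1) (carlitzExpSeries F ^ j)) * X ^ (j + 1)

/-! ### Expansions in `t_a` -/

/-- The expansion of `t_a = t(az)` as a power series in `t`, for `a` monic of degree `d`:
`t_a = t^{q^d} / (t^{q^d} ρ_a(1/t))`. -/
def tSeries (a : MonicPoly F) : PowerSeries (CInf F) :=
  PowerSeries.X ^ q F ^ a.1.natDegree *
    ((reflect (q F ^ a.1.natDegree) (carlitz a.1) : (CInf F)[X]) : PowerSeries (CInf F))⁻¹

/-- `G_n(t_a)` as a power series in `t`. -/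
def gossSeries (n : ℕ) (a : MonicPoly F) : PowerSeries (CInf F) :=
  aeval (tSeries a) (goss F n)

lemma X_pow_dvd_gossSeries (n : ℕ) (a : MonicPoly F) :
    (PowerSeries.X : PowerSeries (CInf F)) ^ q F ^ a.1.natDegree ∣ gossSeries n a := by
  unfold gossSeries goss
  rw [map_sum]
  refine Finset.dvd_sum fun j _ => ?_
  rw [map_mul, aeval_X_pow, pow_succ]
  exact Dvd.dvd.mul_left (Dvd.dvd.mul_left (Dvd.intro _ rfl) _) _

lemma finite_natDegree_le (d : ℕ) : {a : F[X] | a.natDegree ≤ d}.Finite := by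
  refine Set.Finite.of_injOn (f := fun a : F[X] => fun i : Fin (d + 1) => a.coeff i)
    (t := Set.univ) (fun _ _ => Set.mem_univ _) ?_ Set.finite_univ
  intro a ha b hb h
  ext i
  by_cases hi : i < d + 1
  · exact congrFun h ⟨i, hi⟩
  · have ha' : a.natDegree ≤ d := ha
    have hb' : b.natDegree ≤ d := hb
    rw [coeff_eq_zero_of_natDegree_lt (by omega), coeff_eq_zero_of_natDegree_lt (by omega)]

/-- Only finitely many `G_n(t_a)` contribute to a given coefficient, so the finitary sum in
`aSeries` is a genuine one. -/
lemma finite_support_gossSeries (n N : ℕ) (c : MonicPoly F → CInf F) :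
    (Function.support fun a => c a * PowerSeries.coeff N (gossSeries n a)).Finite := by
  refine Set.Finite.subset
    (Set.Finite.preimage Subtype.val_injective.injOn (finite_natDegree_le (F := F) N)) ?_
  intro a ha
  by_contra hN
  have hN' : N < a.1.natDegree := not_le.mp hN
  refine ha ?_
  have h := PowerSeries.X_pow_dvd_iff.mp (X_pow_dvd_gossSeries n a) N
    (hN'.trans (Nat.lt_pow_self Fintype.one_lt_card))
  simp [h]

/-- The formal series `c₀ + ∑_{a ∈ A_+} c_a G_n(t_a)` in `ℂ_∞[[t]]`, summed coefficientwise. -/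
def aSeries (n : ℕ) (c₀ : CInf F) (c : MonicPoly F → CInf F) : PowerSeries (CInf F) :=
  PowerSeries.C c₀ +
    PowerSeries.mk fun N => ∑ᶠ a : MonicPoly F, c a * PowerSeries.coeff N (gossSeries n a)

/-! ### The Drinfeld upper half plane -/

/-- The Drinfeld upper half plane `Ω = ℂ_∞ \ K_∞`. -/
abbrev Omega (F : Type u) [Field F] [Fintype F] : Type u :=
  {z : CInf F // z ∉ Set.range (ofKInf F)}

/-- The "imaginary part" `|z|_i = inf_{x ∈ K_∞} |z - x|`. -/
def imagAbs (z : CInf F) : ℝ := Metric.infDist z (Set.range (ofKInf F))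

lemma denom_ne_zero (a b : KInf F) (h : a ≠ 0 ∨ b ≠ 0) (z : Omega F) :
    ofKInf F a * z.1 + ofKInf F b ≠ 0 := by
  intro h0
  by_cases ha : a = 0
  · subst ha
    have hb : b ≠ 0 := h.resolve_left (fun h => h rfl)
    simp only [map_zero, zero_mul, zero_add] at h0
    exact hb ((map_eq_zero (ofKInf F)).mp h0)
  · refine z.2 ⟨-b / a, ?_⟩
    have ha' : ofKInf F a ≠ 0 := (map_ne_zero (ofKInf F)).mpr ha
    rw [map_div₀, map_neg, div_eq_iff ha']
    linear_combination -h0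

/-- The action of a matrix `(a b; c d)` over `A` with nonzero determinant on `Ω` by
`z ↦ (a z + b) / (c z + d)`. -/
def moebius (M : Matrix (Fin 2) (Fin 2) F[X]) (hM : M.det ≠ 0) (z : Omega F) : Omega F :=
  ⟨(ofA F (M 0 0) * z.1 + ofA F (M 0 1)) / (ofA F (M 1 0) * z.1 + ofA F (M 1 1)), by
    rintro ⟨x, hx⟩
    have hι : ∀ a : F[X], ∃ a' : KInf F, ofKInf F a' = ofA F a ∧ (a' = 0 → a = 0) := fun a =>
      ⟨_, rfl, fun h => ofA_injective (by
        show ofKInf F _ = _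
        rw [h, map_zero, map_zero])⟩
    obtain ⟨a, ha, ha0⟩ := hι (M 0 0)
    obtain ⟨b, hb, hb0⟩ := hι (M 0 1)
    obtain ⟨c, hc, hc0⟩ := hι (M 1 0)
    obtain ⟨d, hd, hd0⟩ := hι (M 1 1)
    have hdet : a * d - b * c ≠ 0 := by
      intro h
      refine hM (ofA_injective ?_)
      rw [Matrix.det_fin_two, map_sub, map_mul, map_mul, ← ha, ← hb, ← hc, ← hd, map_zero,
        ← map_mul, ← map_mul, ← map_sub, h, map_zero]
    rw [← ha, ← hb, ← hc, ← hd] at hx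
    have hden : ofKInf F c * z.1 + ofKInf F d ≠ 0 := by
      refine denom_ne_zero c d ?_ z
      by_contra! h
      exact hdet (by rw [h.1, h.2]; ring)
    rw [eq_div_iff hden] at hx
    refine denom_ne_zero (a - x * c) (b - x * d) ?_ z ?_
    · by_contra! h
      exact hdet (by linear_combination d * h.1 - c * h.2)
    · simp only [map_sub, map_mul]
      linear_combination -hx⟩

/-- Rigid analytic functions on `Ω`: on each of the affinoids
`Ω_n = {z : |z| ≤ q^n, |z|_i ≥ q^{-n}}`, which exhaust `Ω`, the function `f` is a uniform limit of
rational functions without poles in `Ω_n`. -/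
def IsHolomorphic (f : Omega F → CInf F) : Prop :=
  ∀ n : ℕ, ∀ ε : ℝ, 0 < ε → ∃ P Q : (CInf F)[X], ∀ z : Omega F,
    ‖z.1‖ ≤ (q F : ℝ) ^ n → ((q F : ℝ) ^ n)⁻¹ ≤ imagAbs z.1 →
      Q.eval z.1 ≠ 0 ∧ ‖f z - P.eval z.1 / Q.eval z.1‖ ≤ ε

/-- The uniformizer at infinity `t(z) = 1 / e(ϖ z)`. -/
def tParam (ϖ : CInf F) (z : Omega F) : CInf F := (carlitzExp (ϖ * z.1))⁻¹

/-- `S` is the `t`-expansion of `f`: `f(z) = ∑ a_n t(z)^n` in a neighbourhood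
`{|z|_i ≥ R}` of infinity. -/
def HasTExpansion (ϖ : CInf F) (f : Omega F → CInf F) (S : PowerSeries (CInf F)) : Prop :=
  ∃ R : ℝ, ∀ z : Omega F, R ≤ imagAbs z.1 →
    HasSum (fun n : ℕ => PowerSeries.coeff n S * tParam ϖ z ^ n) (f z)

/-! ### Drinfeld modular forms -/

/-- Drinfeld modular forms of weight `k` and type `m` for `GL_2(A)`. -/
structure IsModularForm (ϖ : CInf F) (k : ℕ) (m : ℤ) (f : Omega F → CInf F) : Prop where
  holomorphic : IsHolomorphic f
  transform : ∀ (γ : Matrix.GeneralLinearGroup (Fin 2) F[X]) (z : Omega F),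
    f (moebius γ.1 γ.det.ne_zero z) =
      ofA F γ.det.1 ^ (-m) * (ofA F (γ.1 1 0) * z.1 + ofA F (γ.1 1 1)) ^ k * f z
  holomorphic_at_infinity : ∃ S, HasTExpansion ϖ f S

/-- `S_{k,m}(GL_2(A))`: the modular forms whose `t`-expansion has vanishing constant term. -/
structure IsCuspForm (ϖ : CInf F) (k : ℕ) (m : ℤ) (f : Omega F → CInf F) : Prop extends
    IsModularForm ϖ k m f where
  vanishes_at_infinity : ∃ S, HasTExpansion ϖ f S ∧ PowerSeries.constantCoeff S = 0

/-- The monic primes of `A`; they correspond to the nonzero prime ideals of `A`. -/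
abbrev MonicPrime (F : Type u) [Field F] : Type u := {p : F[X] // p.Monic ∧ Irreducible p}

/-- `{β ∈ A : deg β < d}`. -/
def residues (F : Type u) [Field F] [Fintype F] (d : ℕ) : Finset F[X] :=
  Set.Finite.toFinset (s := {β : F[X] | β.degree < d})
    ((finite_natDegree_le (F := F) d).subset fun _ hβ =>
      natDegree_le_iff_degree_le.mpr (le_of_lt hβ))

/-- The Hecke operator `(T_p f)(z) = p^k f(p z) + ∑_{deg β < deg p} f((z + β) / p)` in weight
`k`. -/
def hecke (k : ℕ) (p : MonicPrime F) (f : Omega F → CInf F) : Omega F → CInf F := fun z =>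
  ofA F p.1 ^ k * f (moebius !![p.1, 0; 0, 1] (by simpa using p.2.2.ne_zero) z) +
    ∑ β ∈ residues F p.1.natDegree,
      f (moebius !![1, β; 0, p.1] (by simpa using p.2.2.ne_zero) z)

/-- `f` is a (nonzero) simultaneous Hecke eigenform of weight `k` with eigensystem `lam`. -/
def IsEigenform (k : ℕ) (lam : MonicPrime F → CInf F) (f : Omega F → CInf F) : Prop :=
  f ≠ 0 ∧ ∀ p, hecke k p f = lam p • f

/-- `f` has the `A`-expansion `f = c₀ + ∑_{a ∈ A_+} c_a G_n(t_a)` with exponent `n`. -/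
def HasAExpansion (ϖ : CInf F) (f : Omega F → CInf F) (n : ℕ) (c₀ : CInf F)
    (c : MonicPoly F → CInf F) : Prop :=
  0 < n ∧ HasTExpansion ϖ f (aSeries n c₀ c)

/-- The monic polynomial `1`. -/
abbrev oneMonic (F : Type u) [Field F] : MonicPoly F := ⟨1, monic_one⟩

end Drinfeld

end

/-!
The proof compares the `t`-expansions of the two sides of the eigenvalue equation
`T_p f = λ_p f`, after expressing both as series in the `G_n(t_a)`.

*Hecke action on the `G_n(t_a)`.* The first summand `p^k f(p z)` of `T_p` acts on expansions by
the substitution `t ↦ t_p`, which maps `G_n(t_a)` to `G_n(t_{pa})` (`substT_gossSeries`). The second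
one is a trace over the points `e(ϖ(z + β)/p)`, which form the fibre of `ρ_p` over `e(ϖ z)`. Since
`ρ_p` has constant derivative `p`, the logarithmic derivative of `ρ_p(X) - x` is
`∑ 1/(X - y) = p/(ρ_p(X) - x)`, the sum being over the fibre `ρ_p(y) = x` (`sum_inv_C_sub`).
Expanding at `X = 0` gives the power sums of the `1/y`, hence the operator on expansions
(`Expands.traceT`); substituting `X = e(u)` and using `ρ_p(e(u)) = e(p u)` gives
`∑_y G_n(1/y) = p^n G_n(1/x)` (`sum_fiber_goss`). Therefore the trace multiplies `G_n(t_a)` by `p^n`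
if `p ∤ a`; if `p ∣ a` it sums `#(A/p)` equal terms and gives `0`.

*Uniqueness of coefficients.* A series `∑ c_a G_n(t_a)` determines the `c_a`
(`eq_zero_of_aSeries_eq_zero`). As `t_a` vanishes to order `q^{deg a}`, the lowest term of the series
shows that `c_1 = 0` if the series is zero. For a prime `p`, the trace retains exactly the terms with
`p ∤ a`, so the terms with `p ∣ a` also sum to zero; they are the image under the injective
substitution `t ↦ t_p` of `∑ c_{pa} G_n(t_a)`, and induction on the prime factors of `a` applies.

*Conclusion.* Comparing coefficients in `T_p f = λ_p f` yields `λ_p c_{pb} = p^k c_b` and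
`λ_p c_1 = p^n c_1`. If `c_1` were zero, all `c_a` would vanish, so `f` would vanish near infinity
and hence everywhere. So `c_1 ≠ 0`, `λ_p = p^n` and `c_a = a^{k-n} c_1`. The eigenvalue at `T`
determines `n`, so two eigenforms of weight `k` with the same eigensystem have proportional
expansions and are proportional near infinity, hence everywhere.

*Analytic input.* The passage from functions to expansions uses a filter `atInfinity` on `Ω`, along
which `|z|_i` and `|1/t(z)|` tend to infinity and which is stable under `z ↦ a z` and
`z ↦ (z + β)/a`; uniqueness of expansions rests on its being nontrivial (`atInfinity_neBot`). The
passage back is the identity theorem `eq_smul_of_eq_near_infinity`. Its proof decreases `|z|_i` by a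
factor of `q` at a time: after translation by an element of `K_∞` one has `|z|_i = |z|`, and on the
annulus `q^l < |z| < q^{l+1}`, which is contained in `Ω`, the approximating rational functions satisfy
a three circles inequality, because `log |P|` is convex and `log |Q|` is linear in `log r` when the
denominator `Q` has no zeros there. These estimates factor polynomials over `ℂ_∞`, whose algebraic
closedness is `isAlgClosed_of_denseRange`.
-/

noncomputable section

namespace Drinfeld

universe u

/-! ### Algebraic closedness of the completion -/

section AlgClosed

variable {K L : Type*} [Field K] [IsAlgClosed K] [NormedField L] [IsUltrametricDist L]
  [Algebra K L]

/-- One step of the continuity of roots: an approximate root of `f` is close to a much better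
approximate root, namely a root of a polynomial with coefficients in the dense subfield. -/
lemma exists_improved_root (hd : DenseRange (algebraMap K L)) {f : L[X]} (hf : f.Monic)
    (hf0 : f.natDegree ≠ 0) {B η : ℝ} (hB : 1 ≤ B) (hη : 0 < η) (hηB : η ≤ B) {x : L}
    (hx : ‖x‖ ≤ B) (hfx : ‖f.eval x‖ ≤ η ^ f.natDegree) :
    ∃ y : L, ‖y‖ ≤ B ∧ ‖y - x‖ ≤ η ∧ ‖f.eval y‖ ≤ (η / 2) ^ f.natDegree := by
  set n := f.natDegree with hn
  have hB0 : 0 < B := by linarith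
  set ε : ℝ := (η / 2) ^ n / B ^ n with hε
  have hε0 : 0 < ε := by positivity
  have happ : ∀ i, ∃ b : K, ‖f.coeff i - algebraMap K L b‖ < ε := by
    intro i
    obtain ⟨b, hb⟩ := hd.exists_dist_lt (f.coeff i) hε0
    exact ⟨b, by rwa [← dist_eq_norm]⟩
  choose b hb using happ
  set g : K[X] := X ^ n + ∑ i ∈ Finset.range n, C (b i) * X ^ i with hg
  have hlow : (∑ i ∈ Finset.range n, C (b i) * X ^ i).degree < (n : WithBot ℕ) := by
    refine (degree_sum_le _ _).trans_lt ((Finset.sup_lt_iff (WithBot.bot_lt_coe n)).2 ?_)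
    intro i hi
    exact (degree_C_mul_X_pow_le _ _).trans_lt (WithBot.coe_lt_coe.2 (Finset.mem_range.1 hi))
  have hgm : g.Monic := monic_X_pow_add hlow
  have hgd : g.natDegree = n := by
    refine natDegree_eq_of_degree_eq_some ?_
    rw [hg, degree_add_eq_left_of_degree_lt (by rwa [degree_X_pow]), degree_X_pow]
  have hdiff : ∀ z : L, ‖z‖ ≤ B → ‖f.eval z - (g.map (algebraMap K L)).eval z‖ ≤ (η / 2) ^ n := by
    intro z hz
    have h1 : f.eval z - (g.map (algebraMap K L)).eval z
        = ∑ i ∈ Finset.range n, (f.coeff i - algebraMap K L (b i)) * z ^ i := by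
      rw [eval_eq_sum_range, ← hn, Finset.sum_range_succ, hn, hf.coeff_natDegree, ← hn, hg]
      simp only [Polynomial.map_add, Polynomial.map_pow, map_X, Polynomial.map_sum,
        Polynomial.map_mul, map_C, eval_add, eval_pow, eval_X, eval_finsetSum, eval_mul, eval_C,
        sub_mul, Finset.sum_sub_distrib]
      ring
    rw [h1]
    refine IsUltrametricDist.norm_sum_le_of_forall_le_of_nonneg (by positivity) fun i hi => ?_
    rw [norm_mul, norm_pow]
    calc ‖f.coeff i - algebraMap K L (b i)‖ * ‖z‖ ^ i ≤ ε * B ^ n := by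
          refine mul_le_mul (hb i).le ?_ (by positivity) hε0.le
          exact (pow_le_pow_left₀ (norm_nonneg _) hz i).trans
            (pow_le_pow_right₀ hB (Finset.mem_range.1 hi).le)
      _ = (η / 2) ^ n := by rw [hε]; field_simp
  have hspl : (g.map (algebraMap K L)).Splits := IsAlgClosed.splits_domain g
  have hgm' : (g.map (algebraMap K L)).Monic := hgm.map _
  have hcard : Multiset.card (g.map (algebraMap K L)).roots = n := by
    rw [← hspl.natDegree_eq_card_roots, natDegree_map, hgd]
  have hgx : ‖(g.map (algebraMap K L)).eval x‖ ≤ η ^ n := by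
    have h1 := hdiff x hx
    have h2 : (η / 2) ^ n ≤ η ^ n := pow_le_pow_left₀ (by positivity) (by linarith) n
    calc ‖(g.map (algebraMap K L)).eval x‖
        = ‖f.eval x - (f.eval x - (g.map (algebraMap K L)).eval x)‖ := by rw [sub_sub_cancel]
      _ ≤ max _ _ := by
        rw [sub_eq_add_neg _ (f.eval x - _)]
        exact (IsUltrametricDist.norm_add_le_max _ _).trans_eq (by rw [norm_neg])
      _ ≤ η ^ n := max_le hfx (h1.trans h2)
  obtain ⟨y, hy, hyx⟩ : ∃ y ∈ (g.map (algebraMap K L)).roots, ‖x - y‖ ≤ η := by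
    by_contra! hcon
    rw [hspl.eval_eq_prod_roots_of_monic hgm' x] at hgx
    have key : ∀ s : Multiset L, (∀ y ∈ s, η < ‖x - y‖) → s ≠ 0 →
        η ^ Multiset.card s < ‖(s.map (x - ·)).prod‖ := by
      intro s
      induction s using Multiset.induction with
      | empty => intro _ h; exact absurd rfl h
      | cons a s ih =>
        intro h _
        have ha := h a (Multiset.mem_cons_self a s)
        rw [Multiset.card_cons, Multiset.map_cons, Multiset.prod_cons, norm_mul, pow_succ']
        rcases eq_or_ne s 0 with rfl | hs
        · simpa using ha
        · exact mul_lt_mul'' ha (ih (fun y hy => h y (Multiset.mem_cons_of_mem hy)) hs) hη.le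
            (by positivity)
    have := key _ hcon (by rw [← Multiset.card_pos, hcard]; omega)
    rw [hcard] at this
    linarith
  have hyx' : ‖y - x‖ ≤ η := by rwa [norm_sub_rev]
  have hyB : ‖y‖ ≤ B := by
    calc ‖y‖ = ‖(y - x) + x‖ := by rw [sub_add_cancel]
      _ ≤ max _ _ := IsUltrametricDist.norm_add_le_max _ _
      _ ≤ B := max_le (hyx'.trans hηB) hx
  refine ⟨y, hyB, hyx', ?_⟩
  have := hdiff y hyB
  rwa [(mem_roots'.1 hy).2, sub_zero] at this

/-- A complete ultrametric field with a dense algebraically closed subfield is algebraically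
closed. -/
theorem isAlgClosed_of_denseRange [CompleteSpace L] (hd : DenseRange (algebraMap K L)) :
    IsAlgClosed L := by
  refine IsAlgClosed.of_exists_root L fun f hf hirr => ?_
  have hf0 : f.natDegree ≠ 0 := hirr.natDegree_pos.ne'
  set B : ℝ := max 1 ‖f.eval 0‖ with hBdef
  have hB : 1 ≤ B := le_max_left _ _
  have hstep : ∀ (k : ℕ) (x : {x : L // ‖x‖ ≤ B ∧ ‖f.eval x‖ ≤ (B / 2 ^ k) ^ f.natDegree}),
      ∃ y : {x : L // ‖x‖ ≤ B ∧ ‖f.eval x‖ ≤ (B / 2 ^ (k + 1)) ^ f.natDegree},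
        ‖y.1 - x.1‖ ≤ B / 2 ^ k := by
    intro k x
    obtain ⟨y, h1, h2, h3⟩ := exists_improved_root hd hf hf0 hB (η := B / 2 ^ k) (by positivity)
      (div_le_self (by linarith) (one_le_pow₀ (by norm_num))) x.2.1 x.2.2
    exact ⟨⟨y, h1, by rwa [pow_succ, ← div_div]⟩, h2⟩
  choose next hnext using hstep
  let s : (k : ℕ) → {x : L // ‖x‖ ≤ B ∧ ‖f.eval x‖ ≤ (B / 2 ^ k) ^ f.natDegree} := fun k =>
    Nat.rec ⟨0, by simpa using (by linarith : (0 : ℝ) ≤ B), by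
      rw [pow_zero, div_one]
      exact (le_max_right _ _).trans (le_self_pow₀ hB hf0)⟩ (fun k x => next k x) k
  have hs : ∀ k, ‖(s (k + 1)).1 - (s k).1‖ ≤ B / 2 ^ k := fun k => hnext k (s k)
  have hcau : CauchySeq fun k => (s k).1 := by
    refine cauchySeq_of_le_geometric (1 / 2) B (by norm_num) fun k => ?_
    rw [dist_comm, dist_eq_norm]
    refine (hs k).trans_eq ?_
    rw [one_div, inv_pow]; rfl
  obtain ⟨x, hx⟩ := cauchySeq_tendsto_of_complete hcau
  refine ⟨x, ?_⟩
  have h1 : Filter.Tendsto (fun k => f.eval (s k).1) Filter.atTop (nhds (f.eval x)) :=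
    (f.continuous.tendsto x).comp hx
  have h2 : Filter.Tendsto (fun k => f.eval (s k).1) Filter.atTop (nhds 0) := by
    refine squeeze_zero_norm (fun k => (s k).2.2) ?_
    have h3 : Filter.Tendsto (fun k : ℕ => B / 2 ^ k) Filter.atTop (nhds 0) := by
      have := (tendsto_pow_atTop_nhds_zero_of_lt_one (r := (1 / 2 : ℝ)) (by norm_num)
        (by norm_num)).const_mul B
      simpa [div_eq_mul_inv] using this
    simpa [hf0] using h3.pow f.natDegree
  exact tendsto_nhds_unique h1 h2

end AlgClosed

/-! ### The field `ℂ_∞` -/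

section FieldFacts

variable {F : Type u} [Field F] [Fintype F]

instance : IsUltrametricDist (KInfAlg F) :=
  IsUltrametricDist.isUltrametricDist_of_forall_norm_add_le_max_norm
    (isNonarchimedean_spectralNorm (K := KInf F) (L := KInfAlg F))

instance : IsUltrametricDist (CInf F) := by
  refine IsUltrametricDist.isUltrametricDist_of_forall_norm_add_le_max_norm fun x y => ?_
  refine UniformSpace.Completion.induction_on₂ x y ?_ fun a b => ?_
  · exact isClosed_le (by fun_prop) (by fun_prop)
  · rw [← UniformSpace.Completion.coe_add]
    simp only [UniformSpace.Completion.norm_coe]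
    exact IsUltrametricDist.norm_add_le_max a b

instance : IsAlgClosed (CInf F) :=
  isAlgClosed_of_denseRange (K := KInfAlg F) UniformSpace.Completion.denseRange_coe

lemma norm_ofKInf (x : KInf F) : ‖ofKInf F x‖ = ‖x‖ := by
  change ‖((algebraMap (KInf F) (KInfAlg F) x : KInfAlg F) : CInf F)‖ = _
  rw [UniformSpace.Completion.norm_coe]
  exact spectralNorm_extends (K := KInf F) (L := KInfAlg F) x

lemma norm_kInf_eq (x : KInf F) :
    ‖x‖ = WithZeroMulInt.toNNReal (one_lt_q F).ne_zero (Valued.v x) := by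
  rw [Valued.toNormedField.norm_def]
  change ((WithZeroMulInt.toNNReal (one_lt_q F).ne_zero
    (MonoidWithZeroHom.ValueGroup₀.embedding (Valued.v.restrict x)) : ℝ≥0) : ℝ) = _
  rw [Valuation.embedding_restrict]

lemma exists_norm_ofKInf_eq_zpow {x : KInf F} (hx : x ≠ 0) :
    ∃ n : ℤ, ‖ofKInf F x‖ = (q F : ℝ) ^ n := by
  rw [norm_ofKInf, norm_kInf_eq, WithZeroMulInt.toNNReal_neg_apply _ ((Valuation.ne_zero_iff _).2 hx)]
  exact ⟨_, by push_cast; rfl⟩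

lemma norm_ofA {a : F[X]} (ha : a ≠ 0) : ‖ofA F a‖ = (q F : ℝ) ^ a.natDegree := by
  classical
  change ‖ofKInf F (algebraMap (RatFunc F) (KInf F) (algebraMap F[X] (RatFunc F) a))‖ = _
  -- the valuation on `K_∞` extends the degree valuation on `F(T)`
  have h : Valued.v (algebraMap (RatFunc F) (KInf F) (algebraMap F[X] (RatFunc F) a))
      = @RatFunc.inftyValuation F _ (Classical.decEq _) (algebraMap F[X] (RatFunc F) a) :=
    @Valued.extensionValuation_apply_coe _ _ _ _
      (@RatFunc.inftyValued F _ (Classical.decEq _)) (algebraMap F[X] (RatFunc F) a)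
  rw [norm_ofKInf, norm_kInf_eq, h, RatFunc.inftyValuation_apply,
    RatFunc.inftyValuation.polynomial (F := F) ha,
    WithZeroMulInt.toNNReal_neg_apply _ WithZero.exp_ne_zero]
  simp [WithZero.exp]

lemma one_lt_q_real : (1 : ℝ) < q F := by exact_mod_cast one_lt_q F

lemma norm_ofA_X : ‖ofA F X‖ = q F := by
  rw [norm_ofA X_ne_zero, natDegree_X, pow_one]

instance : CharP (CInf F) (ringChar F) :=
  charP_of_injective_ringHom (f := (ofA F).comp C) ((ofA F).comp C).injective (ringChar F)

instance : Fact (ringChar F).Prime :=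
  ⟨CharP.char_is_prime F (ringChar F)⟩

lemma exists_q_eq_pow : ∃ n : ℕ, q F = ringChar F ^ n := by
  obtain ⟨n, -, hn⟩ := FiniteField.card F (ringChar F)
  exact ⟨n, hn⟩

end FieldFacts

/-! ### Gauss norms of polynomials on circles -/

section CircleNorm

variable {L : Type*} [NormedField L]

/-- The Gauss norm on the disc of radius `r` about `0` of the polynomial with leading coefficient
`c` and roots `ρ`, given by its value `|c| ∏ max(r, |ρ|)`; the polynomial is assumed to split
wherever this is used. -/
def circleNorm (P : L[X]) (r : ℝ) : ℝ :=
  ‖P.leadingCoeff‖ * (P.roots.map fun ρ => max r ‖ρ‖).prod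

lemma multiset_norm_prod (s : Multiset L) (w : L) :
    ‖(s.map (w - ·)).prod‖ = (s.map fun ρ => ‖w - ρ‖).prod := by
  induction s using Multiset.induction with
  | empty => simp
  | cons a s ih => simp [ih]

lemma norm_eval_eq_circleNorm [IsAlgClosed L] (P : L[X]) {w : L} {r : ℝ}
    (hw : ∀ ρ ∈ P.roots, ‖w - ρ‖ = max r ‖ρ‖) : ‖P.eval w‖ = circleNorm P r := by
  rw [(IsAlgClosed.splits P).eval_eq_prod_roots w, norm_mul, multiset_norm_prod, circleNorm]
  congr 2
  exact Multiset.map_congr rfl hw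

lemma circleNorm_pos {P : L[X]} (hP : P ≠ 0) {r : ℝ} (hr : 0 < r) : 0 < circleNorm P r := by
  refine mul_pos (norm_pos_iff.2 (leadingCoeff_ne_zero.2 hP)) (Multiset.prod_pos ?_)
  intro a ha
  obtain ⟨ρ, -, rfl⟩ := Multiset.mem_map.1 ha
  exact lt_max_of_lt_left hr

lemma circleNorm_nonneg (P : L[X]) {r : ℝ} (hr : 0 < r) : 0 ≤ circleNorm P r := by
  rcases eq_or_ne P 0 with rfl | hP
  · simp [circleNorm]
  · exact (circleNorm_pos hP hr).le

lemma circleNorm_mono (P : L[X]) {r s : ℝ} (hr : 0 < r) (hrs : r ≤ s) :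
    circleNorm P r ≤ circleNorm P s := by
  refine mul_le_mul_of_nonneg_left ?_ (norm_nonneg _)
  exact Multiset.prod_map_le_prod_map₀ _ _ (fun ρ _ => le_max_of_le_left hr.le)
    fun ρ _ => max_le_max_right _ hrs

lemma continuous_circleNorm (P : L[X]) : Continuous (circleNorm P) := by
  unfold circleNorm
  refine continuous_const.mul ?_
  exact continuous_multiset_prod P.roots fun ρ _ => continuous_id.max continuous_const

lemma multiset_prod_rpow {ι : Type*} (s : Multiset ι) (f : ι → ℝ) (hf : ∀ x, 0 ≤ f x) (θ : ℝ) :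
    (s.map fun x => f x ^ θ).prod = (s.map f).prod ^ θ := by
  induction s using Multiset.induction with
  | empty => simp
  | cons a s ih =>
    simp only [Multiset.map_cons, Multiset.prod_cons]
    rw [ih, Real.mul_rpow (hf a)
      (Multiset.prod_nonneg fun y hy => by obtain ⟨x, -, rfl⟩ := Multiset.mem_map.1 hy; exact hf x)]

lemma circleNorm_rpow_mul_rpow (P : L[X]) {a b : ℝ} (ha : 0 < a) (hb : 0 < b) (θ : ℝ) :
    circleNorm P a ^ (1 - θ) * circleNorm P b ^ θ = ‖P.leadingCoeff‖ *
      (P.roots.map fun ρ => (max a ‖ρ‖) ^ (1 - θ) * (max b ‖ρ‖) ^ θ).prod := by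
  have h : ∀ {c : ℝ}, 0 < c → ∀ ρ : L, 0 ≤ max c ‖ρ‖ := fun hc ρ => le_max_of_le_left hc.le
  have h' : ∀ {c : ℝ}, 0 < c → 0 ≤ (P.roots.map fun ρ => max c ‖ρ‖).prod := fun hc =>
    Multiset.prod_nonneg fun y hy => by obtain ⟨x, -, rfl⟩ := Multiset.mem_map.1 hy; exact h hc x
  rw [Multiset.prod_map_mul, multiset_prod_rpow _ _ (h ha), multiset_prod_rpow _ _ (h hb),
    circleNorm, circleNorm, Real.mul_rpow (norm_nonneg _) (h' ha),
    Real.mul_rpow (norm_nonneg _) (h' hb)]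
  rcases eq_or_ne P 0 with rfl | hP
  · have : (0 : ℝ) ^ (1 - θ) * 0 ^ θ = 0 := by
      rcases eq_or_ne θ 0 with rfl | hθ
      · simp
      · simp [Real.zero_rpow hθ]
    simp only [leadingCoeff_zero, norm_zero, roots_zero, Multiset.map_zero, Multiset.prod_zero,
      Real.one_rpow, mul_one, this]
  · have hc : 0 < ‖P.leadingCoeff‖ := norm_pos_iff.2 (leadingCoeff_ne_zero.2 hP)
    have : ‖P.leadingCoeff‖ ^ (1 - θ) * ‖P.leadingCoeff‖ ^ θ = ‖P.leadingCoeff‖ := by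
      rw [← Real.rpow_add hc, sub_add_cancel, Real.rpow_one]
    rw [mul_mul_mul_comm, this]

/-- Hadamard's three circles theorem: each factor `r ↦ max r |ρ|` is logarithmically convex. -/
lemma circleNorm_le_rpow (P : L[X]) {a b θ : ℝ} (ha : 0 < a) (hb : 0 < b) (h0 : 0 ≤ θ)
    (h1 : θ ≤ 1) :
    circleNorm P (a ^ (1 - θ) * b ^ θ) ≤ circleNorm P a ^ (1 - θ) * circleNorm P b ^ θ := by
  rw [circleNorm_rpow_mul_rpow P ha hb θ]
  refine mul_le_mul_of_nonneg_left ?_ (norm_nonneg _)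
  refine Multiset.prod_map_le_prod_map₀ _ _ (fun ρ _ => le_max_of_le_left (by positivity))
    fun ρ _ => max_le ?_ ?_
  · gcongr
    · exact le_max_left _ _
    · exact le_max_left _ _
  · rcases eq_or_ne ρ 0 with rfl | hρ
    · rw [norm_zero]
      positivity
    · have hρ' : 0 < ‖ρ‖ := norm_pos_iff.2 hρ
      calc ‖ρ‖ = ‖ρ‖ ^ (1 - θ) * ‖ρ‖ ^ θ := by
            rw [← Real.rpow_add hρ', sub_add_cancel, Real.rpow_one]
        _ ≤ _ := by
            gcongr
            · exact le_max_right _ _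
            · exact le_max_right _ _

/-- On an annulus without zeros the three circles inequality is an equality. -/
lemma circleNorm_eq_rpow (Q : L[X]) {a b θ : ℝ} (ha : 0 < a) (hab : a ≤ b) (h0 : 0 ≤ θ)
    (h1 : θ ≤ 1) (hQ : ∀ ρ ∈ Q.roots, ‖ρ‖ ≤ a ∨ b ≤ ‖ρ‖) :
    circleNorm Q (a ^ (1 - θ) * b ^ θ) = circleNorm Q a ^ (1 - θ) * circleNorm Q b ^ θ := by
  have hb : 0 < b := ha.trans_le hab
  rw [circleNorm_rpow_mul_rpow Q ha hb θ, circleNorm]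
  congr 2
  refine Multiset.map_congr rfl fun ρ hρ => ?_
  have hsplit : ∀ c : ℝ, 0 < c → c ^ (1 - θ) * c ^ θ = c := fun c hc => by
    rw [← Real.rpow_add hc, sub_add_cancel, Real.rpow_one]
  rcases hQ ρ hρ with h | h
  · rw [max_eq_left h, max_eq_left (h.trans hab), max_eq_left]
    refine h.trans ?_
    conv_lhs => rw [← hsplit a ha]
    gcongr
  · rw [max_eq_right (hab.trans h), max_eq_right h, hsplit _ (hb.trans_le h), max_eq_right]
    refine le_trans ?_ h
    conv_rhs => rw [← hsplit b hb]
    gcongr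

variable [IsUltrametricDist L]

lemma norm_sub_eq_max_of_ne {w ρ : L} (h : ‖w‖ ≠ ‖ρ‖) : ‖w - ρ‖ = max ‖w‖ ‖ρ‖ := by
  rw [sub_eq_add_neg, IsUltrametricDist.norm_add_eq_max_of_norm_ne_norm (by rwa [norm_neg]),
    norm_neg]

variable [IsAlgClosed L]

lemma norm_eval_le_circleNorm (P : L[X]) {w : L} {r : ℝ} (hw : ‖w‖ ≤ r) :
    ‖P.eval w‖ ≤ circleNorm P r := by
  rw [(IsAlgClosed.splits P).eval_eq_prod_roots w, norm_mul, multiset_norm_prod]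
  refine mul_le_mul_of_nonneg_left ?_ (norm_nonneg _)
  refine Multiset.prod_map_le_prod_map₀ _ _ (fun ρ _ => norm_nonneg _) fun ρ _ => ?_
  rw [sub_eq_add_neg]
  refine (IsUltrametricDist.norm_add_le_max _ _).trans ?_
  rw [norm_neg]
  exact max_le_max_right _ hw

lemma norm_eval_eq_circleNorm_of_ne (P : L[X]) {w : L} (hw : ∀ ρ ∈ P.roots, ‖ρ‖ ≠ ‖w‖) :
    ‖P.eval w‖ = circleNorm P ‖w‖ :=
  norm_eval_eq_circleNorm P fun ρ hρ => norm_sub_eq_max_of_ne (hw ρ hρ).symm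

lemma norm_eval_lt_of_circleNorm_lt (P Q : L[X]) {c : ℝ} {w : L}
    (hP : ∀ ρ ∈ P.roots, ‖ρ‖ ≠ ‖w‖) (hQ : ∀ ρ ∈ Q.roots, ‖ρ‖ ≠ ‖w‖)
    (h : c * circleNorm Q ‖w‖ < circleNorm P ‖w‖) : c * ‖Q.eval w‖ < ‖P.eval w‖ := by
  rwa [norm_eval_eq_circleNorm_of_ne P hP, norm_eval_eq_circleNorm_of_ne Q hQ]

end CircleNorm

/-! ### Geometry of the Drinfeld upper half plane -/

section Geometry

variable {F : Type u} [Field F] [Fintype F]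

/-- The value group of `ℂ_∞` is dense, since `ℂ_∞` contains the roots of powers of `T`. -/
lemma exists_norm_mem_Ioo {a b : ℝ} (ha : 0 < a) (hab : a < b) :
    ∃ w : CInf F, a < ‖w‖ ∧ ‖w‖ < b := by
  have hq := one_lt_q_real (F := F)
  obtain ⟨m, hm⟩ := pow_unbounded_of_one_lt (q F : ℝ) ((one_lt_div ha).2 hab)
  have hm0 : m ≠ 0 := by rintro rfl; rw [pow_zero] at hm; linarith
  obtain ⟨n, hn1, hn2⟩ := exists_mem_Ico_zpow (pow_pos ha m) hq
  obtain ⟨w, hw⟩ := IsAlgClosed.exists_pow_nat_eq (ofA F X ^ (n + 1)) (Nat.pos_of_ne_zero hm0)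
  have hw' : ‖w‖ ^ m = (q F : ℝ) ^ (n + 1) := by
    rw [← norm_pow, hw, norm_zpow, norm_ofA_X]
  refine ⟨w, lt_of_pow_lt_pow_left₀ m (norm_nonneg _) (by rwa [hw']),
    lt_of_pow_lt_pow_left₀ m (ha.trans hab).le ?_⟩
  rw [hw', zpow_add_one₀ (by positivity), mul_comm]
  rw [div_pow, lt_div_iff₀ (pow_pos ha m)] at hm
  exact (mul_le_mul_of_nonneg_left hn1 (by linarith)).trans_lt hm

lemma exists_norm_mem_Ioo_not_mem {a b : ℝ} (ha : 0 < a) (hab : a < b) (s : Finset ℝ) :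
    ∃ w : CInf F, a < ‖w‖ ∧ ‖w‖ < b ∧ ‖w‖ ∉ s := by
  induction s using Finset.induction generalizing a b with
  | empty => simpa using exists_norm_mem_Ioo ha hab
  | insert x s _ ih =>
    -- one of the two halves of the interval avoids `x`
    rcases le_or_gt x ((a + b) / 2) with hx | hx
    · obtain ⟨w, h1, h2, h3⟩ := ih (a := (a + b) / 2) (b := b) (by linarith) (by linarith)
      refine ⟨w, by linarith, h2, ?_⟩
      rw [Finset.mem_insert, not_or]
      exact ⟨by linarith, h3⟩
    · obtain ⟨w, h1, h2, h3⟩ := ih (a := a) (b := (a + b) / 2) ha (by linarith)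
      refine ⟨w, h1, by linarith, ?_⟩
      rw [Finset.mem_insert, not_or]
      exact ⟨by linarith, h3⟩

lemma imagAbs_le_norm_sub (z : CInf F) (x : KInf F) : imagAbs z ≤ ‖z - ofKInf F x‖ := by
  rw [← dist_eq_norm]
  exact Metric.infDist_le_dist_of_mem ⟨x, rfl⟩

lemma imagAbs_le_norm (z : CInf F) : imagAbs z ≤ ‖z‖ := by
  simpa using imagAbs_le_norm_sub z 0

lemma le_imagAbs {z : CInf F} {r : ℝ} (h : ∀ x, r ≤ ‖z - ofKInf F x‖) : r ≤ imagAbs z := by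
  refine (Metric.le_infDist (Set.range_nonempty _)).2 ?_
  rintro _ ⟨x, rfl⟩
  rw [dist_eq_norm]
  exact h x

lemma exists_norm_sub_lt {z : CInf F} {r : ℝ} (h : imagAbs z < r) :
    ∃ x, ‖z - ofKInf F x‖ < r := by
  by_contra! hcon
  exact absurd (le_imagAbs hcon) (not_le.2 h)

lemma imagAbs_add_ofKInf (z : CInf F) (x : KInf F) : imagAbs (z + ofKInf F x) = imagAbs z := by
  have h : ∀ (z : CInf F) (x : KInf F), imagAbs z ≤ imagAbs (z + ofKInf F x) := fun z x =>
    le_imagAbs fun y => by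
      have := imagAbs_le_norm_sub z (y - x)
      rwa [map_sub, ← sub_add, sub_add_eq_add_sub] at this
  refine le_antisymm ?_ (h z x)
  simpa using h (z + ofKInf F x) (-x)

lemma imagAbs_ofKInf_mul {x : KInf F} (hx : x ≠ 0) (z : CInf F) :
    imagAbs (ofKInf F x * z) = ‖ofKInf F x‖ * imagAbs z := by
  have h : ∀ {x : KInf F}, x ≠ 0 → ∀ z : CInf F,
      ‖ofKInf F x‖ * imagAbs z ≤ imagAbs (ofKInf F x * z) := fun {x} hx z =>
    le_imagAbs fun y => by
      have hx' : ofKInf F x ≠ 0 := (_root_.map_ne_zero _).2 hx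
      have := mul_le_mul_of_nonneg_left (imagAbs_le_norm_sub z (y / x)) (norm_nonneg (ofKInf F x))
      rwa [← norm_mul, mul_sub, map_div₀, mul_div_cancel₀ _ hx'] at this
  have hx' : ofKInf F x ≠ 0 := (_root_.map_ne_zero _).2 hx
  refine le_antisymm ?_ (h hx z)
  have := h (inv_ne_zero hx) (ofKInf F x * z)
  rwa [map_inv₀, inv_mul_cancel_left₀ hx', norm_inv,
    inv_mul_le_iff₀ (norm_pos_iff.2 hx')] at this

lemma isClosed_range_ofKInf : IsClosed (Set.range (ofKInf F)) := by
  have : Isometry (ofKInf F) := AddMonoidHomClass.isometry_of_norm _ norm_ofKInf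
  exact this.isClosedEmbedding.isClosed_range

lemma imagAbs_pos_iff {z : CInf F} : 0 < imagAbs z ↔ z ∉ Set.range (ofKInf F) :=
  (isClosed_range_ofKInf.notMem_iff_infDist_pos (Set.range_nonempty _)).symm

lemma imagAbs_pos (z : Omega F) : 0 < imagAbs z.1 := imagAbs_pos_iff.2 z.2

lemma norm_ofKInf_ne_of_mem_Ioo {r : ℝ} {l : ℤ} (h1 : (q F : ℝ) ^ l < r)
    (h2 : r < (q F : ℝ) ^ (l + 1)) (x : KInf F) : ‖ofKInf F x‖ ≠ r := by
  rintro rfl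
  have hx : x ≠ 0 := by
    rintro rfl
    rw [map_zero, norm_zero] at h1
    exact absurd h1 (not_lt.2 (by positivity))
  obtain ⟨n, hn⟩ := exists_norm_ofKInf_eq_zpow hx
  rw [hn] at h1 h2
  have h3 := (zpow_lt_zpow_iff_right₀ one_lt_q_real).1 h1
  have h4 := (zpow_lt_zpow_iff_right₀ one_lt_q_real).1 h2
  omega

lemma imagAbs_eq_norm_of_ne {w : CInf F} (hw : ∀ x, ‖ofKInf F x‖ ≠ ‖w‖) : imagAbs w = ‖w‖ := by
  refine le_antisymm (imagAbs_le_norm w) (le_imagAbs fun x => ?_)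
  rw [norm_sub_eq_max_of_ne (hw x).symm]
  exact le_max_left _ _

lemma imagAbs_eq_norm_of_mem_Ioo {w : CInf F} {l : ℤ} (h1 : (q F : ℝ) ^ l < ‖w‖)
    (h2 : ‖w‖ < (q F : ℝ) ^ (l + 1)) : imagAbs w = ‖w‖ :=
  imagAbs_eq_norm_of_ne (norm_ofKInf_ne_of_mem_Ioo h1 h2)

/-- The infimum defining the imaginary part is attained. -/
lemma exists_norm_sub_eq_imagAbs {z : CInf F} (hz : 0 < imagAbs z) :
    ∃ x, ‖z - ofKInf F x‖ = imagAbs z := by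
  obtain ⟨l, h1, h2⟩ := exists_mem_Ico_zpow hz (one_lt_q_real (F := F))
  obtain ⟨x, hx⟩ := exists_norm_sub_lt h2
  refine ⟨x, ?_⟩
  have h3 := imagAbs_le_norm_sub z x
  have h4 : imagAbs (z - ofKInf F x) = imagAbs z := by
    rw [sub_eq_add_neg, ← map_neg, imagAbs_add_ofKInf]
  rcases (h1.trans h3).eq_or_lt with h5 | h5
  · linarith
  · rw [← h4, imagAbs_eq_norm_of_mem_Ioo h5 hx]

end Geometry

/-! ### The identity theorem on the Drinfeld upper half plane -/

section Identity

variable {F : Type u} [Field F] [Fintype F]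

/-- Rigid analyticity on `Ω`, for a function given on all of `ℂ_∞` (its values on `K_∞` are
irrelevant). -/
def IsHolomorphicOn (g : CInf F → CInf F) : Prop :=
  ∀ n : ℕ, ∀ ε : ℝ, 0 < ε → ∃ P Q : (CInf F)[X], ∀ z : CInf F,
    ‖z‖ ≤ (q F : ℝ) ^ n → ((q F : ℝ) ^ n)⁻¹ ≤ imagAbs z →
      Q.eval z ≠ 0 ∧ ‖g z - P.eval z / Q.eval z‖ ≤ ε

lemma norm_add_le_pow_max {z x : CInf F} {n m : ℕ} (hz : ‖z‖ ≤ (q F : ℝ) ^ n)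
    (hx : ‖x‖ ≤ (q F : ℝ) ^ m) : ‖z + x‖ ≤ (q F : ℝ) ^ max n m := by
  have hq := (one_lt_q_real (F := F)).le
  exact (IsUltrametricDist.norm_add_le_max _ _).trans (max_le
    (hz.trans (pow_le_pow_right₀ hq (le_max_left _ _)))
    (hx.trans (pow_le_pow_right₀ hq (le_max_right _ _))))

lemma IsHolomorphicOn.comp_add {g : CInf F → CInf F} (hg : IsHolomorphicOn g) (x : KInf F) :
    IsHolomorphicOn fun w => g (w + ofKInf F x) := by
  intro n ε hε
  obtain ⟨m, hm⟩ := pow_unbounded_of_one_lt ‖ofKInf F x‖ (one_lt_q_real (F := F))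
  obtain ⟨P, Q, h⟩ := hg (max n m) ε hε
  refine ⟨P.comp (X + C (ofKInf F x)), Q.comp (X + C (ofKInf F x)), fun z hz hz' => ?_⟩
  have := h (z + ofKInf F x) (norm_add_le_pow_max hz hm.le) (by
    rw [imagAbs_add_ofKInf]
    refine le_trans ?_ hz'
    have hq := (one_lt_q_real (F := F))
    gcongr
    · exact hq.le
    · exact le_max_left _ _)
  simpa [eval_comp] using this

/-- If a rational function is bounded on an open annulus then its Gauss norm on the inner boundary
circle satisfies the same bound. -/
lemma circleNorm_le_of_annulus {P Q : (CInf F)[X]} {a b ε : ℝ} (ha : 0 < a) (hab : a < b)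
    (h : ∀ w : CInf F, a < ‖w‖ → ‖w‖ < b → ‖P.eval w‖ ≤ ε * ‖Q.eval w‖) :
    circleNorm P a ≤ ε * circleNorm Q a := by
  by_contra! hcon
  have hev : ∀ᶠ r in nhds a, ε * circleNorm Q r < circleNorm P r :=
    ((continuous_circleNorm Q).const_mul ε).continuousAt.eventually_lt
      (continuous_circleNorm P).continuousAt hcon
  obtain ⟨δ, hδ, hball⟩ := Metric.eventually_nhds_iff.1 hev
  -- a radius near `a` that is the absolute value of no zero and no pole
  obtain ⟨w, h1, h2, h3⟩ := exists_norm_mem_Ioo_not_mem (F := F) ha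
    (lt_min hab (by linarith : a < a + δ))
    ((P.roots.map norm).toFinset ∪ (Q.roots.map norm).toFinset)
  rw [Finset.mem_union, not_or, Multiset.mem_toFinset, Multiset.mem_toFinset] at h3
  have h4 : ε * circleNorm Q ‖w‖ < circleNorm P ‖w‖ := by
    refine hball ?_
    rw [Real.dist_eq, abs_lt]
    have := lt_min_iff.1 h2
    constructor <;> linarith
  refine absurd (h w h1 (lt_min_iff.1 h2).1) (not_le.2 ?_)
  exact norm_eval_lt_of_circleNorm_lt P Q
    (fun ρ hρ he => h3.1 (Multiset.mem_map.2 ⟨ρ, hρ, he⟩))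
    (fun ρ hρ he => h3.2 (Multiset.mem_map.2 ⟨ρ, hρ, he⟩)) h4

lemma norm_le_max_of_norm_sub_le {x y : CInf F} {ε M : ℝ} (h : ‖x - y‖ ≤ ε) (hy : ‖y‖ ≤ M) :
    ‖x‖ ≤ max ε M := by
  rw [← sub_add_cancel x y]
  exact (IsUltrametricDist.norm_add_le_max _ _).trans (max_le_max h hy)

/-- If `Q` has no zeros in the affinoid `|z| ≤ c`, `|z|_i ≥ a`, then on the points of this affinoid
with `|w|_i = |w|` its absolute value is its Gauss norm: no zero of `Q` lies in the same residue
disc of the circle as `w`. -/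
lemma norm_eval_eq_circleNorm_of_imagAbs {Q : (CInf F)[X]} {a c : ℝ}
    (hQ : ∀ z : CInf F, ‖z‖ ≤ c → a ≤ imagAbs z → Q.eval z ≠ 0) {w : CInf F}
    (hw : imagAbs w = ‖w‖) (hwa : a ≤ ‖w‖) (hwc : ‖w‖ ≤ c) :
    ‖Q.eval w‖ = circleNorm Q ‖w‖ := by
  refine norm_eval_eq_circleNorm Q fun ρ hρ => ?_
  rcases eq_or_ne ‖w‖ ‖ρ‖ with h | h
  · refine le_antisymm ?_ ?_
    · rw [sub_eq_add_neg, ← norm_neg ρ]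
      exact IsUltrametricDist.norm_add_le_max _ _
    · rw [← h, max_self]
      by_contra! hlt
      refine hQ ρ (h ▸ hwc) (le_imagAbs fun x => ?_) (mem_roots'.1 hρ).2
      have h1 : ‖w‖ ≤ ‖w - ofKInf F x‖ := hw ▸ imagAbs_le_norm_sub w x
      by_contra! h2
      have h3 : ‖w - ofKInf F x‖ ≤ max ‖w - ρ‖ ‖ρ - ofKInf F x‖ := by
        rw [← sub_add_sub_cancel w ρ]
        exact IsUltrametricDist.norm_add_le_max _ _
      exact absurd (h1.trans h3) (not_le.2 (max_lt hlt (h2.trans_le hwa)))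
  · exact norm_sub_eq_max_of_ne h

/-- One step of the identity theorem: vanishing for `|z|_i ≥ q^{l+1}` propagates to the points with
`|z|_i = |z| ≥ q^l`. On the annulus `q^l < |z| < q^{l+1}` an approximation of `g` up to `ε` is bounded
on the inner circle and at most `ε` on the outer one, so the three circles inequality bounds `g` by a
positive power of `ε`. -/
lemma IsHolomorphicOn.eq_zero_of_annulus {g : CInf F → CInf F} (hg : IsHolomorphicOn g) (l : ℤ)
    (h0 : ∀ z, (q F : ℝ) ^ (l + 1) ≤ imagAbs z → g z = 0) {w : CInf F} (hw : imagAbs w = ‖w‖)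
    (hwl : (q F : ℝ) ^ l ≤ ‖w‖) : g w = 0 := by
  have hq := one_lt_q_real (F := F)
  have hq0 : (0 : ℝ) < q F := by linarith
  rcases le_or_gt ((q F : ℝ) ^ (l + 1)) ‖w‖ with hwb | hwb
  · exact h0 w (hw ▸ hwb)
  set a : ℝ := (q F : ℝ) ^ l with ha
  set b : ℝ := (q F : ℝ) ^ (l + 1) with hb
  set c : ℝ := (q F : ℝ) ^ (l + 1 + 1) with hc
  have ha0 : 0 < a := by positivity
  have hb0 : 0 < b := by positivity
  have hab : a < b := zpow_lt_zpow_right₀ hq (by omega)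
  have hbc : b < c := zpow_lt_zpow_right₀ hq (by omega)
  -- approximation on the affinoid `|z| ≤ c`, `|z|_i ≥ a`
  have happ : ∀ ε : ℝ, 0 < ε → ∃ P Q : (CInf F)[X], ∀ z : CInf F, ‖z‖ ≤ c → a ≤ imagAbs z →
      Q.eval z ≠ 0 ∧ ‖g z - P.eval z / Q.eval z‖ ≤ ε := by
    intro ε hε
    obtain ⟨N, hN⟩ := pow_unbounded_of_one_lt (max c a⁻¹) hq
    obtain ⟨P, Q, h⟩ := hg N ε hε
    refine ⟨P, Q, fun z hz hz' => h z (hz.trans ((le_max_left _ _).trans hN.le)) ?_⟩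
    exact (inv_le_of_inv_le₀ ha0 ((le_max_right _ _).trans hN.le)).trans hz'
  -- points of the two open annuli
  have hann : ∀ z : CInf F, a < ‖z‖ → ‖z‖ < b → imagAbs z = ‖z‖ := fun z h1 h2 =>
    imagAbs_eq_norm_of_mem_Ioo h1 h2
  have hann' : ∀ z : CInf F, b < ‖z‖ → ‖z‖ < c → imagAbs z = ‖z‖ := fun z h1 h2 =>
    imagAbs_eq_norm_of_mem_Ioo h1 h2
  have hroots : ∀ {Q : (CInf F)[X]},
      (∀ z : CInf F, ‖z‖ ≤ c → a ≤ imagAbs z → Q.eval z ≠ 0) →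
      ∀ ρ ∈ Q.roots, ‖ρ‖ ≤ a ∨ b ≤ ‖ρ‖ := by
    intro Q hQ ρ hρ
    by_contra! hcon
    exact hQ ρ (hcon.2.trans hbc).le (by rw [hann ρ hcon.1 hcon.2]; exact hcon.1.le)
      (mem_roots'.1 hρ).2
  have hquot : ∀ {x y : CInf F} {M : ℝ}, y ≠ 0 → (‖x / y‖ ≤ M ↔ ‖x‖ ≤ M * ‖y‖) := by
    intro x y M hy
    rw [norm_div, div_le_iff₀ (norm_pos_iff.2 hy)]
  have hne : ∀ {Q : (CInf F)[X]}, (∀ z : CInf F, ‖z‖ ≤ c → a ≤ imagAbs z → Q.eval z ≠ 0) →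
      Q ≠ 0 := by
    rintro Q hQ rfl
    exact hQ w (hwb.trans hbc).le (hw ▸ hwl) (by simp)
  -- vanishing on the open annulus `a < |z| < b`
  have hin : ∀ z : CInf F, a < ‖z‖ → ‖z‖ < b → g z = 0 := by
    intro z hz1 hz2
    obtain ⟨P₁, Q₁, h₁⟩ := happ 1 one_pos
    have hQ₁ : ∀ z : CInf F, ‖z‖ ≤ c → a ≤ imagAbs z → Q₁.eval z ≠ 0 := fun z hz hz' =>
      (h₁ z hz hz').1
    have hQ₁pos : 0 < circleNorm Q₁ a := circleNorm_pos (hne hQ₁) ha0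
    set M : ℝ := max 1 (circleNorm P₁ b / circleNorm Q₁ a) with hM
    have hM1 : 1 ≤ M := le_max_left _ _
    have hgM : ∀ z : CInf F, a < ‖z‖ → ‖z‖ < b → ‖g z‖ ≤ M := by
      intro z h1 h2
      have hz := h₁ z (h2.trans hbc).le (by rw [hann z h1 h2]; exact h1.le)
      refine norm_le_max_of_norm_sub_le hz.2 ?_
      rw [norm_div]
      refine div_le_div₀ (circleNorm_nonneg P₁ hb0) (norm_eval_le_circleNorm P₁ h2.le) hQ₁pos ?_
      rw [norm_eval_eq_circleNorm_of_imagAbs hQ₁ (hann z h1 h2) h1.le (h2.trans hbc).le]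
      exact circleNorm_mono Q₁ ha0 h1.le
    set θ : ℝ := (Real.log ‖z‖ - Real.log a) / (Real.log b - Real.log a) with hθ
    have hz0 : 0 < ‖z‖ := ha0.trans hz1
    have hlog1 : 0 < Real.log b - Real.log a := sub_pos.2 (Real.log_lt_log ha0 hab)
    have hlog2 : 0 < Real.log ‖z‖ - Real.log a := sub_pos.2 (Real.log_lt_log ha0 hz1)
    have hlog3 : Real.log ‖z‖ - Real.log a ≤ Real.log b - Real.log a :=
      sub_le_sub_right (Real.log_le_log hz0 hz2.le) _
    have hθ0 : 0 < θ := div_pos hlog2 hlog1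
    have hθ1 : θ ≤ 1 := (div_le_one hlog1).2 hlog3
    have hzθ : a ^ (1 - θ) * b ^ θ = ‖z‖ := by
      refine Real.log_injOn_pos (Set.mem_Ioi.2 (by positivity)) (Set.mem_Ioi.2 hz0) ?_
      rw [Real.log_mul (by positivity) (by positivity), Real.log_rpow ha0, Real.log_rpow hb0, hθ]
      field_simp
      ring
    have hbound : ∀ ε : ℝ, 0 < ε → ε < 1 → ‖g z‖ ≤ max ε (M ^ (1 - θ) * ε ^ θ) := by
      intro ε hε hε1
      obtain ⟨P, Q, h⟩ := happ ε hε
      have hQ : ∀ z : CInf F, ‖z‖ ≤ c → a ≤ imagAbs z → Q.eval z ≠ 0 := fun z hz hz' =>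
        (h z hz hz').1
      have hPb : circleNorm P b ≤ ε * circleNorm Q b := by
        refine circleNorm_le_of_annulus hb0 hbc fun y h1 h2 => ?_
        have hy := h y h2.le (by rw [hann' y h1 h2]; exact (hab.trans h1).le)
        rw [h0 y (by rw [hann' y h1 h2]; exact h1.le), zero_sub, norm_neg] at hy
        exact (hquot hy.1).1 hy.2
      have hPa : circleNorm P a ≤ M * circleNorm Q a := by
        refine circleNorm_le_of_annulus ha0 hab fun y h1 h2 => ?_
        have hy := h y (h2.trans hbc).le (by rw [hann y h1 h2]; exact h1.le)
        refine (hquot hy.1).1 ?_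
        rw [norm_sub_rev] at hy
        exact (norm_le_max_of_norm_sub_le hy.2 (hgM y h1 h2)).trans
          (max_le (hε1.le.trans hM1) le_rfl)
      have hz := h z (hz2.trans hbc).le (by rw [hann z hz1 hz2]; exact hz1.le)
      refine norm_le_max_of_norm_sub_le hz.2 ((hquot hz.1).2 ?_)
      rw [norm_eval_eq_circleNorm_of_imagAbs hQ (hann z hz1 hz2) hz1.le (hz2.trans hbc).le]
      refine (norm_eval_le_circleNorm P le_rfl).trans ?_
      rw [← hzθ, circleNorm_eq_rpow Q ha0 hab.le hθ0.le hθ1 (hroots hQ)]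
      refine (circleNorm_le_rpow P ha0 hb0 hθ0.le hθ1).trans ?_
      have e1 : circleNorm P a ^ (1 - θ) ≤ (M * circleNorm Q a) ^ (1 - θ) :=
        Real.rpow_le_rpow (circleNorm_nonneg P ha0) hPa (by linarith)
      have e2 : circleNorm P b ^ θ ≤ (ε * circleNorm Q b) ^ θ :=
        Real.rpow_le_rpow (circleNorm_nonneg P hb0) hPb hθ0.le
      refine (mul_le_mul e1 e2 (Real.rpow_nonneg (circleNorm_nonneg P hb0) _)
        (Real.rpow_nonneg (mul_nonneg (by linarith) (circleNorm_nonneg Q ha0)) _)).trans_eq ?_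
      rw [Real.mul_rpow (by linarith) (circleNorm_nonneg Q ha0),
        Real.mul_rpow hε.le (circleNorm_nonneg Q hb0)]
      ring
    have hlim : Filter.Tendsto (fun ε : ℝ => max ε (M ^ (1 - θ) * ε ^ θ))
        (nhdsWithin 0 (Set.Ioi 0)) (nhds 0) := by
      have h1 : Filter.Tendsto (fun ε : ℝ => max ε (M ^ (1 - θ) * ε ^ θ)) (nhds 0)
          (nhds (max 0 (M ^ (1 - θ) * 0 ^ θ))) :=
        (continuous_id.max (continuous_const.mul
          (Real.continuous_rpow_const hθ0.le))).tendsto 0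
      rw [Real.zero_rpow hθ0.ne', mul_zero, max_self] at h1
      exact h1.mono_left nhdsWithin_le_nhds
    refine norm_le_zero_iff.1 (ge_of_tendsto hlim ?_)
    filter_upwards [Ioo_mem_nhdsGT (one_pos : (0 : ℝ) < 1)] with ε hε using hbound ε hε.1 hε.2
  -- vanishing on the inner boundary circle
  rcases hwl.eq_or_lt with hwa | hwa
  · refine norm_le_zero_iff.1 (le_of_forall_pos_le_add fun ε hε => ?_)
    rw [zero_add]
    obtain ⟨P, Q, h⟩ := happ ε hε
    have hPa : circleNorm P a ≤ ε * circleNorm Q a := by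
      refine circleNorm_le_of_annulus ha0 hab fun y h1 h2 => ?_
      have hy := h y (h2.trans hbc).le (by rw [hann y h1 h2]; exact h1.le)
      rw [hin y h1 h2, zero_sub, norm_neg] at hy
      exact (hquot hy.1).1 hy.2
    have hz := h w (hwb.trans hbc).le (hw ▸ hwl)
    refine (norm_le_max_of_norm_sub_le hz.2 ((hquot hz.1).2 ?_)).trans_eq (max_self ε)
    rw [norm_eval_eq_circleNorm_of_imagAbs (fun z hz hz' => (h z hz hz').1) hw hwl
      (hwb.trans hbc).le, ← hwa]
    exact (norm_eval_le_circleNorm P hwa.ge).trans hPa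
  · exact hin w hwa hwb

/-- The identity theorem: a rigid analytic function on `Ω` that vanishes in a neighbourhood of
infinity vanishes identically. -/
theorem IsHolomorphicOn.eq_zero {g : CInf F → CInf F} (hg : IsHolomorphicOn g) {R : ℝ}
    (h0 : ∀ z, 0 < imagAbs z → R ≤ imagAbs z → g z = 0) {z : CInf F} (hz : 0 < imagAbs z) :
    g z = 0 := by
  have hq := one_lt_q_real (F := F)
  have hq0 : (0 : ℝ) < q F := by linarith
  obtain ⟨N, hN⟩ := pow_unbounded_of_one_lt R hq
  have key : ∀ k : ℕ, ∀ z, (q F : ℝ) ^ ((N : ℤ) - k) ≤ imagAbs z → g z = 0 := by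
    intro k
    induction k with
    | zero =>
      intro z hz
      simp only [Nat.cast_zero, sub_zero, zpow_natCast] at hz
      exact h0 z ((by positivity : (0 : ℝ) < q F ^ N).trans_le hz) (hN.le.trans hz)
    | succ k ih =>
      intro z hz
      obtain ⟨x, hx⟩ := exists_norm_sub_eq_imagAbs
        ((by positivity : (0 : ℝ) < (q F : ℝ) ^ ((N : ℤ) - (k + 1 : ℕ))).trans_le hz)
      have h1 : imagAbs (z - ofKInf F x) = imagAbs z := by
        rw [sub_eq_add_neg, ← map_neg, imagAbs_add_ofKInf]
      have := (hg.comp_add x).eq_zero_of_annulus ((N : ℤ) - (k + 1 : ℕ)) (fun y hy => by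
          refine ih (y + ofKInf F x) ?_
          rw [imagAbs_add_ofKInf]
          convert hy using 2
          push_cast; ring) (w := z - ofKInf F x) (by rw [h1, hx]) (by rw [hx]; exact hz)
      simpa using this
  obtain ⟨n, hn⟩ := exists_pow_lt_of_lt_one hz (inv_lt_one_of_one_lt₀ hq)
  refine key (N + n) z (le_trans ?_ hn.le)
  rw [inv_pow, ← zpow_natCast, ← zpow_neg]
  refine zpow_le_zpow_right₀ hq.le ?_
  push_cast; omega

/-- The difference `f - μ f'` of rigid analytic functions on `Ω`, extended by zero to `ℂ_∞`. -/
def extendSubSMul (μ : CInf F) (f f' : Omega F → CInf F) : CInf F → CInf F := by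
  classical
  exact fun z => if h : z ∉ Set.range (ofKInf F) then f ⟨z, h⟩ - μ * f' ⟨z, h⟩ else 0

lemma extendSubSMul_apply (μ : CInf F) (f f' : Omega F → CInf F) (z : Omega F) :
    extendSubSMul μ f f' z.1 = f z - μ * f' z := dif_pos z.2

lemma isHolomorphicOn_extendSubSMul (μ : CInf F) {f f' : Omega F → CInf F}
    (hf : IsHolomorphic f) (hf' : IsHolomorphic f') :
    IsHolomorphicOn (extendSubSMul μ f f') := by
  intro n ε hε
  obtain ⟨P, Q, h⟩ := hf n ε hε
  obtain ⟨P', Q', h'⟩ := hf' n (ε / (‖μ‖ + 1)) (by positivity)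
  refine ⟨P * Q' - C μ * P' * Q, Q * Q', fun z hz hz' => ?_⟩
  have hzΩ : z ∉ Set.range (ofKInf F) := by
    refine imagAbs_pos_iff.1 (lt_of_lt_of_le ?_ hz')
    have := one_lt_q_real (F := F)
    positivity
  obtain ⟨h1, h2⟩ := h ⟨z, hzΩ⟩ hz hz'
  obtain ⟨h3, h4⟩ := h' ⟨z, hzΩ⟩ hz hz'
  refine ⟨by simpa using ⟨h1, h3⟩, ?_⟩
  have e : extendSubSMul μ f f' z - (P * Q' - C μ * P' * Q).eval z / (Q * Q').eval z
      = (f ⟨z, hzΩ⟩ - P.eval z / Q.eval z)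
        + -(μ * (f' ⟨z, hzΩ⟩ - P'.eval z / Q'.eval z)) := by
    rw [extendSubSMul_apply μ f f' ⟨z, hzΩ⟩]
    dsimp only at h1 h3
    simp only [eval_sub, eval_mul, eval_C]
    field_simp
    ring
  rw [e]
  refine (IsUltrametricDist.norm_add_le_max _ _).trans (max_le h2 ?_)
  rw [norm_neg, norm_mul]
  calc ‖μ‖ * ‖f' ⟨z, hzΩ⟩ - P'.eval z / Q'.eval z‖ ≤ (‖μ‖ + 1) * (ε / (‖μ‖ + 1)) :=
        mul_le_mul (by linarith) h4 (norm_nonneg _) (by positivity)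
    _ = ε := by field_simp

/-- Rigid analytic functions on `Ω` which are proportional near infinity are proportional. -/
theorem eq_smul_of_eq_near_infinity {μ : CInf F} {f f' : Omega F → CInf F}
    (hf : IsHolomorphic f) (hf' : IsHolomorphic f') {R : ℝ}
    (h : ∀ z : Omega F, R ≤ imagAbs z.1 → f z = μ * f' z) : f = μ • f' := by
  have h0 : ∀ y, 0 < imagAbs y → R ≤ imagAbs y → extendSubSMul μ f f' y = 0 := by
    intro y hy hyR
    rw [← sub_eq_zero.2 (h ⟨y, imagAbs_pos_iff.1 hy⟩ hyR)]
    exact extendSubSMul_apply μ f f' ⟨y, imagAbs_pos_iff.1 hy⟩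
  funext z
  have h1 : extendSubSMul μ f f' z.1 = 0 :=
    (isHolomorphicOn_extendSubSMul μ hf hf').eq_zero h0 (imagAbs_pos z)
  exact sub_eq_zero.1 ((extendSubSMul_apply μ f f' z).symm.trans h1)

end Identity

variable {F : Type u} [Field F] [Fintype F]

/-! ### The polynomials of the Carlitz module -/

lemma q_cast_eq_zero (R : Type*) [CommRing R] [Algebra (CInf F) R] : (q F : R) = 0 := by
  obtain ⟨n, hn⟩ := exists_q_eq_pow (F := F)
  have hn0 : n ≠ 0 := by
    rintro rfl
    exact absurd hn (by rw [pow_zero]; exact Fintype.one_lt_card.ne')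
  have h : (q F : CInf F) = 0 := by
    rw [hn, Nat.cast_pow, CharP.cast_eq_zero, zero_pow hn0]
  rw [← map_natCast (algebraMap (CInf F) R), h, map_zero]

lemma q_pos : 0 < q F := Fintype.card_pos

lemma add_pow_q_pow {R : Type*} [CommRing R] [CharP R (ringChar F)] (x y : R) (i : ℕ) :
    (x + y) ^ q F ^ i = x ^ q F ^ i + y ^ q F ^ i := by
  obtain ⟨n, hn⟩ := exists_q_eq_pow (F := F)
  rw [hn, ← pow_mul]
  exact add_pow_char_pow x y _ _

lemma add_pow_q {R : Type*} [CommRing R] [CharP R (ringChar F)] (x y : R) :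
    (x + y) ^ q F = x ^ q F + y ^ q F := by
  simpa using add_pow_q_pow (F := F) x y 1

lemma ofA_C_pow_q_pow (c : F) (i : ℕ) : ofA F (C c) ^ q F ^ i = ofA F (C c) := by
  rw [← map_pow, ← C_pow, FiniteField.pow_card_pow]

/-- `ρ_a` is the universal polynomial expressing `ψ(a)` through `ψ(1)`, for an `F`-linear map `ψ`
on `A` satisfying the functional equation `ψ(T a) = T ψ(a) + ψ(a)^q`. -/
lemma aeval_carlitz {R : Type*} [CommRing R] [Algebra (CInf F) R] (ψ : F[X] →+ R)
    (hC : ∀ (c : F) (a : F[X]), ψ (C c * a) = algebraMap (CInf F) R (ofA F (C c)) * ψ a)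
    (hX : ∀ a : F[X], ψ (X * a) = algebraMap (CInf F) R (ofA F X) * ψ a + ψ a ^ q F)
    (a : F[X]) : aeval (ψ 1) (carlitz a) = ψ a := by
  have h : ∀ i, aeval (ψ 1) (carlitzTPow F i) = ψ (X ^ i) := by
    intro i
    induction i with
    | zero => simp [carlitzTPow]
    | succ i ih =>
      rw [carlitzTPow, map_add, map_mul, aeval_C, map_pow, ih, pow_succ', hX]
  conv_rhs => rw [a.as_sum_support_C_mul_X_pow]
  rw [carlitz, Polynomial.sum, map_sum, map_sum]
  exact Finset.sum_congr rfl fun i _ => by rw [map_mul, aeval_C, h, hC]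

lemma carlitz_one : carlitz (1 : F[X]) = X := by
  rw [carlitz, ← C_1, sum_C_index (by simp)]
  simp [carlitzTPow]

lemma derivative_carlitzTPow (i : ℕ) :
    derivative (carlitzTPow F i) = C (ofA F X ^ i) := by
  induction i with
  | zero => simp [carlitzTPow]
  | succ i ih =>
    rw [carlitzTPow, derivative_add, derivative_C_mul, ih, derivative_pow,
      q_cast_eq_zero (F := F) (CInf F), map_zero, zero_mul, zero_mul, add_zero, ← C_mul, pow_succ']

/-- The Carlitz module has derivative `a ↦ a`: all monomials of `ρ_a` but the linear one are
`p`-th powers. -/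
lemma derivative_carlitz (a : F[X]) : derivative (carlitz a) = C (ofA F a) := by
  conv_rhs => rw [a.as_sum_support_C_mul_X_pow]
  rw [carlitz, Polynomial.sum, derivative_sum, map_sum, map_sum]
  refine Finset.sum_congr rfl fun i _ => ?_
  rw [derivative_C_mul, derivative_carlitzTPow, ← C_mul, ← map_pow, ← map_mul]

lemma eval_zero_carlitzTPow (i : ℕ) : (carlitzTPow F i).eval 0 = 0 := by
  induction i with
  | zero => simp [carlitzTPow]
  | succ i ih => simp [carlitzTPow, ih, zero_pow q_pos.ne']

lemma eval_zero_carlitz (a : F[X]) : (carlitz a).eval 0 = 0 := by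
  rw [carlitz, Polynomial.sum, eval_finsetSum]
  exact Finset.sum_eq_zero fun i _ => by rw [eval_mul, eval_zero_carlitzTPow, mul_zero]

lemma degree_C_mul_le_degree (c : CInf F) (P : (CInf F)[X]) : (C c * P).degree ≤ P.degree := by
  rw [C_mul']
  exact degree_smul_le c P

lemma carlitzTPow_monic_natDegree (i : ℕ) :
    (carlitzTPow F i).Monic ∧ (carlitzTPow F i).natDegree = q F ^ i := by
  induction i with
  | zero => exact ⟨monic_X, by simp [carlitzTPow]⟩
  | succ i ih =>
    have hd : (carlitzTPow F i ^ q F).natDegree = q F ^ (i + 1) := by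
      rw [ih.1.natDegree_pow, ih.2, pow_succ']
    have hlt : (C (ofA F X) * carlitzTPow F i).degree < (carlitzTPow F i ^ q F).degree := by
      refine (degree_C_mul_le_degree _ _).trans_lt ?_
      rw [degree_eq_natDegree ih.1.ne_zero, degree_eq_natDegree (ih.1.pow _).ne_zero, hd, ih.2]
      exact_mod_cast Nat.pow_lt_pow_right Fintype.one_lt_card (Nat.lt_succ_self i)
    rw [carlitzTPow]
    exact ⟨(ih.1.pow _).add_of_right hlt, by rw [natDegree_add_eq_right_of_degree_lt hlt, hd]⟩

lemma carlitz_monic_natDegree {a : F[X]} (ha : a.Monic) :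
    (carlitz a).Monic ∧ (carlitz a).natDegree = q F ^ a.natDegree := by
  have hsum : carlitz a = (∑ i ∈ Finset.range a.natDegree,
      C (ofA F (C (a.coeff i))) * carlitzTPow F i) + carlitzTPow F a.natDegree := by
    rw [carlitz, sum_over_range a (by simp), Finset.sum_range_succ, ha.coeff_natDegree]
    simp
  obtain ⟨hm, hd⟩ := carlitzTPow_monic_natDegree (F := F) a.natDegree
  have hlt : (∑ i ∈ Finset.range a.natDegree,
      C (ofA F (C (a.coeff i))) * carlitzTPow F i).degree
        < (carlitzTPow F a.natDegree).degree := by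
    refine (degree_sum_le _ _).trans_lt ((Finset.sup_lt_iff ?_).2 fun i hi => ?_)
    · exact bot_lt_iff_ne_bot.2 (degree_eq_bot.not.2 hm.ne_zero)
    · refine (degree_C_mul_le_degree _ _).trans_lt ?_
      rw [degree_eq_natDegree hm.ne_zero, hd,
        degree_eq_natDegree (carlitzTPow_monic_natDegree i).1.ne_zero,
        (carlitzTPow_monic_natDegree i).2]
      exact_mod_cast Nat.pow_lt_pow_right Fintype.one_lt_card (Finset.mem_range.1 hi)
  rw [hsum]
  exact ⟨hm.add_of_right hlt, by rw [natDegree_add_eq_right_of_degree_lt hlt, hd]⟩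

/-! ### The Carlitz exponential -/

lemma ofA_X_pow_sub_norm {i j : ℕ} (h : j < i) :
    ‖ofA F X ^ q F ^ i - ofA F X ^ q F ^ j‖ = (q F : ℝ) ^ q F ^ i := by
  have hlt : (q F : ℝ) ^ q F ^ j < (q F : ℝ) ^ q F ^ i :=
    pow_lt_pow_right₀ one_lt_q_real (Nat.pow_lt_pow_right Fintype.one_lt_card h)
  rw [norm_sub_eq_max_of_ne (by rw [norm_pow, norm_pow, norm_ofA_X]; exact hlt.ne'), norm_pow,
    norm_pow, norm_ofA_X, max_eq_left hlt.le]

lemma norm_carlitzD (i : ℕ) : ‖carlitzD F i‖ = ((q F : ℝ) ^ i) ^ q F ^ i := by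
  rw [carlitzD, norm_prod, Finset.prod_congr rfl fun j hj =>
    ofA_X_pow_sub_norm (Finset.mem_range.1 hj), Finset.prod_const, Finset.card_range, ← pow_mul,
    ← pow_mul, mul_comm]

lemma carlitzD_ne_zero (i : ℕ) : carlitzD F i ≠ 0 := by
  rw [← norm_pos_iff, norm_carlitzD]
  have := one_lt_q_real (F := F)
  positivity

lemma carlitzD_succ (i : ℕ) :
    carlitzD F (i + 1) = (ofA F X ^ q F ^ (i + 1) - ofA F X) * carlitzD F i ^ q F := by
  rw [carlitzD, Finset.prod_range_succ', carlitzD, ← Finset.prod_pow, mul_comm, pow_zero, pow_one]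
  congr 1
  refine Finset.prod_congr rfl fun j _ => ?_
  rw [sub_eq_iff_eq_add, pow_succ (q F) i, pow_succ (q F) j, pow_mul, pow_mul,
    ← add_pow_q, sub_add_cancel]

lemma norm_carlitzExp_term (w : CInf F) (i : ℕ) :
    ‖w ^ q F ^ i / carlitzD F i‖ = (‖w‖ / (q F : ℝ) ^ i) ^ q F ^ i := by
  rw [norm_div, norm_pow, norm_carlitzD, div_pow]

lemma summable_carlitzExp (w : CInf F) :
    Summable fun i : ℕ => w ^ q F ^ i / carlitzD F i := by
  have hq := one_lt_q_real (F := F)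
  refine Summable.of_norm_bounded_eventually_nat (g := fun i => (1 / 2 : ℝ) ^ i)
    (summable_geometric_of_lt_one (by norm_num) (by norm_num)) ?_
  obtain ⟨N, hN⟩ := pow_unbounded_of_one_lt (2 * ‖w‖) hq
  filter_upwards [Filter.eventually_ge_atTop N] with i hi
  have hqi : (0 : ℝ) < (q F : ℝ) ^ i := by positivity
  rw [norm_carlitzExp_term]
  have h1 : ‖w‖ / (q F : ℝ) ^ i ≤ 1 / 2 := by
    rw [div_le_iff₀ hqi]
    have := pow_le_pow_right₀ hq.le hi
    linarith
  calc (‖w‖ / (q F : ℝ) ^ i) ^ q F ^ i ≤ (1 / 2) ^ q F ^ i :=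
        pow_le_pow_left₀ (by positivity) h1 _
    _ ≤ (1 / 2) ^ i := pow_le_pow_of_le_one (by norm_num) (by norm_num)
        (Nat.lt_pow_self Fintype.one_lt_card).le

lemma carlitzExp_add (w w' : CInf F) :
    carlitzExp (w + w') = carlitzExp w + carlitzExp w' := by
  rw [carlitzExp, carlitzExp, carlitzExp,
    ← (summable_carlitzExp w).tsum_add (summable_carlitzExp w')]
  exact tsum_congr fun i => by rw [add_pow_q_pow, add_div]

lemma carlitzExp_C_mul (c : F) (w : CInf F) :
    carlitzExp (ofA F (C c) * w) = ofA F (C c) * carlitzExp w := by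
  rw [carlitzExp, carlitzExp, ← tsum_mul_left]
  exact tsum_congr fun i => by rw [mul_pow, ofA_C_pow_q_pow, mul_div_assoc]

lemma carlitzExp_zero : carlitzExp (0 : CInf F) = 0 := by
  have := carlitzExp_C_mul (0 : F) (0 : CInf F)
  simpa using this

lemma carlitzExp_X_mul (w : CInf F) :
    carlitzExp (ofA F X * w) = ofA F X * carlitzExp w + carlitzExp w ^ q F := by
  have hpow : carlitzExp w ^ q F = ∑' i : ℕ, (w ^ q F ^ i / carlitzD F i) ^ q F := by
    let φ : CInf F →+ CInf F :=
      { toFun := fun x => x ^ q F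
        map_zero' := zero_pow q_pos.ne'
        map_add' := add_pow_q }
    exact ((summable_carlitzExp w).hasSum.map φ (continuous_pow (q F))).tsum_eq.symm
  have hs1 : Summable fun i : ℕ => ofA F X * (w ^ q F ^ i / carlitzD F i) :=
    (summable_carlitzExp w).mul_left _
  have hs2 : Summable fun i : ℕ =>
      (ofA F X * w) ^ q F ^ i / carlitzD F i - ofA F X * (w ^ q F ^ i / carlitzD F i) :=
    (summable_carlitzExp (ofA F X * w)).sub hs1
  have hdiff : carlitzExp (ofA F X * w) - ofA F X * carlitzExp w
      = ∑' i : ℕ, ((ofA F X * w) ^ q F ^ i / carlitzD F i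
        - ofA F X * (w ^ q F ^ i / carlitzD F i)) := by
    rw [(summable_carlitzExp (ofA F X * w)).tsum_sub hs1, tsum_mul_left]
    rfl
  rw [← sub_eq_iff_eq_add', hdiff, hs2.tsum_eq_zero_add, hpow]
  have h0 : (ofA F X * w) ^ q F ^ 0 / carlitzD F 0 - ofA F X * (w ^ q F ^ 0 / carlitzD F 0) = 0 := by
    simp [carlitzD]
  rw [h0, zero_add]
  refine tsum_congr fun i => ?_
  have h1 := carlitzD_ne_zero (F := F) (i + 1)
  have h2 := carlitzD_ne_zero (F := F) i
  rw [carlitzD_succ] at h1 ⊢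
  have h3 := left_ne_zero_of_mul h1
  rw [div_pow, ← pow_mul, ← pow_succ, mul_pow]
  field_simp

/-- The functional equation `e(a w) = ρ_a(e(w))` of the Carlitz exponential. -/
lemma carlitzExp_ofA_mul (a : F[X]) (w : CInf F) :
    carlitzExp (ofA F a * w) = (carlitz a).eval (carlitzExp w) := by
  let ψ : F[X] →+ CInf F :=
    { toFun := fun a => carlitzExp (ofA F a * w)
      map_zero' := by rw [map_zero, zero_mul, carlitzExp_zero]
      map_add' := fun a b => by rw [map_add, add_mul, carlitzExp_add] }
  have h := aeval_carlitz ψ (fun c a => by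
      change carlitzExp (ofA F (C c * a) * w) = _ * carlitzExp (ofA F a * w)
      rw [map_mul, mul_assoc, carlitzExp_C_mul]; rfl) (fun a => by
      change carlitzExp (ofA F (X * a) * w)
        = _ * carlitzExp (ofA F a * w) + carlitzExp (ofA F a * w) ^ q F
      rw [map_mul, mul_assoc, carlitzExp_X_mul]; rfl) a
  change aeval (carlitzExp (ofA F 1 * w)) (carlitz a) = carlitzExp (ofA F a * w) at h
  rw [map_one, one_mul, coe_aeval_eq_eval] at h
  exact h.symm

lemma norm_carlitzExp_of_lt_one {w : CInf F} (h : ‖w‖ < 1) : ‖carlitzExp w‖ = ‖w‖ := by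
  rcases eq_or_ne w 0 with rfl | hw
  · rw [carlitzExp_zero]
  have hw0 : 0 < ‖w‖ := norm_pos_iff.2 hw
  rw [carlitzExp, (summable_carlitzExp w).tsum_eq_zero_add]
  have h0 : w ^ q F ^ 0 / carlitzD F 0 = w := by simp [carlitzD]
  rw [h0]
  have htail : ‖∑' i : ℕ, w ^ q F ^ (i + 1) / carlitzD F (i + 1)‖ ≤ ‖w‖ ^ 2 := by
    refine IsUltrametricDist.norm_tsum_le_of_forall_le_of_nonneg (by positivity) fun i => ?_
    rw [norm_carlitzExp_term]
    have h1 : ‖w‖ / (q F : ℝ) ^ (i + 1) ≤ ‖w‖ :=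
      div_le_self hw0.le (one_le_pow₀ one_lt_q_real.le)
    have h2 : 2 ≤ q F ^ (i + 1) := by
      have : 2 ≤ q F := Fintype.one_lt_card
      exact this.trans (Nat.le_self_pow (by omega) _)
    exact (pow_le_pow_left₀ (by positivity) h1 _).trans
      (pow_le_pow_of_le_one hw0.le h.le h2)
  have hlt : ‖∑' i : ℕ, w ^ q F ^ (i + 1) / carlitzD F (i + 1)‖ < ‖w‖ :=
    htail.trans_lt (by rw [sq]; exact mul_lt_of_lt_one_left hw0 h)
  rw [IsUltrametricDist.norm_add_eq_max_of_norm_ne_norm hlt.ne', max_eq_left hlt.le]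

/-! ### The Carlitz exponential as a formal power series -/

/-- The `q`-th power map on power series is the composite of the Frobenius on coefficients with
`t ↦ t^q`. -/
lemma coeff_pow_q (S : PowerSeries (CInf F)) (n : ℕ) :
    PowerSeries.coeff n (S ^ q F)
      = if q F ∣ n then PowerSeries.coeff (n / q F) S ^ q F else 0 := by
  obtain ⟨k, hk⟩ := exists_q_eq_pow (F := F)
  have hq0 : q F ≠ 0 := q_pos.ne'
  have hp0 : ringChar F ≠ 0 := (Fact.out : (ringChar F).Prime).ne_zero
  have h : S ^ ringChar F ^ k = PowerSeries.map (iterateFrobenius (CInf F) (ringChar F) k)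
      (PowerSeries.expand (ringChar F ^ k) (pow_ne_zero k hp0) S) :=
    (MvPowerSeries.map_iterateFrobenius_expand (ringChar F) hp0 S k).symm
  simp only [hk]
  rw [h, PowerSeries.coeff_map, PowerSeries.coeff_expand]
  split_ifs with hd
  · rw [iterateFrobenius_def]
  · rw [map_zero]

lemma coeff_carlitzExpSeries_pow (i : ℕ) :
    PowerSeries.coeff (q F ^ i) (carlitzExpSeries F) = (carlitzD F i)⁻¹ := by
  rw [carlitzExpSeries, PowerSeries.coeff_mk, Nat.log_pow Fintype.one_lt_card, if_pos rfl]

lemma coeff_carlitzExpSeries_of_ne {n : ℕ} (h : ∀ i, n ≠ q F ^ i) :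
    PowerSeries.coeff n (carlitzExpSeries F) = 0 := by
  rw [carlitzExpSeries, PowerSeries.coeff_mk, if_neg (h _)]

lemma constantCoeff_carlitzExpSeries :
    PowerSeries.constantCoeff (carlitzExpSeries F) = 0 := by
  rw [← PowerSeries.coeff_zero_eq_constantCoeff_apply]
  exact coeff_carlitzExpSeries_of_ne fun i => (pow_pos q_pos i).ne

/-- The recursion for the coefficients of the Carlitz exponential expressing the functional
equation `e(T u) = T e(u) + e(u)^q`. -/
lemma ofA_X_pow_mul_coeff_carlitzExpSeries (n : ℕ) :
    ofA F X ^ n * PowerSeries.coeff n (carlitzExpSeries F)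
      = ofA F X * PowerSeries.coeff n (carlitzExpSeries F)
        + if q F ∣ n then PowerSeries.coeff (n / q F) (carlitzExpSeries F) ^ q F else 0 := by
  by_cases h : ∃ i, n = q F ^ i
  · obtain ⟨i, rfl⟩ := h
    rcases i with _ | i
    · have h1 : ¬ q F ∣ q F ^ 0 := by
        rw [pow_zero, Nat.dvd_one]
        exact Fintype.one_lt_card.ne'
      rw [if_neg h1, pow_zero, pow_one, add_zero]
    · have h1 : q F ^ (i + 1) / q F = q F ^ i := by
        rw [pow_succ, Nat.mul_div_cancel _ q_pos]
      rw [if_pos (dvd_pow_self _ (Nat.succ_ne_zero i)), h1, coeff_carlitzExpSeries_pow,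
        coeff_carlitzExpSeries_pow]
      have h2 := carlitzD_ne_zero (F := F) (i + 1)
      have h3 := carlitzD_ne_zero (F := F) i
      rw [carlitzD_succ] at h2 ⊢
      have h4 := left_ne_zero_of_mul h2
      rw [mul_inv, inv_pow]
      field_simp
      ring
  · push Not at h
    have h1 : PowerSeries.coeff n (carlitzExpSeries F) = 0 := coeff_carlitzExpSeries_of_ne h
    rw [h1, mul_zero, mul_zero, zero_add]
    split_ifs with hd
    · rw [coeff_carlitzExpSeries_of_ne, zero_pow q_pos.ne']
      intro i hi
      exact h (i + 1) (by rw [pow_succ, ← hi, Nat.div_mul_cancel hd])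
    · rfl

/-- The formal functional equation `ρ_a(e(u)) = e(a u)`. -/
lemma aeval_carlitzExpSeries_carlitz (a : F[X]) :
    aeval (carlitzExpSeries F) (carlitz a) = PowerSeries.rescale (ofA F a) (carlitzExpSeries F) := by
  let ψ : F[X] →+ PowerSeries (CInf F) :=
    { toFun := fun a => PowerSeries.rescale (ofA F a) (carlitzExpSeries F)
      map_zero' := by
        ext n
        rw [PowerSeries.coeff_rescale, map_zero, map_zero]
        rcases n with _ | n
        · rw [PowerSeries.coeff_zero_eq_constantCoeff_apply, constantCoeff_carlitzExpSeries,
            mul_zero]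
        · rw [zero_pow (Nat.succ_ne_zero n), zero_mul]
      map_add' := fun a b => by
        ext n
        simp only [map_add, PowerSeries.coeff_rescale, ← add_mul]
        by_cases h : ∃ i, n = q F ^ i
        · obtain ⟨i, rfl⟩ := h
          rw [add_pow_q_pow]
        · push Not at h
          rw [coeff_carlitzExpSeries_of_ne h, mul_zero, mul_zero] }
  have hψ : ∀ a, ψ a = PowerSeries.rescale (ofA F a) (carlitzExpSeries F) := fun a => rfl
  have halg : ∀ c : CInf F, algebraMap (CInf F) (PowerSeries (CInf F)) c = PowerSeries.C c :=
    fun c => rfl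
  have h1 : ψ 1 = carlitzExpSeries F := by
    rw [hψ, map_one, PowerSeries.rescale_one, RingHom.id_apply]
  have h := aeval_carlitz ψ (fun c a => by
      ext n
      rw [hψ, hψ, halg, PowerSeries.coeff_C_mul, PowerSeries.coeff_rescale,
        PowerSeries.coeff_rescale, map_mul, mul_pow, ← mul_assoc]
      by_cases h : ∃ i, n = q F ^ i
      · obtain ⟨i, rfl⟩ := h
        rw [ofA_C_pow_q_pow]
      · push Not at h
        rw [coeff_carlitzExpSeries_of_ne h, mul_zero, mul_zero]) (fun a => by
      ext n
      rw [hψ, hψ, halg, map_add, PowerSeries.coeff_C_mul, coeff_pow_q, PowerSeries.coeff_rescale,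
        PowerSeries.coeff_rescale, PowerSeries.coeff_rescale, map_mul, mul_pow,
        mul_comm (ofA F X ^ n), mul_assoc, ofA_X_pow_mul_coeff_carlitzExpSeries]
      split_ifs with hd
      · rw [mul_pow, ← pow_mul, Nat.div_mul_cancel hd]
        ring
      · ring) a
  rw [h1] at h
  rw [h, hψ]

/-! ### Sums over the fibres of the Carlitz module -/

lemma mem_residues {d : ℕ} {β : F[X]} : β ∈ residues F d ↔ β.degree < d := by
  rw [residues, Set.Finite.mem_toFinset, Set.mem_ofPred_eq]

lemma card_residues (d : ℕ) : (residues F d).card = q F ^ d := by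
  have h : Nat.card {β : F[X] // β ∈ residues F d} = Nat.card (degreeLT F d) :=
    Nat.card_congr (Equiv.subtypeEquivRight fun β => by rw [mem_residues, mem_degreeLT])
  rw [Nat.card_eq_fintype_card, Fintype.card_coe] at h
  rw [h, Nat.card_congr (degreeLTEquiv F d).toEquiv, Nat.card_eq_fintype_card,
    Fintype.card_fun, Fintype.card_fin]

/-- The fibre of `ρ_p` over `x` determines `ρ_p - x`. -/
lemma carlitz_sub_C_eq_prod {p : F[X]} (hp : p.Monic) {w : F[X] → CInf F} {x : CInf F}
    (hinj : Set.InjOn w (residues F p.natDegree))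
    (hw : ∀ β ∈ residues F p.natDegree, (carlitz p).eval (w β) = x) :
    carlitz p - C x = ∏ β ∈ residues F p.natDegree, (X - C (w β)) := by
  obtain ⟨hm, hd⟩ := carlitz_monic_natDegree hp
  have hpos : 0 < q F ^ p.natDegree := pow_pos q_pos _
  have hdeg : (carlitz p).degree = ((q F ^ p.natDegree : ℕ) : WithBot ℕ) := by
    rw [degree_eq_natDegree hm.ne_zero, hd]
  have hClt : (C x : (CInf F)[X]).degree < (carlitz p).degree := by
    rw [hdeg]
    exact degree_C_le.trans_lt (by exact_mod_cast hpos)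
  have hm' : (carlitz p - C x).Monic := hm.sub_of_left hClt
  have hprod : (∏ β ∈ residues F p.natDegree, (X - C (w β))).Monic :=
    monic_prod_of_monic _ _ fun β _ => monic_X_sub_C _
  have hdprod : (∏ β ∈ residues F p.natDegree, (X - C (w β))).degree
      = ((q F ^ p.natDegree : ℕ) : WithBot ℕ) := by
    rw [degree_prod]
    simp [card_residues]
  have hdsub : (carlitz p - C x).degree = ((q F ^ p.natDegree : ℕ) : WithBot ℕ) := by
    rw [degree_sub_eq_left_of_degree_lt hClt, hdeg]
  refine eq_of_degree_sub_lt_of_eval_index_eq _ hinj ?_ fun β hβ => ?_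
  · rw [card_residues, ← hdsub]
    exact degree_sub_lt_left (hdsub.trans hdprod.symm) hm'.ne_zero
      (hm'.leadingCoeff.trans hprod.leadingCoeff.symm)
  · rw [eval_sub, eval_C, hw β hβ, sub_self, eval_prod]
    exact (Finset.prod_eq_zero hβ (by simp)).symm

lemma constantCoeff_aeval (P : (CInf F)[X]) {V : PowerSeries (CInf F)}
    (hV : PowerSeries.constantCoeff V = 0) :
    PowerSeries.constantCoeff (aeval V P) = P.eval 0 := by
  rw [aeval_def, hom_eval₂, hV]
  rfl

lemma constantCoeff_C_sub_ne_zero {w : CInf F} (hw : w ≠ 0) {V : PowerSeries (CInf F)}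
    (hV : PowerSeries.constantCoeff V = 0) :
    PowerSeries.constantCoeff (PowerSeries.C w - V) ≠ 0 := by
  rwa [map_sub, hV, PowerSeries.constantCoeff_C, sub_zero]

/-- The logarithmic derivative of `ρ_p - x`, evaluated at a formal power series `V`. -/
lemma sum_inv_C_sub {p : F[X]} (hp : p.Monic) {w : F[X] → CInf F} {x : CInf F} (hx : x ≠ 0)
    (hinj : Set.InjOn w (residues F p.natDegree))
    (hw : ∀ β ∈ residues F p.natDegree, (carlitz p).eval (w β) = x)
    {V : PowerSeries (CInf F)} (hV : PowerSeries.constantCoeff V = 0) :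
    ∑ β ∈ residues F p.natDegree, (PowerSeries.C (w β) - V)⁻¹
      = PowerSeries.C (ofA F p) * (PowerSeries.C x - aeval V (carlitz p))⁻¹ := by
  classical
  have hw0 : ∀ β ∈ residues F p.natDegree, w β ≠ 0 := by
    intro β hβ h
    have := hw β hβ
    rw [h, eval_zero_carlitz] at this
    exact hx this.symm
  have hcρ : PowerSeries.constantCoeff (aeval V (carlitz p)) = 0 := by
    rw [constantCoeff_aeval _ hV, eval_zero_carlitz]
  have hprod := carlitz_sub_C_eq_prod hp hinj hw
  have h1 : aeval V (carlitz p) - PowerSeries.C x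
      = ∏ β ∈ residues F p.natDegree, (V - PowerSeries.C (w β)) := by
    have := congrArg (aeval V) hprod
    simpa [map_prod] using this
  have h2 : PowerSeries.C (ofA F p) = ∑ β ∈ residues F p.natDegree,
      ∏ β' ∈ (residues F p.natDegree).erase β, (V - PowerSeries.C (w β')) := by
    have h := congrArg derivative hprod
    rw [derivative_sub, derivative_C, sub_zero, derivative_carlitz, derivative_prod_finset] at h
    have h' := congrArg (aeval V) h
    simpa [map_sum, map_prod] using h'
  rw [PowerSeries.eq_mul_inv_iff_mul_eq (constantCoeff_C_sub_ne_zero hx hcρ), Finset.sum_mul, h2]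
  refine Finset.sum_congr rfl fun β hβ => ?_
  rw [← neg_sub (aeval V (carlitz p)), h1, ← Finset.mul_prod_erase _ _ hβ, ← neg_mul, neg_sub,
    ← mul_assoc,
    PowerSeries.inv_mul_cancel _ (constantCoeff_C_sub_ne_zero (hw0 β hβ) hV), one_mul]

/-- The geometric series `1 / (w - V) = ∑_j V^j / w^{j+1}`. -/
lemma coeff_inv_C_sub {w : CInf F} (hw : w ≠ 0) {V : PowerSeries (CInf F)}
    (hV : PowerSeries.constantCoeff V = 0) (m : ℕ) :
    PowerSeries.coeff m (PowerSeries.C w - V)⁻¹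
      = ∑ j ∈ Finset.range (m + 1), w⁻¹ ^ (j + 1) * PowerSeries.coeff m (V ^ j) := by
  have hgeom : ∀ k : ℕ, (∑ j ∈ Finset.range k, PowerSeries.C (w⁻¹ ^ (j + 1)) * V ^ j)
      * (PowerSeries.C w - V) = 1 - PowerSeries.C (w⁻¹ ^ k) * V ^ k := by
    intro k
    induction k with
    | zero => simp
    | succ k ih =>
      have h1 : PowerSeries.C (w⁻¹ ^ (k + 1)) * PowerSeries.C w = PowerSeries.C (w⁻¹ ^ k) := by
        rw [← map_mul, pow_succ, mul_assoc, inv_mul_cancel₀ hw, mul_one]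
      rw [Finset.sum_range_succ, add_mul, ih, mul_sub, mul_right_comm, h1, pow_succ V, mul_assoc]
      ring
  have hc := constantCoeff_C_sub_ne_zero hw hV
  have hdecomp : (PowerSeries.C w - V)⁻¹
      = (∑ j ∈ Finset.range (m + 1), PowerSeries.C (w⁻¹ ^ (j + 1)) * V ^ j)
        + V ^ (m + 1) * (PowerSeries.C (w⁻¹ ^ (m + 1)) * (PowerSeries.C w - V)⁻¹) := by
    symm
    rw [PowerSeries.eq_inv_iff_mul_eq_one hc, add_mul, hgeom, mul_assoc, mul_assoc,
      PowerSeries.inv_mul_cancel _ hc]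
    ring
  have hlast : PowerSeries.coeff m
      (V ^ (m + 1) * (PowerSeries.C (w⁻¹ ^ (m + 1)) * (PowerSeries.C w - V)⁻¹)) = 0 := by
    refine PowerSeries.X_pow_dvd_iff.1 (Dvd.dvd.mul_right (pow_dvd_pow_of_dvd ?_ (m + 1)) _) m
      (Nat.lt_succ_self m)
    rwa [PowerSeries.X_dvd_iff]
  rw [hdecomp, map_add, hlast, add_zero, map_sum]
  exact Finset.sum_congr rfl fun j _ => by rw [PowerSeries.coeff_C_mul]

lemma sum_fiber_coeff {p : F[X]} (hp : p.Monic) {w : F[X] → CInf F} {x : CInf F} (hx : x ≠ 0)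
    (hinj : Set.InjOn w (residues F p.natDegree))
    (hw : ∀ β ∈ residues F p.natDegree, (carlitz p).eval (w β) = x)
    {V : PowerSeries (CInf F)} (hV : PowerSeries.constantCoeff V = 0) (m : ℕ) :
    ∑ β ∈ residues F p.natDegree,
        ∑ j ∈ Finset.range (m + 1), (w β)⁻¹ ^ (j + 1) * PowerSeries.coeff m (V ^ j)
      = ofA F p * ∑ j ∈ Finset.range (m + 1),
        x⁻¹ ^ (j + 1) * PowerSeries.coeff m (aeval V (carlitz p) ^ j) := by
  have hcρ : PowerSeries.constantCoeff (aeval V (carlitz p)) = 0 := by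
    rw [constantCoeff_aeval _ hV, eval_zero_carlitz]
  have h := congrArg (PowerSeries.coeff m) (sum_inv_C_sub hp hx hinj hw hV)
  rw [map_sum, PowerSeries.coeff_C_mul, coeff_inv_C_sub hx hcρ] at h
  rw [← h]
  refine Finset.sum_congr rfl fun β hβ => (coeff_inv_C_sub ?_ hV m).symm
  rintro h0
  have := hw β hβ
  rw [h0, eval_zero_carlitz] at this
  exact hx this.symm

/-- Newton's identities for the inverses of the points of a fibre of `ρ_p`. -/
lemma sum_fiber_inv_pow {p : F[X]} (hp : p.Monic) {w : F[X] → CInf F} {x : CInf F} (hx : x ≠ 0)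
    (hinj : Set.InjOn w (residues F p.natDegree))
    (hw : ∀ β ∈ residues F p.natDegree, (carlitz p).eval (w β) = x) (m : ℕ) :
    ∑ β ∈ residues F p.natDegree, (w β)⁻¹ ^ (m + 1)
      = ∑ j ∈ Finset.range (m + 1), ofA F p * (carlitz p ^ j).coeff m * x⁻¹ ^ (j + 1) := by
  have h := sum_fiber_coeff hp hx hinj hw (V := PowerSeries.X) PowerSeries.constantCoeff_X m
  have hX : aeval (PowerSeries.X : PowerSeries (CInf F)) (carlitz p)
      = ((carlitz p : (CInf F)[X]) : PowerSeries (CInf F)) := by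
    rw [Polynomial.aeval_def]
    exact Polynomial.eval₂_C_X_eq_coe
  simp only [hX, ← Polynomial.coe_pow, Polynomial.coeff_coe, PowerSeries.coeff_X_pow, mul_ite,
    mul_one, mul_zero, Finset.sum_ite_eq, Finset.mem_range, Nat.lt_succ_self, if_true] at h
  rw [h, Finset.mul_sum]
  exact Finset.sum_congr rfl fun j _ => by ring

/-- Goss polynomials are eigenvectors of the trace along `ρ_p`. -/
lemma sum_fiber_goss {p : F[X]} (hp : p.Monic) {w : F[X] → CInf F} {x : CInf F} (hx : x ≠ 0)
    (hinj : Set.InjOn w (residues F p.natDegree))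
    (hw : ∀ β ∈ residues F p.natDegree, (carlitz p).eval (w β) = x) {n : ℕ} (hn : 0 < n) :
    ∑ β ∈ residues F p.natDegree, (goss F n).eval (w β)⁻¹
      = ofA F p ^ n * (goss F n).eval x⁻¹ := by
  obtain ⟨m, rfl⟩ := Nat.exists_eq_add_of_lt hn
  rw [zero_add]
  have hgoss : ∀ y : CInf F, (goss F (m + 1)).eval y = ∑ j ∈ Finset.range (m + 1),
      y ^ (j + 1) * PowerSeries.coeff m (carlitzExpSeries F ^ j) := by
    intro y
    rw [goss, eval_finsetSum]
    refine Finset.sum_congr rfl fun j _ => ?_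
    rw [eval_mul, eval_C, eval_pow, eval_X, Nat.add_sub_cancel, mul_comm]
  simp only [hgoss]
  rw [sum_fiber_coeff hp hx hinj hw constantCoeff_carlitzExpSeries m,
    aeval_carlitzExpSeries_carlitz, pow_succ', mul_assoc]
  congr 1
  rw [Finset.mul_sum]
  refine Finset.sum_congr rfl fun j _ => ?_
  rw [← map_pow, PowerSeries.coeff_rescale]
  ring

/-! ### Evaluation of formal power series -/

/-- The power series `S` converges absolutely at `t`, with sum `v`. -/
def AbsEval (S : PowerSeries (CInf F)) (t v : CInf F) : Prop :=
  (Summable fun N : ℕ => ‖PowerSeries.coeff N S * t ^ N‖) ∧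
    HasSum (fun N : ℕ => PowerSeries.coeff N S * t ^ N) v

lemma AbsEval.mul {S S' : PowerSeries (CInf F)} {t v v' : CInf F} (h : AbsEval S t v)
    (h' : AbsEval S' t v') : AbsEval (S * S') t (v * v') := by
  have e : ∀ N : ℕ, PowerSeries.coeff N (S * S') * t ^ N
      = ∑ kl ∈ Finset.HasAntidiagonal.antidiagonal N,
        (PowerSeries.coeff kl.1 S * t ^ kl.1) * (PowerSeries.coeff kl.2 S' * t ^ kl.2) := by
    intro N
    rw [PowerSeries.coeff_mul, Finset.sum_mul]
    refine Finset.sum_congr rfl fun kl hkl => ?_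
    rw [← Finset.HasAntidiagonal.mem_antidiagonal.1 hkl, pow_add]
    ring
  have hs := summable_norm_sum_mul_antidiagonal_of_summable_norm h.1 h'.1
  refine ⟨by simpa only [e] using hs, ?_⟩
  simp only [e]
  rw [← h.2.tsum_eq, ← h'.2.tsum_eq,
    tsum_mul_tsum_eq_tsum_sum_antidiagonal_of_summable_norm h.1 h'.1]
  exact hs.of_norm.hasSum

lemma AbsEval.add {S S' : PowerSeries (CInf F)} {t v v' : CInf F} (h : AbsEval S t v)
    (h' : AbsEval S' t v') : AbsEval (S + S') t (v + v') := by
  have e : ∀ N : ℕ, PowerSeries.coeff N (S + S') * t ^ N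
      = PowerSeries.coeff N S * t ^ N + PowerSeries.coeff N S' * t ^ N := fun N => by
    rw [map_add, add_mul]
  constructor
  · simp only [e]
    exact (h.1.add h'.1).of_nonneg_of_le (fun _ => norm_nonneg _) fun _ => norm_add_le _ _
  · simp only [e]
    exact h.2.add h'.2

lemma absEval_polynomial (P : (CInf F)[X]) (t : CInf F) :
    AbsEval (P : PowerSeries (CInf F)) t (P.eval t) := by
  have h0 : ∀ N ∉ Finset.range (P.natDegree + 1),
      PowerSeries.coeff N (P : PowerSeries (CInf F)) * t ^ N = 0 := by
    intro N hN
    rw [Finset.mem_range, not_lt] at hN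
    rw [Polynomial.coeff_coe, coeff_eq_zero_of_natDegree_lt hN, zero_mul]
  constructor
  · exact summable_of_ne_finset_zero (s := Finset.range (P.natDegree + 1)) fun N hN => by
      rw [h0 N hN, norm_zero]
  · rw [eval_eq_sum_range]
    simpa only [Polynomial.coeff_coe] using hasSum_sum_of_ne_finset_zero h0

lemma AbsEval.pow {S : PowerSeries (CInf F)} {t v : CInf F} (h : AbsEval S t v) (n : ℕ) :
    AbsEval (S ^ n) t (v ^ n) := by
  induction n with
  | zero => simpa using absEval_polynomial 1 t
  | succ n ih =>
    rw [pow_succ, pow_succ]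
    exact ih.mul h

lemma AbsEval.aeval {S : PowerSeries (CInf F)} {t v : CInf F} (h : AbsEval S t v)
    (P : (CInf F)[X]) : AbsEval (aeval S P) t (P.eval v) := by
  induction P using Polynomial.induction_on' with
  | add P Q hP hQ =>
    rw [map_add, eval_add]
    exact hP.add hQ
  | monomial n c =>
    rw [aeval_monomial, eval_monomial]
    refine AbsEval.mul ?_ (h.pow n)
    have := absEval_polynomial (C c) t
    rwa [eval_C, Polynomial.coe_C] at this

/-! ### Coefficient bounds -/

lemma coeff_mul_norm_le {C : ℝ} (hC : 1 ≤ C) {S S' : PowerSeries (CInf F)}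
    (h : ∀ N, ‖PowerSeries.coeff N S‖ ≤ C ^ N) (h' : ∀ N, ‖PowerSeries.coeff N S'‖ ≤ C ^ N)
    (N : ℕ) : ‖PowerSeries.coeff N (S * S')‖ ≤ C ^ N := by
  rw [PowerSeries.coeff_mul]
  refine IsUltrametricDist.norm_sum_le_of_forall_le_of_nonneg (by positivity) fun kl hkl => ?_
  rw [norm_mul, ← Finset.HasAntidiagonal.mem_antidiagonal.1 hkl, pow_add]
  exact mul_le_mul (h _) (h' _) (norm_nonneg _) (by positivity)

lemma coeff_X_pow_norm_le {C : ℝ} (hC : 1 ≤ C) (k N : ℕ) :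
    ‖PowerSeries.coeff N (PowerSeries.X ^ k : PowerSeries (CInf F))‖ ≤ C ^ N := by
  rw [PowerSeries.coeff_X_pow]
  split_ifs
  · rw [norm_one]
    exact one_le_pow₀ hC
  · rw [norm_zero]
    positivity

lemma coeff_pow_norm_le {C : ℝ} (hC : 1 ≤ C) {S : PowerSeries (CInf F)}
    (h : ∀ N, ‖PowerSeries.coeff N S‖ ≤ C ^ N) (n N : ℕ) :
    ‖PowerSeries.coeff N (S ^ n)‖ ≤ C ^ N := by
  induction n generalizing N with
  | zero => simpa using coeff_X_pow_norm_le hC 0 N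
  | succ n ih =>
    rw [pow_succ]
    exact coeff_mul_norm_le hC ih h N

lemma coeff_inv_norm_le {C : ℝ} (hC : 1 ≤ C) {S : PowerSeries (CInf F)}
    (h : ∀ N, ‖PowerSeries.coeff N S‖ ≤ C ^ N) (h1 : PowerSeries.constantCoeff S = 1) (N : ℕ) :
    ‖PowerSeries.coeff N S⁻¹‖ ≤ C ^ N := by
  induction N using Nat.strong_induction_on with
  | _ N ih =>
    rw [PowerSeries.coeff_inv, h1, inv_one]
    split_ifs with hN
    · rw [norm_one]
      exact one_le_pow₀ hC
    · rw [neg_one_mul, norm_neg]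
      refine IsUltrametricDist.norm_sum_le_of_forall_le_of_nonneg (by positivity) fun kl hkl => ?_
      split_ifs with hlt
      · rw [norm_mul, ← Finset.HasAntidiagonal.mem_antidiagonal.1 hkl, pow_add]
        exact mul_le_mul (h _) (ih _ hlt) (norm_nonneg _) (by positivity)
      · rw [norm_zero]
        positivity

lemma exists_coeff_norm_le (P : (CInf F)[X]) : ∃ C : ℝ, 1 ≤ C ∧ ∀ N, ‖P.coeff N‖ ≤ C := by
  refine ⟨1 + ∑ i ∈ P.support, ‖P.coeff i‖, ?_, fun N => ?_⟩
  · have := Finset.sum_nonneg fun i (_ : i ∈ P.support) => norm_nonneg (P.coeff i)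
    linarith
  · by_cases hN : N ∈ P.support
    · have := Finset.single_le_sum (f := fun i => ‖P.coeff i‖) (fun i _ => norm_nonneg _) hN
      linarith
    · rw [notMem_support_iff.1 hN, norm_zero]
      have := Finset.sum_nonneg fun i (_ : i ∈ P.support) => norm_nonneg (P.coeff i)
      linarith

lemma coeff_polynomial_pow_norm_le {C : ℝ} (hC : 1 ≤ C) {P : (CInf F)[X]}
    (hP : ∀ N, ‖P.coeff N‖ ≤ C) (j N : ℕ) : ‖(P ^ j).coeff N‖ ≤ C ^ j := by
  induction j generalizing N with
  | zero =>
    rw [pow_zero, pow_zero, coeff_one]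
    split_ifs
    · rw [norm_one]
    · rw [norm_zero]
      exact zero_le_one
  | succ j ih =>
    rw [pow_succ, coeff_mul, pow_succ]
    refine IsUltrametricDist.norm_sum_le_of_forall_le_of_nonneg (by positivity) fun kl _ => ?_
    rw [norm_mul]
    exact mul_le_mul (ih _) (hP _) (norm_nonneg _) (by positivity)

lemma summable_norm_of_coeff_norm_le {C A : ℝ} {S : PowerSeries (CInf F)} {t : CInf F}
    (h : ∀ N, ‖PowerSeries.coeff N S‖ ≤ A * C ^ N) (hC : 0 ≤ C) (ht : C * ‖t‖ < 1) :
    Summable fun N : ℕ => ‖PowerSeries.coeff N S * t ^ N‖ := by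
  refine ((summable_geometric_of_lt_one (by positivity) ht).mul_left A).of_nonneg_of_le
    (fun _ => norm_nonneg _) fun N => ?_
  rw [norm_mul, norm_pow, mul_pow, ← mul_assoc]
  exact mul_le_mul_of_nonneg_right (h N) (by positivity)

/-! ### The expansion of `t(az)` -/

/-- The reversed Carlitz polynomial `t^{q^d} ρ_a(1/t)`. -/
abbrev revCarlitz (a : F[X]) : (CInf F)[X] := reflect (q F ^ a.natDegree) (carlitz a)

lemma constantCoeff_revCarlitz (a : MonicPoly F) :
    PowerSeries.constantCoeff (revCarlitz a.1 : PowerSeries (CInf F)) = 1 := by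
  obtain ⟨hm, hd⟩ := carlitz_monic_natDegree a.2
  rw [Polynomial.constantCoeff_coe, coeff_reflect, revAt_le (Nat.zero_le _), Nat.sub_zero, ← hd,
    hm.coeff_natDegree]

lemma eval_revCarlitz (a : MonicPoly F) {t : CInf F} (ht : t ≠ 0) :
    (revCarlitz a.1).eval t = t ^ q F ^ a.1.natDegree * (carlitz a.1).eval t⁻¹ := by
  have hd := (carlitz_monic_natDegree a.2).2
  let : Invertible t⁻¹ := invertibleOfNonzero (inv_ne_zero ht)
  have h := eval₂_reflect_mul_pow (RingHom.id (CInf F)) t⁻¹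
    (q F ^ a.1.natDegree) (carlitz a.1) hd.le
  rw [invOf_eq_inv, inv_inv] at h
  rw [eval, eval, ← h, mul_comm, mul_assoc, ← mul_pow, inv_mul_cancel₀ ht, one_pow, mul_one]

/-- The coefficients of `t_a` grow at most geometrically, and `t_a` converges to `1 / ρ_a(1/t)`. -/
lemma exists_coeff_tSeries_norm_le (a : MonicPoly F) :
    ∃ C : ℝ, 1 ≤ C ∧ (∀ N, ‖PowerSeries.coeff N (tSeries a)‖ ≤ C ^ N) ∧
      ∀ t : CInf F, t ≠ 0 → C * ‖t‖ < 1 → AbsEval (tSeries a) t ((carlitz a.1).eval t⁻¹)⁻¹ := by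
  obtain ⟨C, hC, hcoeff⟩ := exists_coeff_norm_le (revCarlitz a.1)
  have h1 := constantCoeff_revCarlitz a
  have h1' : (revCarlitz a.1).coeff 0 = 1 := by rwa [Polynomial.constantCoeff_coe] at h1
  have hb : ∀ N, ‖PowerSeries.coeff N (revCarlitz a.1 : PowerSeries (CInf F))‖ ≤ C ^ N := by
    intro N
    rw [Polynomial.coeff_coe]
    rcases N with _ | N
    · rw [h1', norm_one, pow_zero]
    · exact (hcoeff _).trans (le_self_pow₀ hC (Nat.succ_ne_zero N))
  have hinv := coeff_inv_norm_le hC hb h1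
  refine ⟨C, hC, coeff_mul_norm_le hC (coeff_X_pow_norm_le hC _) hinv, fun t ht hCt => ?_⟩
  have hsum := summable_norm_of_coeff_norm_le (A := 1) (by simpa using hinv) (by linarith) hCt
  have hI : AbsEval (revCarlitz a.1 : PowerSeries (CInf F))⁻¹ t _ := ⟨hsum, hsum.of_norm.hasSum⟩
  have hprod := (absEval_polynomial (revCarlitz a.1) t).mul hI
  rw [PowerSeries.mul_inv_cancel _ (by rw [h1]; exact one_ne_zero)] at hprod
  have hone : AbsEval (1 : PowerSeries (CInf F)) t 1 := by
    simpa using absEval_polynomial 1 t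
  have hval := hprod.2.unique hone.2
  rw [eq_inv_of_mul_eq_one_right hval] at hI
  have hX : AbsEval (PowerSeries.X ^ q F ^ a.1.natDegree : PowerSeries (CInf F)) t
      (t ^ q F ^ a.1.natDegree) := by
    simpa using absEval_polynomial (X ^ q F ^ a.1.natDegree) t
  have := hX.mul hI
  rwa [eval_revCarlitz a ht, mul_inv, mul_inv_cancel_left₀ (pow_ne_zero _ ht)] at this

/-! ### Continuous linear operators on formal power series -/

/-- The `t`-adically continuous linear operator `t^N ↦ Λ_N` on formal power series; it is used for
families with `t^M`-coefficient of `Λ_N` zero for `N > κ M`, so that the sums are finite. -/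
def transform (κ : ℕ) (Λ : ℕ → PowerSeries (CInf F)) (S : PowerSeries (CInf F)) :
    PowerSeries (CInf F) :=
  PowerSeries.mk fun M => ∑ N ∈ Finset.range (κ * M + 1),
    PowerSeries.coeff N S * PowerSeries.coeff M (Λ N)

lemma coeff_transform (κ : ℕ) (Λ : ℕ → PowerSeries (CInf F)) (S : PowerSeries (CInf F)) (M : ℕ) :
    PowerSeries.coeff M (transform κ Λ S) = ∑ N ∈ Finset.range (κ * M + 1),
      PowerSeries.coeff N S * PowerSeries.coeff M (Λ N) := PowerSeries.coeff_mk _ _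

/-- If `g = ∑_N s_N Λ_N(t)`, then `g` is the value at `t` of the transform of `∑_N s_N t^N`: the
double series can be rearranged, because its terms are `O(2^{-M})` and, for fixed `M`, only those with
`N ≤ κ M` are nonzero. -/
lemma hasSum_transform {κ : ℕ} {Λ : ℕ → PowerSeries (CInf F)} {S : PowerSeries (CInf F)}
    {A B C : ℝ} {t v : CInf F} {G : ℕ → CInf F} (hB : 1 ≤ B) (hC : 1 ≤ C) (hA : 0 ≤ A)
    (hΛ0 : ∀ N M, κ * M < N → PowerSeries.coeff M (Λ N) = 0)
    (hΛ : ∀ N M, ‖PowerSeries.coeff M (Λ N)‖ ≤ C ^ M)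
    (hS : ∀ N, ‖PowerSeries.coeff N S‖ ≤ A * B ^ N) (ht : C * B ^ κ * ‖t‖ ≤ 1 / 2)
    (hG : ∀ N, HasSum (fun M : ℕ => PowerSeries.coeff M (Λ N) * t ^ M) (G N))
    (hv : HasSum (fun N : ℕ => PowerSeries.coeff N S * G N) v) :
    HasSum (fun M : ℕ => PowerSeries.coeff M (transform κ Λ S) * t ^ M) v := by
  set T : ℕ × ℕ → CInf F := fun x =>
    PowerSeries.coeff x.1 S * (PowerSeries.coeff x.2 (Λ x.1) * t ^ x.2) with hT
  have hT0 : ∀ x : ℕ × ℕ, κ * x.2 < x.1 → T x = 0 := fun x hx => by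
    rw [hT]
    simp only [hΛ0 x.1 x.2 hx, zero_mul, mul_zero]
  have hTle : ∀ x : ℕ × ℕ, ‖T x‖ ≤ A * (1 / 2) ^ x.2 := by
    rintro ⟨N, M⟩
    rcases lt_or_ge (κ * M) N with h | h
    · rw [hT0 (N, M) h, norm_zero]
      positivity
    · have h1 : B ^ N ≤ B ^ (κ * M) := pow_le_pow_right₀ hB h
      calc ‖T (N, M)‖ = ‖PowerSeries.coeff N S‖ * (‖PowerSeries.coeff M (Λ N)‖ * ‖t‖ ^ M) := by
            rw [hT, norm_mul, norm_mul, norm_pow]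
        _ ≤ (A * B ^ (κ * M)) * (C ^ M * ‖t‖ ^ M) := by
            refine mul_le_mul ((hS N).trans (mul_le_mul_of_nonneg_left h1 hA)) ?_
              (by positivity) (by positivity)
            exact mul_le_mul_of_nonneg_right (hΛ N M) (by positivity)
        _ = A * (C * B ^ κ * ‖t‖) ^ M := by
            rw [mul_pow, mul_pow, pow_mul]
            ring
        _ ≤ A * (1 / 2) ^ M := by
            refine mul_le_mul_of_nonneg_left (pow_le_pow_left₀ (by positivity) ht M) hA
  have hsum : Summable T := by
    have := IsUltrametricDist.nonarchimedeanAddGroup (M := CInf F)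
    refine NonarchimedeanAddGroup.summable_of_tendsto_cofinite_zero ?_
    rw [Metric.tendsto_nhds]
    intro ε hε
    obtain ⟨M₀, hM₀⟩ := exists_pow_lt_of_lt_one (show 0 < ε / (A + 1) by positivity)
      (by norm_num : (1 / 2 : ℝ) < 1)
    rw [Filter.eventually_cofinite]
    refine ((Finset.range (κ * M₀ + 1) ×ˢ Finset.range M₀).finite_toSet).subset ?_
    rintro ⟨N, M⟩ hx
    have hx' : ¬ ‖T (N, M)‖ < ε := by simpa [dist_eq_norm] using hx
    have hM : M < M₀ := by
      by_contra! hM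
      refine hx' ((hTle (N, M)).trans_lt ?_)
      calc A * (1 / 2 : ℝ) ^ M ≤ A * (1 / 2) ^ M₀ := by
            refine mul_le_mul_of_nonneg_left ?_ hA
            exact pow_le_pow_of_le_one (by norm_num) (by norm_num) hM
        _ ≤ (A + 1) * (1 / 2) ^ M₀ := by gcongr; linarith
        _ < (A + 1) * (ε / (A + 1)) := by gcongr
        _ = ε := by field_simp
    have hN : N ≤ κ * M := by
      by_contra! hN
      exact hx' (by rw [hT0 (N, M) hN, norm_zero]; exact hε)
    have hN' : N < κ * M₀ + 1 := Nat.lt_succ_of_le (hN.trans (Nat.mul_le_mul_left κ hM.le))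
    simp [hM, hN']
  obtain ⟨a, ha⟩ := hsum
  have hrow := ha.prod_fiberwise fun N => (hG N).mul_left (PowerSeries.coeff N S)
  rw [hrow.unique hv] at ha
  have hcol := (((Equiv.prodComm ℕ ℕ).hasSum_iff (f := T)).2 ha).prod_fiberwise
    (g := fun M => PowerSeries.coeff M (transform κ Λ S) * t ^ M) fun M => ?_
  · exact hcol
  · have h0 : ∀ N ∉ Finset.range (κ * M + 1), T (N, M) = 0 := fun N hN => by
      rw [Finset.mem_range, not_lt] at hN
      exact hT0 (N, M) hN
    have h1 : HasSum (fun N => T (N, M)) _ := hasSum_sum_of_ne_finset_zero h0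
    rw [coeff_transform, Finset.sum_mul]
    simpa only [hT, mul_assoc, Function.comp_def, Equiv.prodComm_apply, Prod.swap] using h1

/-! ### Expansions at infinity -/

/-- The filter of neighbourhoods of infinity on `Ω`, along which `|z|_i` and `|1/t(z)|` tend to
infinity. Requiring the second condition as well makes the convergence of power series in `t(z)`
immediate; that the two conditions are compatible is `atInfinity_neBot`. -/
def atInfinity (ϖ : CInf F) : Filter (Omega F) :=
  Filter.comap (fun z => imagAbs z.1) Filter.atTop ⊓
    Filter.comap (fun z => ‖carlitzExp (ϖ * z.1)‖) Filter.atTop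

lemma tendsto_imagAbs_atInfinity (ϖ : CInf F) :
    Filter.Tendsto (fun z : Omega F => imagAbs z.1) (atInfinity ϖ) Filter.atTop :=
  Filter.tendsto_comap.mono_left inf_le_left

lemma tendsto_carlitzExp_atInfinity (ϖ : CInf F) :
    Filter.Tendsto (fun z : Omega F => ‖carlitzExp (ϖ * z.1)‖) (atInfinity ϖ) Filter.atTop :=
  Filter.tendsto_comap.mono_left inf_le_right

lemma tendsto_atInfinity {ϖ : CInf F} {α : Type*} {l : Filter α} {φ : α → Omega F}
    (h1 : Filter.Tendsto (fun z => imagAbs (φ z).1) l Filter.atTop)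
    (h2 : Filter.Tendsto (fun z => ‖carlitzExp (ϖ * (φ z).1)‖) l Filter.atTop) :
    Filter.Tendsto φ l (atInfinity ϖ) :=
  Filter.tendsto_inf.2 ⟨Filter.tendsto_comap_iff.2 h1, Filter.tendsto_comap_iff.2 h2⟩

lemma carlitzExp_ne_zero {ϖ : CInf F} (hϖ : IsCarlitzPeriod ϖ) (z : Omega F) :
    carlitzExp (ϖ * z.1) ≠ 0 := by
  rw [Ne, hϖ.2]
  rintro ⟨a, ha⟩
  exact z.2 ⟨_, (mul_left_cancel₀ hϖ.1 ha).symm⟩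

lemma tParam_ne_zero {ϖ : CInf F} (hϖ : IsCarlitzPeriod ϖ) (z : Omega F) : tParam ϖ z ≠ 0 :=
  inv_ne_zero (carlitzExp_ne_zero hϖ z)

lemma eventually_norm_tParam_lt (ϖ : CInf F) {δ : ℝ} (hδ : 0 < δ) :
    ∀ᶠ z in atInfinity ϖ, ‖tParam ϖ z‖ < δ := by
  filter_upwards [(tendsto_carlitzExp_atInfinity ϖ).eventually_gt_atTop δ⁻¹] with z hz
  rw [tParam, norm_inv]
  exact inv_lt_of_inv_lt₀ hδ hz

lemma exists_ofKInf_eq_ofA {a : F[X]} (ha : a ≠ 0) :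
    ∃ x : KInf F, x ≠ 0 ∧ ofKInf F x = ofA F a :=
  ⟨algebraMap (RatFunc F) (KInf F) (algebraMap F[X] (RatFunc F) a), fun h => ha (ofA_injective (by
    change ofKInf F (algebraMap (RatFunc F) (KInf F) (algebraMap F[X] (RatFunc F) a)) = _
    rw [h, map_zero, map_zero])), rfl⟩

lemma ofA_ne_zero {a : F[X]} (ha : a ≠ 0) : ofA F a ≠ 0 := fun h =>
  ha (ofA_injective (h.trans (map_zero _).symm))

lemma imagAbs_ofA_mul {a : F[X]} (ha : a ≠ 0) (z : CInf F) :
    imagAbs (ofA F a * z) = ‖ofA F a‖ * imagAbs z := by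
  obtain ⟨x, hx, h⟩ := exists_ofKInf_eq_ofA ha
  rw [← h, imagAbs_ofKInf_mul hx]

lemma imagAbs_add_ofA (a : F[X]) (z : CInf F) : imagAbs (z + ofA F a) = imagAbs z :=
  imagAbs_add_ofKInf z _

/-- Multiplication by `T` pushes points with large `|e(ϖ z)|` further towards infinity. -/
lemma norm_carlitzExp_X_mul_of_lt {w : CInf F}
    (h : (q F : ℝ) < ‖carlitzExp w‖ ^ (q F - 1)) :
    ‖carlitzExp (ofA F X * w)‖ = ‖carlitzExp w‖ ^ q F := by
  have hy : 0 < ‖carlitzExp w‖ := by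
    rcases (norm_nonneg (carlitzExp w)).eq_or_lt with h0 | h0
    · rw [← h0, zero_pow (Nat.sub_ne_zero_of_lt Fintype.one_lt_card)] at h
      exact absurd h (not_lt.2 (Nat.cast_nonneg _))
    · exact h0
  have e : ‖carlitzExp w‖ ^ q F = ‖carlitzExp w‖ ^ (q F - 1) * ‖carlitzExp w‖ := by
    rw [← pow_succ, Nat.sub_add_cancel q_pos]
  have hlt : ‖ofA F X * carlitzExp w‖ < ‖carlitzExp w ^ q F‖ := by
    rw [norm_mul, norm_ofA_X, norm_pow, e]
    gcongr
  rw [carlitzExp_X_mul, IsUltrametricDist.norm_add_eq_max_of_norm_ne_norm hlt.ne,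
    max_eq_right hlt.le, norm_pow]

/-- There is a point of `Ω` at which `e(ϖ z)` is large. The absolute value of `w = ϖ z` is chosen in
`q^{-1/q + ℤ}`, so that `T^j w` never meets the critical radius at which the two terms of
`e(T w) = T e(w) + e(w)^q` have the same size. -/
lemma exists_lt_norm_carlitzExp {ϖ : CInf F} (hϖ : ϖ ≠ 0) :
    ∃ z : Omega F, (q F : ℝ) < ‖carlitzExp (ϖ * z.1)‖ ^ (q F - 1) := by
  have hq := one_lt_q_real (F := F)
  have hq0 : (0 : ℝ) < q F := by linarith
  have hq2 : 2 ≤ q F := Fintype.one_lt_card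
  have hT : ofA F X ≠ 0 := ofA_ne_zero X_ne_zero
  obtain ⟨v, hv⟩ := IsAlgClosed.exists_pow_nat_eq (ofA F X)⁻¹ (q_pos (F := F))
  have hvn : ‖v‖ ^ q F = (q F : ℝ)⁻¹ := by rw [← norm_pow, hv, norm_inv, norm_ofA_X]
  have hv0 : 0 < ‖v‖ := by
    rcases (norm_nonneg v).eq_or_lt with h | h
    · rw [← h, zero_pow q_pos.ne'] at hvn
      exact absurd hvn (inv_pos.2 hq0).ne
    · exact h
  have hv1 : ‖v‖ < 1 := by
    by_contra! h
    have := one_le_pow₀ h (n := q F)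
    rw [hvn] at this
    exact absurd this (not_le.2 (inv_lt_one_of_one_lt₀ hq))
  have hvΩ : 0 < imagAbs v := by
    rw [imagAbs_eq_norm_of_ne]
    · exact hv0
    · intro x hx
      obtain ⟨n, hn⟩ := exists_norm_ofKInf_eq_zpow (F := F) (x := x) (by
        rintro rfl
        rw [map_zero, norm_zero] at hx
        exact hv0.ne hx)
      rw [← hx, hn, ← zpow_natCast, ← zpow_mul, ← zpow_neg_one] at hvn
      have := zpow_right_injective₀ hq0 hq.ne' hvn
      have h1 : (q F : ℤ) ∣ 1 := ⟨-n, by linarith⟩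
      have h2 := Int.le_of_dvd one_pos h1
      omega
  obtain ⟨w, hwn, hwΩ⟩ : ∃ w : CInf F, ‖w‖ = ‖v‖ ∧ 0 < imagAbs (w / ϖ) := by
    by_cases h : 0 < imagAbs (v / ϖ)
    · exact ⟨v, rfl, h⟩
    · rw [imagAbs_pos_iff, not_not] at h
      obtain ⟨x, hx⟩ := h
      obtain ⟨j, hj⟩ := exists_pow_lt_of_lt_one (show 0 < ‖ϖ‖⁻¹ by positivity)
        (inv_lt_one_of_one_lt₀ hq)
      obtain ⟨y, hy0, hy⟩ := exists_ofKInf_eq_ofA (F := F) (X_ne_zero)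
      have hlt : ‖ϖ * (ofKInf F (y ^ j)⁻¹ * v)‖ < ‖v‖ := by
        rw [norm_mul, norm_mul, map_inv₀, map_pow, hy, norm_inv, norm_pow, norm_ofA_X, ← inv_pow]
        calc ‖ϖ‖ * ((q F : ℝ)⁻¹ ^ j * ‖v‖) < ‖ϖ‖ * (‖ϖ‖⁻¹ * ‖v‖) := by gcongr
          _ = ‖v‖ := mul_inv_cancel_left₀ (norm_ne_zero_iff.2 hϖ) _
      refine ⟨ϖ * (ofKInf F (y ^ j)⁻¹ * v) + v, ?_, ?_⟩
      · rw [IsUltrametricDist.norm_add_eq_max_of_norm_ne_norm hlt.ne, max_eq_right hlt.le]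
      · rw [add_div, mul_div_cancel_left₀ _ hϖ, ← hx, imagAbs_add_ofKInf,
          imagAbs_ofKInf_mul (inv_ne_zero (pow_ne_zero _ hy0))]
        exact mul_pos (norm_pos_iff.2 ((_root_.map_ne_zero _).2
          (inv_ne_zero (pow_ne_zero _ hy0)))) hvΩ
  have hexists : ∃ j : ℕ, (q F : ℝ) < ‖carlitzExp (ofA F X ^ j * w)‖ ^ (q F - 1) := by
    by_contra! hcon
    have hj : ∀ j : ℕ, ‖carlitzExp (ofA F X ^ j * w)‖ = (q F : ℝ) ^ j * ‖v‖ := by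
      intro j
      induction j with
      | zero => rw [pow_zero, one_mul, norm_carlitzExp_of_lt_one (hwn ▸ hv1), hwn, pow_zero, one_mul]
      | succ j ih =>
        set y := carlitzExp (ofA F X ^ j * w) with hy
        have hne : ‖y‖ ^ (q F - 1) ≠ q F := by
          intro h
          rw [ih] at h
          have h1 : (((q F : ℝ) ^ j * ‖v‖) ^ (q F - 1)) ^ q F = (q F : ℝ) ^ q F := by rw [h]
          rw [mul_pow, mul_pow, ← pow_mul ‖v‖, mul_comm (q F - 1), pow_mul ‖v‖, hvn, inv_pow,
            ← pow_mul, ← pow_mul, mul_inv_eq_iff_eq_mul₀ (by positivity), ← pow_add] at h1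
          have h2 := Nat.pow_right_injective hq2 (by exact_mod_cast h1)
          obtain ⟨k, hk⟩ := Nat.exists_eq_add_of_le hq2
          rw [hk] at h2
          have h3 : (2 + k) ∣ (2 + k) + (2 + k - 1) := ⟨j * (2 + k - 1), by rw [← h2]; ring⟩
          have h4 := (Nat.dvd_add_right (dvd_refl (2 + k))).1 h3
          have h5 := Nat.le_of_dvd (by omega) h4
          omega
        have hy0 : 0 < ‖y‖ := by rw [ih]; positivity
        have hlt : ‖y ^ q F‖ < ‖ofA F X * y‖ := by
          rw [norm_mul, norm_ofA_X, norm_pow, ← Nat.sub_add_cancel q_pos, pow_succ]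
          rw [Nat.sub_add_cancel q_pos]
          exact mul_lt_mul_of_pos_right (lt_of_le_of_ne (hcon j) hne) hy0
        rw [pow_succ', mul_assoc, carlitzExp_X_mul, ← hy,
          IsUltrametricDist.norm_add_eq_max_of_norm_ne_norm hlt.ne', max_eq_left hlt.le, norm_mul,
          norm_ofA_X, ih, pow_succ', mul_assoc]
    obtain ⟨j, hj'⟩ := pow_unbounded_of_one_lt ((q F : ℝ) / ‖v‖) hq
    rw [div_lt_iff₀ hv0] at hj'
    have h1 := hcon j
    rw [hj j] at h1
    have h2 : (q F : ℝ) ^ j * ‖v‖ ≤ ((q F : ℝ) ^ j * ‖v‖) ^ (q F - 1) :=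
      le_self_pow₀ (by linarith) (by omega)
    linarith
  obtain ⟨j, hj⟩ := hexists
  refine ⟨⟨ofA F X ^ j * (w / ϖ), imagAbs_pos_iff.1 ?_⟩, ?_⟩
  · rw [← map_pow, imagAbs_ofA_mul (pow_ne_zero _ X_ne_zero)]
    exact mul_pos (norm_pos_iff.2 (ofA_ne_zero (pow_ne_zero _ X_ne_zero))) hwΩ
  · have : ϖ * (ofA F X ^ j * (w / ϖ)) = ofA F X ^ j * w := by field_simp
    rwa [this]

/-- Starting from a point where `|e(ϖ z)|` is large, the points `T^j z` tend to infinity. -/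
lemma atInfinity_neBot {ϖ : CInf F} (hϖ : ϖ ≠ 0) : (atInfinity ϖ).NeBot := by
  have hq := one_lt_q_real (F := F)
  obtain ⟨z₀, hz₀⟩ := exists_lt_norm_carlitzExp hϖ
  have hpos : ∀ j : ℕ, imagAbs (ofA F X ^ j * z₀.1) = (q F : ℝ) ^ j * imagAbs z₀.1 := fun j => by
    rw [← map_pow, imagAbs_ofA_mul (pow_ne_zero _ X_ne_zero), map_pow, norm_pow, norm_ofA_X]
  let z : ℕ → Omega F := fun j => ⟨ofA F X ^ j * z₀.1, imagAbs_pos_iff.1 (by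
    rw [hpos]
    exact mul_pos (by positivity) (imagAbs_pos z₀))⟩
  set r := ‖carlitzExp (ϖ * z₀.1)‖ with hr
  have hr1 : 1 < r := by
    by_contra! h
    have := pow_le_one₀ (norm_nonneg _) h (n := q F - 1)
    linarith
  have hnorm : ∀ j, ‖carlitzExp (ϖ * (z j).1)‖ = r ^ q F ^ j := by
    intro j
    induction j with
    | zero => simp [z, hr]
    | succ j ih =>
      have e : ϖ * (z (j + 1)).1 = ofA F X * (ϖ * (z j).1) := by
        simp only [z, pow_succ']
        ring
      rw [e, norm_carlitzExp_X_mul_of_lt, ih, ← pow_mul, pow_succ]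
      rw [ih]
      refine hz₀.trans_le (pow_le_pow_left₀ (by linarith) ?_ _)
      exact le_self_pow₀ hr1.le (pow_pos q_pos _).ne'
  refine Filter.NeBot.mono (Filter.map_neBot (f := Filter.atTop) (m := z))
    (tendsto_atInfinity (φ := z) ?_ ?_)
  · have : (fun j => imagAbs (z j).1) = fun j => (q F : ℝ) ^ j * imagAbs z₀.1 := funext hpos
    rw [this]
    exact (tendsto_pow_atTop_atTop_of_one_lt hq).atTop_mul_const (imagAbs_pos z₀)
  · rw [funext hnorm]
    refine Filter.tendsto_atTop_mono (fun j => ?_) (tendsto_pow_atTop_atTop_of_one_lt hr1)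
    exact pow_le_pow_right₀ hr1.le (Nat.lt_pow_self Fintype.one_lt_card).le

/-- `f` is the sum of the power series `S` in `t(z)` along the filter of neighbourhoods of
infinity. -/
def Expands (ϖ : CInf F) (f : Omega F → CInf F) (S : PowerSeries (CInf F)) : Prop :=
  ∀ᶠ z in atInfinity ϖ, HasSum (fun N : ℕ => PowerSeries.coeff N S * tParam ϖ z ^ N) (f z)

lemma HasTExpansion.expands {ϖ : CInf F} {f : Omega F → CInf F} {S : PowerSeries (CInf F)}
    (h : HasTExpansion ϖ f S) : Expands ϖ f S := by
  obtain ⟨R, hR⟩ := h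
  filter_upwards [(tendsto_imagAbs_atInfinity ϖ).eventually_ge_atTop R] with z hz using hR z hz

lemma Expands.add {ϖ : CInf F} {f g : Omega F → CInf F} {S S' : PowerSeries (CInf F)}
    (h : Expands ϖ f S) (h' : Expands ϖ g S') : Expands ϖ (fun z => f z + g z) (S + S') := by
  filter_upwards [h, h'] with z hz hz'
  simpa only [map_add, add_mul] using hz.add hz'

lemma Expands.const_mul {ϖ : CInf F} {f : Omega F → CInf F} {S : PowerSeries (CInf F)}
    (h : Expands ϖ f S) (c : CInf F) :
    Expands ϖ (fun z => c * f z) (PowerSeries.C c * S) := by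
  filter_upwards [h] with z hz
  simpa only [PowerSeries.coeff_C_mul, mul_assoc] using hz.mul_left c

/-- A series which converges at a single point with `t(z) ≠ 0` has coefficients of at most geometric
growth. -/
lemma Expands.exists_coeff_norm_le {ϖ : CInf F} (hϖ : IsCarlitzPeriod ϖ) {f : Omega F → CInf F}
    {S : PowerSeries (CInf F)} (h : Expands ϖ f S) :
    ∃ A B : ℝ, 0 ≤ A ∧ 1 ≤ B ∧ ∀ N, ‖PowerSeries.coeff N S‖ ≤ A * B ^ N := by
  have := atInfinity_neBot hϖ.1
  obtain ⟨z, hz⟩ := h.exists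
  have ht := norm_pos_iff.2 (tParam_ne_zero hϖ z)
  obtain ⟨A, hA⟩ := hz.summable.tendsto_atTop_zero.norm.bddAbove_range
  have hA' : ∀ N, ‖PowerSeries.coeff N S‖ * ‖tParam ϖ z‖ ^ N ≤ A := fun N => by
    rw [← norm_pow, ← norm_mul]
    exact hA ⟨N, rfl⟩
  have hA0 : 0 ≤ A := le_trans (by positivity) (hA' 0)
  refine ⟨A, max 1 ‖tParam ϖ z‖⁻¹, hA0, le_max_left _ _, fun N => ?_⟩
  calc ‖PowerSeries.coeff N S‖ ≤ A * ‖tParam ϖ z‖⁻¹ ^ N := by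
        rw [inv_pow, ← div_eq_mul_inv, le_div_iff₀ (by positivity)]
        exact hA' N
    _ ≤ _ := by
        gcongr
        exact le_max_right _ _

lemma Expands.eq_zero {ϖ : CInf F} (hϖ : IsCarlitzPeriod ϖ)
    {S : PowerSeries (CInf F)} (h : Expands ϖ (fun _ => 0) S) : S = 0 := by
  have hne := atInfinity_neBot hϖ.1
  obtain ⟨A, B, hA, hB, hAB⟩ := h.exists_coeff_norm_le hϖ
  ext n
  rw [map_zero]
  induction n using Nat.strong_induction_on with
  | _ n ih =>
    by_contra hn
    have hδ : 0 < min B⁻¹ (‖PowerSeries.coeff n S‖ / (A * B ^ (n + 1) + 1)) :=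
      lt_min (by positivity) (by positivity)
    obtain ⟨z, hz, hzt⟩ := (h.and (eventually_norm_tParam_lt ϖ hδ)).exists
    obtain ⟨hzt1, hzt2⟩ := lt_min_iff.1 hzt
    set t := tParam ϖ z with ht
    have ht0 : 0 < ‖t‖ := norm_pos_iff.2 (tParam_ne_zero hϖ z)
    have hBt : B * ‖t‖ ≤ 1 := by
      have := mul_le_mul_of_nonneg_left hzt1.le (by linarith : 0 ≤ B)
      rwa [mul_inv_cancel₀ (by linarith)] at this
    have h1 := (hasSum_nat_add_iff' (n + 1)).2 hz
    rw [Finset.sum_range_succ, Finset.sum_eq_zero (fun i hi => by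
      rw [ih i (Finset.mem_range.1 hi), zero_mul]), zero_add, zero_sub] at h1
    have h2 : ‖PowerSeries.coeff n S * t ^ n‖ ≤ A * B ^ (n + 1) * ‖t‖ ^ (n + 1) := by
      rw [← norm_neg, ← h1.tsum_eq]
      refine IsUltrametricDist.norm_tsum_le_of_forall_le_of_nonneg (by positivity) fun i => ?_
      rw [norm_mul, norm_pow]
      calc ‖PowerSeries.coeff (i + (n + 1)) S‖ * ‖t‖ ^ (i + (n + 1))
          ≤ (A * B ^ (i + (n + 1))) * ‖t‖ ^ (i + (n + 1)) :=
            mul_le_mul_of_nonneg_right (hAB _) (by positivity)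
        _ = (A * B ^ (n + 1) * ‖t‖ ^ (n + 1)) * (B * ‖t‖) ^ i := by ring
        _ ≤ (A * B ^ (n + 1) * ‖t‖ ^ (n + 1)) * 1 := by
            gcongr
            exact pow_le_one₀ (by positivity) hBt
        _ = _ := mul_one _
    rw [norm_mul, norm_pow, pow_succ ‖t‖ n, ← mul_assoc, mul_right_comm] at h2
    have h3 := le_of_mul_le_mul_right h2 (by positivity)
    rw [lt_div_iff₀ (by positivity)] at hzt2
    nlinarith

/-- Expansions at infinity are unique. -/
lemma Expands.unique {ϖ : CInf F} (hϖ : IsCarlitzPeriod ϖ) {f : Omega F → CInf F}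
    {S S' : PowerSeries (CInf F)} (h : Expands ϖ f S) (h' : Expands ϖ f S') : S = S' := by
  refine sub_eq_zero.1 (Expands.eq_zero hϖ ?_)
  filter_upwards [h, h'] with z hz hz'
  simpa only [map_sub, sub_mul, sub_self] using hz.sub hz'

/-- If the functions `t^N` are replaced by functions `G_N` with expansions `Λ_N`, then `∑ s_N G_N` is
expanded by the transform of `∑ s_N t^N`. -/
lemma Expands.transform {ϖ : CInf F} (hϖ : IsCarlitzPeriod ϖ) {κ : ℕ}
    {Λ : ℕ → PowerSeries (CInf F)} {S : PowerSeries (CInf F)} {C : ℝ} (hC : 1 ≤ C)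
    (hΛ0 : ∀ N M, κ * M < N → PowerSeries.coeff M (Λ N) = 0)
    (hΛ : ∀ N M, ‖PowerSeries.coeff M (Λ N)‖ ≤ C ^ M) {f g : Omega F → CInf F}
    (hf : Expands ϖ f S) {G : Omega F → ℕ → CInf F}
    (hG : ∀ᶠ z in atInfinity ϖ, ∀ N,
      HasSum (fun M : ℕ => PowerSeries.coeff M (Λ N) * tParam ϖ z ^ M) (G z N))
    (hg : ∀ᶠ z in atInfinity ϖ, HasSum (fun N : ℕ => PowerSeries.coeff N S * G z N) (g z)) :
    Expands ϖ g (Drinfeld.transform κ Λ S) := by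
  obtain ⟨A, B, hA, hB, hAB⟩ := hf.exists_coeff_norm_le hϖ
  have hδ : 0 < 1 / 2 / (C * B ^ κ) := by positivity
  filter_upwards [hG, hg, eventually_norm_tParam_lt ϖ hδ] with z h1 h2 h3
  refine hasSum_transform hB hC hA hΛ0 hΛ hAB ?_ h1 h2
  rw [lt_div_iff₀ (by positivity)] at h3
  linarith

/-! ### The maps `z ↦ a z` and `z ↦ (z + β) / a` -/

/-- The point `a z` of `Ω`. -/
abbrev mulPoint {a : F[X]} (ha : a ≠ 0) (z : Omega F) : Omega F :=
  moebius !![a, 0; 0, 1] (by simpa using ha) z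

/-- The point `(z + β) / a` of `Ω`. -/
abbrev divPoint {a : F[X]} (ha : a ≠ 0) (β : F[X]) (z : Omega F) : Omega F :=
  moebius !![1, β; 0, a] (by simpa using ha) z

lemma mulPoint_val {a : F[X]} (ha : a ≠ 0) (z : Omega F) : (mulPoint ha z).1 = ofA F a * z.1 := by
  simp [mulPoint, moebius]

lemma divPoint_val {a : F[X]} (ha : a ≠ 0) (β : F[X]) (z : Omega F) :
    (divPoint ha β z).1 = (z.1 + ofA F β) / ofA F a := by
  simp [divPoint, moebius]

lemma carlitzExp_mulPoint (ϖ : CInf F) {a : F[X]} (ha : a ≠ 0) (z : Omega F) :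
    carlitzExp (ϖ * (mulPoint ha z).1) = (carlitz a).eval (carlitzExp (ϖ * z.1)) := by
  rw [mulPoint_val, mul_left_comm, carlitzExp_ofA_mul]

lemma carlitzExp_period_mul {ϖ : CInf F} (hϖ : IsCarlitzPeriod ϖ) (a : F[X]) :
    carlitzExp (ϖ * ofA F a) = 0 := (hϖ.2 _).2 ⟨a, rfl⟩

lemma eval_carlitz_carlitzExp_divPoint {ϖ : CInf F} (hϖ : IsCarlitzPeriod ϖ) {a : F[X]}
    (ha : a ≠ 0) (β : F[X]) (z : Omega F) :
    (carlitz a).eval (carlitzExp (ϖ * (divPoint ha β z).1)) = carlitzExp (ϖ * z.1) := by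
  have h := ofA_ne_zero ha
  rw [← carlitzExp_ofA_mul, divPoint_val,
    show ofA F a * (ϖ * ((z.1 + ofA F β) / ofA F a)) = ϖ * z.1 + ϖ * ofA F β by field_simp,
    carlitzExp_add, carlitzExp_period_mul hϖ, add_zero]

lemma tendsto_mulPoint (ϖ : CInf F) {a : F[X]} (ha : a.Monic) :
    Filter.Tendsto (mulPoint ha.ne_zero) (atInfinity ϖ) (atInfinity ϖ) := by
  refine tendsto_atInfinity ?_ ?_
  · simp only [mulPoint_val, imagAbs_ofA_mul ha.ne_zero]
    exact (tendsto_imagAbs_atInfinity ϖ).const_mul_atTop (norm_pos_iff.2 (ofA_ne_zero ha.ne_zero))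
  · simp only [carlitzExp_mulPoint]
    obtain ⟨hm, hd⟩ := carlitz_monic_natDegree ha
    refine Polynomial.tendsto_norm_atTop _ ?_ (tendsto_carlitzExp_atInfinity ϖ)
    rw [degree_eq_natDegree hm.ne_zero, hd]
    exact_mod_cast pow_pos q_pos _

lemma tendsto_divPoint {ϖ : CInf F} (hϖ : IsCarlitzPeriod ϖ) {a : F[X]} (ha : a ≠ 0) (β : F[X]) :
    Filter.Tendsto (divPoint ha β) (atInfinity ϖ) (atInfinity ϖ) := by
  have ha' : 0 < ‖ofA F a‖ := norm_pos_iff.2 (ofA_ne_zero ha)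
  refine tendsto_atInfinity ?_ ?_
  · have h : ∀ z : Omega F, imagAbs (divPoint ha β z).1 = ‖ofA F a‖⁻¹ * imagAbs z.1 := by
      intro z
      rw [eq_inv_mul_iff_mul_eq₀ ha'.ne', ← imagAbs_ofA_mul ha, divPoint_val,
        mul_div_cancel₀ _ (ofA_ne_zero ha), imagAbs_add_ofA]
    simp only [h]
    exact (tendsto_imagAbs_atInfinity ϖ).const_mul_atTop (inv_pos.2 ha')
  · -- `ρ_a` is bounded on discs, and `ρ_a(e(ϖ(z + β)/a)) = e(ϖ z)`
    rw [Filter.tendsto_atTop]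
    intro B
    filter_upwards [(tendsto_carlitzExp_atInfinity ϖ).eventually_gt_atTop
      (circleNorm (carlitz a) B)] with z hz
    by_contra! hlt
    rw [← eval_carlitz_carlitzExp_divPoint hϖ ha β z] at hz
    exact absurd (norm_eval_le_circleNorm (carlitz a) hlt.le) (not_le.2 hz)

/-! ### The two parts of the Hecke operators on expansions -/

/-- The substitution `t ↦ t_a` on formal power series. -/
def substT (a : MonicPoly F) : PowerSeries (CInf F) → PowerSeries (CInf F) :=
  transform 1 fun N => tSeries a ^ N

lemma X_pow_dvd_tSeries_pow (a : MonicPoly F) (N : ℕ) :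
    (PowerSeries.X : PowerSeries (CInf F)) ^ (q F ^ a.1.natDegree * N) ∣ tSeries a ^ N := by
  rw [pow_mul]
  exact pow_dvd_pow_of_dvd (Dvd.intro _ rfl) N

lemma coeff_tSeries_pow_eq_zero (a : MonicPoly F) {N M : ℕ} (h : M < q F ^ a.1.natDegree * N) :
    PowerSeries.coeff M (tSeries a ^ N) = 0 :=
  PowerSeries.X_pow_dvd_iff.1 (X_pow_dvd_tSeries_pow a N) M h

lemma Expands.substT {ϖ : CInf F} (hϖ : IsCarlitzPeriod ϖ) {f : Omega F → CInf F}
    {S : PowerSeries (CInf F)} (hf : Expands ϖ f S) (a : MonicPoly F) :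
    Expands ϖ (fun z => f (mulPoint a.2.ne_zero z)) (substT a S) := by
  obtain ⟨C, hC, hcoeff, heval⟩ := exists_coeff_tSeries_norm_le a
  refine Expands.transform hϖ hC (fun N M h => coeff_tSeries_pow_eq_zero a ?_)
    (fun N M => coeff_pow_norm_le hC hcoeff N M) hf
    (G := fun z N => tParam ϖ (mulPoint a.2.ne_zero z) ^ N) ?_
    ((tendsto_mulPoint ϖ a.2).eventually hf)
  · exact lt_of_lt_of_le (by simpa using h) (Nat.le_mul_of_pos_left N (pow_pos q_pos _))
  · have hC0 : 0 < C := by linarith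
    filter_upwards [eventually_norm_tParam_lt ϖ (inv_pos.2 hC0)] with z hz N
    have h1 : C * ‖tParam ϖ z‖ < 1 := by
      have := mul_lt_mul_of_pos_left hz hC0
      rwa [mul_inv_cancel₀ hC0.ne'] at this
    have h2 := ((heval _ (tParam_ne_zero hϖ z) h1).pow N).2
    rwa [tParam, inv_inv, ← carlitzExp_mulPoint ϖ a.2.ne_zero] at h2

/-- The polynomial in `t = 1/x` expressing the power sum `∑ y^{-N}` over the fibre `ρ_p(y) = x`;
the zeroth power sum is the order of the fibre, which vanishes in `ℂ_∞`. -/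
def tracePoly (p : F[X]) : ℕ → (CInf F)[X]
  | 0 => 0
  | m + 1 => ∑ j ∈ Finset.range (m + 1), C (ofA F p * (carlitz p ^ j).coeff m) * X ^ (j + 1)

/-- The operator on formal power series induced by `f ↦ ∑_{deg β < deg p} f((z + β)/p)`. -/
def traceT (p : MonicPoly F) : PowerSeries (CInf F) → PowerSeries (CInf F) :=
  transform (q F ^ p.1.natDegree) fun N => (tracePoly p.1 N : PowerSeries (CInf F))

lemma coeff_tracePoly_succ (p : F[X]) (m M : ℕ) :
    (tracePoly p (m + 1)).coeff M = ∑ j ∈ Finset.range (m + 1),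
      if M = j + 1 then ofA F p * (carlitz p ^ j).coeff m else 0 := by
  rw [tracePoly, finsetSum_coeff]
  exact Finset.sum_congr rfl fun j _ => coeff_C_mul_X_pow _ _ _

lemma coeff_tracePoly_eq_zero (p : MonicPoly F) {N M : ℕ} (h : q F ^ p.1.natDegree * M < N) :
    (tracePoly p.1 N).coeff M = 0 := by
  obtain ⟨hm, hd⟩ := carlitz_monic_natDegree p.2
  rcases N with _ | m
  · simp [tracePoly]
  rw [coeff_tracePoly_succ]
  refine Finset.sum_eq_zero fun j _ => ?_
  split_ifs with hj
  · rw [coeff_eq_zero_of_natDegree_lt, mul_zero]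
    rw [hm.natDegree_pow, hd]
    have : 0 < q F ^ p.1.natDegree := pow_pos q_pos _
    rw [hj, mul_add, mul_one] at h
    rw [mul_comm]
    omega
  · rfl

lemma coeff_tracePoly_norm_le {p : F[X]} {C : ℝ} (hC : 1 ≤ C) (hp : ‖ofA F p‖ ≤ C)
    (hcoeff : ∀ N, ‖(carlitz p).coeff N‖ ≤ C) (N M : ℕ) : ‖(tracePoly p N).coeff M‖ ≤ C ^ M := by
  rcases N with _ | m
  · rw [tracePoly, coeff_zero, norm_zero]
    positivity
  rw [coeff_tracePoly_succ]
  refine IsUltrametricDist.norm_sum_le_of_forall_le_of_nonneg (by positivity) fun j _ => ?_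
  split_ifs with hj
  · rw [hj, norm_mul, pow_succ']
    exact mul_le_mul hp (coeff_polynomial_pow_norm_le hC hcoeff j m) (norm_nonneg _) (by positivity)
  · rw [norm_zero]
    positivity

lemma carlitzExp_sub (w w' : CInf F) : carlitzExp (w - w') = carlitzExp w - carlitzExp w' := by
  rw [eq_sub_iff_add_eq, ← carlitzExp_add, sub_add_cancel]

/-- The points `e(ϖ a(z + β)/p)`, `deg β < deg p`, of the fibre of `ρ_p` over `e(ϖ a z)` are distinct
when the prime `p` does not divide `a`. -/
lemma injOn_carlitzExp_mul_divPoint {ϖ : CInf F} (hϖ : IsCarlitzPeriod ϖ) (p : MonicPrime F)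
    {a : F[X]} (ha : ¬ p.1 ∣ a) (z : Omega F) :
    Set.InjOn (fun β => carlitzExp (ϖ * (ofA F a * (divPoint p.2.2.ne_zero β z).1)))
      (residues F p.1.natDegree) := by
  intro β hβ β' hβ' h
  have hp0 := ofA_ne_zero p.2.2.ne_zero
  dsimp only at h
  rw [← sub_eq_zero, ← carlitzExp_sub, hϖ.2] at h
  obtain ⟨c, hc⟩ := h
  rw [← mul_sub] at hc
  have hc' := mul_left_cancel₀ hϖ.1 hc
  rw [divPoint_val, divPoint_val, ← mul_sub, ← sub_div, add_sub_add_left_eq_sub, mul_div_assoc',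
    div_eq_iff hp0, ← map_sub, ← map_mul, ← map_mul] at hc'
  have hdvd : p.1 ∣ a * (β - β') := ⟨c, by rw [ofA_injective hc', mul_comm]⟩
  have hdvd' := (p.2.2.prime.dvd_or_dvd hdvd).resolve_left ha
  refine sub_eq_zero.1 (eq_zero_of_dvd_of_degree_lt hdvd' ?_)
  rw [degree_eq_natDegree p.2.2.ne_zero]
  exact (degree_sub_le _ _).trans_lt (max_lt (mem_residues.1 hβ) (mem_residues.1 hβ'))

lemma eval_carlitz_carlitzExp_mul_divPoint {ϖ : CInf F} (hϖ : IsCarlitzPeriod ϖ) {p : F[X]}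
    (hp : p ≠ 0) (a β : F[X]) (z : Omega F) :
    (carlitz p).eval (carlitzExp (ϖ * (ofA F a * (divPoint hp β z).1)))
      = carlitzExp (ϖ * (ofA F a * z.1)) := by
  have h := ofA_ne_zero hp
  rw [← carlitzExp_ofA_mul, divPoint_val,
    show ofA F p * (ϖ * (ofA F a * ((z.1 + ofA F β) / ofA F p)))
      = ϖ * (ofA F a * z.1) + ϖ * (ofA F a * ofA F β) by field_simp,
    carlitzExp_add, ← map_mul, carlitzExp_period_mul hϖ, add_zero]

lemma cast_card_residues (p : MonicPrime F) :
    ((residues F p.1.natDegree).card : CInf F) = 0 := by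
  rw [card_residues, Nat.cast_pow, q_cast_eq_zero (F := F) (CInf F),
    zero_pow p.2.2.natDegree_pos.ne']

/-- A monic prime as a monic polynomial. -/
abbrev MonicPrime.toMonic (p : MonicPrime F) : MonicPoly F := ⟨p.1, p.2.1⟩

lemma Expands.traceT {ϖ : CInf F} (hϖ : IsCarlitzPeriod ϖ) {f : Omega F → CInf F}
    {S : PowerSeries (CInf F)} (hf : Expands ϖ f S) (p : MonicPrime F) :
    Expands ϖ (fun z => ∑ β ∈ residues F p.1.natDegree, f (divPoint p.2.2.ne_zero β z))
      (traceT p.toMonic S) := by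
  obtain ⟨C₀, hC₀, hcoeff⟩ := Drinfeld.exists_coeff_norm_le (carlitz p.1)
  have hC : 1 ≤ max C₀ ‖ofA F p.1‖ := le_max_of_le_left hC₀
  refine Expands.transform hϖ hC
    (fun N M h => by rw [Polynomial.coeff_coe]; exact coeff_tracePoly_eq_zero p.toMonic h)
    (fun N M => by
      rw [Polynomial.coeff_coe]
      exact coeff_tracePoly_norm_le hC (le_max_right _ _)
        (fun N => (hcoeff N).trans (le_max_left _ _)) N M) hf
    (G := fun z N => ∑ β ∈ residues F p.1.natDegree, tParam ϖ (divPoint p.2.2.ne_zero β z) ^ N)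
    (Filter.Eventually.of_forall fun z N => ?_) ?_
  · have h := (absEval_polynomial (tracePoly p.1 N) (tParam ϖ z)).2
    convert h using 1
    rcases N with _ | m
    · simp only [pow_zero, Finset.sum_const, nsmul_eq_mul, mul_one, cast_card_residues]
      simp [tracePoly]
    · have h1 := sum_fiber_inv_pow p.2.1 (carlitzExp_ne_zero hϖ z)
        (w := fun β => carlitzExp (ϖ * (ofA F 1 * (divPoint p.2.2.ne_zero β z).1)))
        (injOn_carlitzExp_mul_divPoint hϖ p (a := 1) p.2.2.prime.not_dvd_one z)
        (fun β _ => by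
          rw [eval_carlitz_carlitzExp_mul_divPoint hϖ p.2.2.ne_zero, map_one, one_mul]) m
      simp only [map_one, one_mul] at h1
      simp only [tParam]
      rw [h1, tracePoly, eval_finsetSum]
      exact Finset.sum_congr rfl fun j _ => by rw [eval_mul, eval_C, eval_pow, eval_X]
  · have hall : ∀ᶠ z in atInfinity ϖ, ∀ β ∈ residues F p.1.natDegree,
        HasSum (fun N : ℕ => PowerSeries.coeff N S * tParam ϖ (divPoint p.2.2.ne_zero β z) ^ N)
          (f (divPoint p.2.2.ne_zero β z)) :=
      (Filter.eventually_all_finset _).2 fun β _ =>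
        (tendsto_divPoint hϖ p.2.2.ne_zero β).eventually hf
    filter_upwards [hall] with z hz
    simpa only [Finset.mul_sum] using hasSum_sum hz

/-! ### The Hecke action on the series `G_n(t_a)` -/

/-- `G_n(t_a)` is the expansion of `G_n(t(az))`. -/
lemma expands_gossSeries {ϖ : CInf F} (hϖ : IsCarlitzPeriod ϖ) (n : ℕ) (a : MonicPoly F) :
    Expands ϖ (fun z => (goss F n).eval (carlitzExp (ϖ * (ofA F a.1 * z.1)))⁻¹)
      (gossSeries n a) := by
  obtain ⟨C, hC, -, heval⟩ := exists_coeff_tSeries_norm_le a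
  have hC0 : 0 < C := by linarith
  filter_upwards [eventually_norm_tParam_lt ϖ (inv_pos.2 hC0)] with z hz
  have h1 : C * ‖tParam ϖ z‖ < 1 := by
    have := mul_lt_mul_of_pos_left hz hC0
    rwa [mul_inv_cancel₀ hC0.ne'] at this
  have h2 := ((heval _ (tParam_ne_zero hϖ z) h1).aeval (goss F n)).2
  rwa [tParam, inv_inv, ← carlitzExp_ofA_mul, mul_left_comm] at h2

/-- The product of two monic polynomials. -/
abbrev MonicPoly.mul (a b : MonicPoly F) : MonicPoly F := ⟨a.1 * b.1, a.2.mul b.2⟩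

lemma substT_gossSeries {ϖ : CInf F} (hϖ : IsCarlitzPeriod ϖ) (n : ℕ) (p a : MonicPoly F) :
    substT p (gossSeries n a) = gossSeries n (p.mul a) := by
  refine Expands.unique hϖ ((expands_gossSeries hϖ n a).substT hϖ p) ?_
  have h := expands_gossSeries hϖ n (p.mul a)
  filter_upwards [h] with z hz
  rwa [mulPoint_val, ← mul_assoc (ofA F a.1), ← map_mul, mul_comm a.1]

lemma traceT_gossSeries_of_not_dvd {ϖ : CInf F} (hϖ : IsCarlitzPeriod ϖ) {n : ℕ} (hn : 0 < n)
    (p : MonicPrime F) (a : MonicPoly F) (hpa : ¬ p.1 ∣ a.1) :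
    traceT p.toMonic (gossSeries n a) = PowerSeries.C (ofA F p.1 ^ n) * gossSeries n a := by
  refine Expands.unique hϖ ((expands_gossSeries hϖ n a).traceT hϖ p) ?_
  filter_upwards [(expands_gossSeries hϖ n a).const_mul (ofA F p.1 ^ n)] with z hz
  have hx : carlitzExp (ϖ * (ofA F a.1 * z.1)) ≠ 0 := by
    rw [← mulPoint_val a.2.ne_zero]
    exact carlitzExp_ne_zero hϖ _
  have h1 := sum_fiber_goss p.2.1 hx (injOn_carlitzExp_mul_divPoint hϖ p hpa z)
    (fun β _ => eval_carlitz_carlitzExp_mul_divPoint hϖ p.2.2.ne_zero a.1 β z) hn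
  rwa [h1]

lemma traceT_gossSeries_of_dvd {ϖ : CInf F} (hϖ : IsCarlitzPeriod ϖ) (n : ℕ)
    (p : MonicPrime F) (a : MonicPoly F) (hpa : p.1 ∣ a.1) :
    traceT p.toMonic (gossSeries n a) = 0 := by
  obtain ⟨b, hb⟩ := hpa
  have hp0 := ofA_ne_zero p.2.2.ne_zero
  refine Expands.eq_zero hϖ ?_
  filter_upwards [(expands_gossSeries hϖ n a).traceT hϖ p] with z hz
  -- all the summands agree, and their number vanishes in `ℂ_∞`
  have h : ∀ β, carlitzExp (ϖ * (ofA F a.1 * (divPoint p.2.2.ne_zero β z).1))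
      = carlitzExp (ϖ * (ofA F b * z.1)) := by
    intro β
    rw [divPoint_val, hb, map_mul,
      show ϖ * (ofA F p.1 * ofA F b * ((z.1 + ofA F β) / ofA F p.1))
        = ϖ * (ofA F b * z.1) + ϖ * (ofA F b * ofA F β) by field_simp,
      carlitzExp_add, ← map_mul, carlitzExp_period_mul hϖ, add_zero]
  simpa only [h, Finset.sum_const, nsmul_eq_mul, cast_card_residues, zero_mul] using hz

/-! ### Series in the `G_n(t_a)` -/

lemma coeff_aSeries (n : ℕ) (c : MonicPoly F → CInf F) (N : ℕ) :
    PowerSeries.coeff N (aSeries n 0 c)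
      = ∑ᶠ a : MonicPoly F, c a * PowerSeries.coeff N (gossSeries n a) := by
  rw [aSeries, map_zero, zero_add, PowerSeries.coeff_mk]

lemma aSeries_add (n : ℕ) (c c' : MonicPoly F → CInf F) :
    aSeries n 0 c + aSeries n 0 c' = aSeries n 0 fun a => c a + c' a := by
  ext N
  rw [map_add, coeff_aSeries, coeff_aSeries, coeff_aSeries, ← finsum_add_distrib
    (finite_support_gossSeries n N c) (finite_support_gossSeries n N c')]
  exact finsum_congr fun a => by rw [add_mul]

lemma C_mul_aSeries (n : ℕ) (x : CInf F) (c : MonicPoly F → CInf F) :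
    PowerSeries.C x * aSeries n 0 c = aSeries n 0 fun a => x * c a := by
  ext N
  rw [PowerSeries.coeff_C_mul, coeff_aSeries, coeff_aSeries, mul_finsum]
  exact finsum_congr fun a => by rw [mul_assoc]

lemma coeff_transform_aSeries (κ : ℕ) (Λ : ℕ → PowerSeries (CInf F)) (n : ℕ)
    (c : MonicPoly F → CInf F) (M : ℕ) :
    PowerSeries.coeff M (transform κ Λ (aSeries n 0 c))
      = ∑ᶠ a : MonicPoly F, c a * PowerSeries.coeff M (transform κ Λ (gossSeries n a)) := by
  simp only [coeff_transform, Finset.mul_sum]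
  rw [finsum_sum_comm]
  · refine Finset.sum_congr rfl fun N _ => ?_
    rw [coeff_aSeries, finsum_mul]
    exact finsum_congr fun a => mul_assoc _ _ _
  · intro N _
    refine (finite_support_gossSeries n N c).subset fun a ha h => ha ?_
    dsimp only at h ⊢
    rw [← mul_assoc, h, zero_mul]

open Classical in
lemma traceT_aSeries {ϖ : CInf F} (hϖ : IsCarlitzPeriod ϖ) {n : ℕ} (hn : 0 < n)
    (p : MonicPrime F) (c : MonicPoly F → CInf F) :
    traceT p.toMonic (aSeries n 0 c)
      = aSeries n 0 fun a => if p.1 ∣ a.1 then 0 else ofA F p.1 ^ n * c a := by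
  ext M
  rw [traceT, coeff_transform_aSeries, coeff_aSeries]
  refine finsum_congr fun a => ?_
  rw [← traceT]
  split_ifs with h
  · rw [traceT_gossSeries_of_dvd hϖ n p a h, map_zero, mul_zero, zero_mul]
  · rw [traceT_gossSeries_of_not_dvd hϖ hn p a h, PowerSeries.coeff_C_mul]
    ring

lemma mul_injective {F : Type u} [Field F] (p : MonicPoly F) : Function.Injective p.mul :=
  fun _ _ h => Subtype.ext (mul_left_cancel₀ p.2.ne_zero (congrArg Subtype.val h))

/-- The substitution `t ↦ t_p` moves the coefficient at `a` to `p a`; the coefficients at elements not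
divisible by `p` become zero. -/
lemma substT_aSeries {ϖ : CInf F} (hϖ : IsCarlitzPeriod ϖ) (n : ℕ) (p : MonicPoly F)
    (c : MonicPoly F → CInf F) :
    substT p (aSeries n 0 c) = aSeries n 0 (Function.extend p.mul c 0) := by
  ext M
  rw [substT, coeff_transform_aSeries, coeff_aSeries]
  have hrange : ∀ b : MonicPoly F,
      Function.extend p.mul c 0 b * PowerSeries.coeff M (gossSeries n b)
        = (Set.range p.mul).indicator (fun b => Function.extend p.mul c 0 b
          * PowerSeries.coeff M (gossSeries n b)) b := by
    intro b
    by_cases h : b ∈ Set.range p.mul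
    · rw [Set.indicator_of_mem h]
    · rw [Set.indicator_of_notMem h, Function.extend_apply' _ _ _ h, Pi.zero_apply, zero_mul]
  rw [finsum_congr hrange, ← finsum_mem_def, finsum_mem_range (mul_injective p)]
  refine finsum_congr fun a => ?_
  rw [(mul_injective p).extend_apply, ← substT, substT_gossSeries hϖ]

lemma constantCoeff_aSeries (n : ℕ) (c₀ : CInf F) (c : MonicPoly F → CInf F) :
    PowerSeries.constantCoeff (aSeries n c₀ c) = c₀ := by
  rw [aSeries, map_add, PowerSeries.constantCoeff_C, ← PowerSeries.coeff_zero_eq_constantCoeff_apply,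
    PowerSeries.coeff_mk, finsum_eq_zero_of_forall_eq_zero, add_zero]
  intro a
  rw [PowerSeries.X_pow_dvd_iff.1 (X_pow_dvd_gossSeries n a) 0 (pow_pos q_pos _), mul_zero]

lemma coeff_pow_self {S : PowerSeries (CInf F)} (h : PowerSeries.constantCoeff S = 0) (k : ℕ) :
    PowerSeries.coeff k (S ^ k) = PowerSeries.coeff 1 S ^ k := by
  obtain ⟨V, rfl⟩ := PowerSeries.X_dvd_iff.2 h
  have h1 := PowerSeries.coeff_X_pow_mul (V ^ k) k 0
  have h2 := PowerSeries.coeff_X_pow_mul V 1 0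
  rw [zero_add] at h1
  rw [zero_add, pow_one] at h2
  rw [mul_pow, h1, h2, PowerSeries.coeff_zero_eq_constantCoeff_apply, map_pow,
    PowerSeries.coeff_zero_eq_constantCoeff_apply]

/-- The coefficient of `X^n` in `G_n` is `1`. -/
lemma goss_ne_zero {n : ℕ} (hn : 0 < n) : goss F n ≠ 0 := by
  obtain ⟨m, rfl⟩ := Nat.exists_eq_add_of_lt hn
  rw [zero_add]
  intro h
  have h1 := congrArg (fun P => coeff P (m + 1)) h
  have h2 : PowerSeries.coeff 1 (carlitzExpSeries F) = 1 := by
    have := coeff_carlitzExpSeries_pow (F := F) 0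
    rwa [pow_zero, carlitzD, Finset.prod_range_zero, inv_one] at this
  simp only [goss, finsetSum_coeff, coeff_C_mul_X_pow, coeff_zero, add_left_inj,
    Nat.add_sub_cancel, Finset.sum_ite_eq, Finset.mem_range, Nat.lt_succ_self, if_true,
    coeff_pow_self constantCoeff_carlitzExpSeries, h2, one_pow] at h1
  exact one_ne_zero h1

lemma gossSeries_one (n : ℕ) :
    gossSeries n (oneMonic F) = ((goss F n : (CInf F)[X]) : PowerSeries (CInf F)) := by
  have h : tSeries (oneMonic F) = PowerSeries.X := by
    have h1 : (reflect 1 X : (CInf F)[X]) = 1 := by simp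
    simp [tSeries, carlitz_one, h1]
  rw [gossSeries, h, aeval_def]
  exact eval₂_C_X_eq_coe

/-- The leading coefficient of a series in the `G_n(t_a)` comes from the term with `a = 1`, since
`t_a` vanishes to order `q^{deg a}`. -/
lemma coeff_one_eq_zero_of_aSeries_eq_zero {n : ℕ} (hn : 0 < n) {c : MonicPoly F → CInf F}
    (h : aSeries n 0 c = 0) : c (oneMonic F) = 0 := by
  set v := (goss F n).natTrailingDegree with hv
  have hgoss := goss_ne_zero (F := F) hn
  have hX : X ∣ goss F n := by
    rw [goss]
    exact Finset.dvd_sum fun j _ => Dvd.dvd.mul_left (dvd_pow_self X (Nat.succ_ne_zero j)) _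
  have hv0 : 0 < v := by
    rw [hv, Nat.pos_iff_ne_zero, Ne, natTrailingDegree_eq_zero, not_or, not_not]
    exact ⟨hgoss, X_dvd_iff.1 hX⟩
  have hcoeff : (goss F n).coeff v ≠ 0 := by
    have := trailingCoeff_nonzero_iff_nonzero.2 hgoss
    exact this
  have hdvd : X ^ v ∣ goss F n := by
    rw [X_pow_dvd_iff]
    exact fun d hd => coeff_eq_zero_of_lt_natTrailingDegree hd
  have hzero : ∀ a : MonicPoly F, a ≠ oneMonic F →
      c a * PowerSeries.coeff v (gossSeries n a) = 0 := by
    intro a ha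
    have hd : 0 < a.1.natDegree := by
      rw [Nat.pos_iff_ne_zero]
      exact fun h => ha (Subtype.ext (eq_one_of_monic_natDegree_zero a.2 h))
    have h1 : PowerSeries.X ^ (q F ^ a.1.natDegree * v) ∣ gossSeries n a := by
      refine (X_pow_dvd_tSeries_pow a v).trans ?_
      have := _root_.map_dvd (aeval (tSeries a)) hdvd
      rwa [map_pow, aeval_X] at this
    have h2 : v < q F ^ a.1.natDegree * v :=
      (Nat.lt_mul_iff_one_lt_left hv0).2 (Nat.one_lt_pow hd.ne' Fintype.one_lt_card)
    rw [PowerSeries.X_pow_dvd_iff.1 h1 v h2, mul_zero]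
  have h1 := congrArg (PowerSeries.coeff v) h
  rw [coeff_aSeries, map_zero, finsum_eq_single _ _ hzero, gossSeries_one,
    Polynomial.coeff_coe] at h1
  exact (mul_eq_zero.1 h1).resolve_right hcoeff

/-- The substitution `t ↦ t_a` is injective. -/
lemma eq_zero_of_substT_eq_zero (a : MonicPoly F) {S : PowerSeries (CInf F)}
    (h : substT a S = 0) : S = 0 := by
  have hQ : 0 < q F ^ a.1.natDegree := pow_pos q_pos _
  ext n
  rw [map_zero]
  induction n using Nat.strong_induction_on with
  | _ n ih =>
    have h1 := congrArg (PowerSeries.coeff (q F ^ a.1.natDegree * n)) h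
    rw [substT, coeff_transform, map_zero, Finset.sum_eq_single n] at h1
    · refine (mul_eq_zero.1 h1).resolve_right ?_
      have h2 : PowerSeries.constantCoeff (revCarlitz a.1 : PowerSeries (CInf F))⁻¹ = 1 := by
        rw [PowerSeries.constantCoeff_inv, constantCoeff_revCarlitz, inv_one]
      have h3 := PowerSeries.coeff_X_pow_mul
        ((revCarlitz a.1 : PowerSeries (CInf F))⁻¹ ^ n) (q F ^ a.1.natDegree * n) 0
      rw [zero_add, PowerSeries.coeff_zero_eq_constantCoeff_apply, map_pow, h2, one_pow, pow_mul,
        ← mul_pow] at h3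
      change PowerSeries.coeff _ (tSeries a ^ n) = 1 at h3
      rw [h3]
      exact one_ne_zero
    · intro N _ hN
      rcases lt_or_gt_of_ne hN with hlt | hgt
      · rw [ih N hlt, zero_mul]
      · rw [coeff_tSeries_pow_eq_zero a (Nat.mul_lt_mul_of_pos_left hgt hQ), mul_zero]
    · intro hn
      refine absurd (Finset.mem_range.2 ?_) hn
      rw [one_mul]
      exact Nat.lt_succ_of_le (Nat.le_mul_of_pos_left n hQ)

lemma transform_zero (κ : ℕ) (Λ : ℕ → PowerSeries (CInf F)) : transform κ Λ 0 = 0 := by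
  ext M
  simp [coeff_transform]

/-- Induction on monic polynomials through their prime factors. -/
lemma MonicPoly.induction {F : Type u} [Field F] {P : MonicPoly F → Prop} (h1 : P (oneMonic F))
    (hmul : ∀ (p : MonicPrime F) (b : MonicPoly F), P b → P (p.toMonic.mul b)) (b : MonicPoly F) :
    P b := by
  induction hd : b.1.natDegree using Nat.strong_induction_on generalizing b with
  | _ d ih =>
    by_cases hb : b = oneMonic F
    · rwa [hb]
    · have hunit : ¬ IsUnit b.1 := fun hu => hb (Subtype.ext (b.2.eq_one_of_isUnit hu))
      obtain ⟨p, hpm, hpi, hpb⟩ := exists_monic_irreducible_factor b.1 hunit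
      obtain ⟨b', hb'⟩ := hpb
      have hm' : b'.Monic := hpm.of_mul_monic_left (hb' ▸ b.2)
      have hdeg : b'.natDegree < d := by
        rw [← hd, hb', hpm.natDegree_mul hm']
        have := hpi.natDegree_pos
        omega
      have := hmul ⟨p, hpm, hpi⟩ ⟨b', hm'⟩ (ih _ hdeg ⟨b', hm'⟩ rfl)
      rwa [show b = MonicPoly.mul ⟨p, hpm⟩ ⟨b', hm'⟩ from Subtype.ext hb']

/-- The coefficients of a series in the `G_n(t_a)` are determined by the series: the trace operator
of a prime `p` isolates the part supported on multiples of `p`, which is a substitution of a series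
of the same kind. -/
theorem eq_zero_of_aSeries_eq_zero {ϖ : CInf F} (hϖ : IsCarlitzPeriod ϖ) {n : ℕ} (hn : 0 < n)
    (b : MonicPoly F) : ∀ c : MonicPoly F → CInf F, aSeries n 0 c = 0 → c b = 0 := by
  classical
  induction b using MonicPoly.induction with
  | h1 => exact fun c hc => coeff_one_eq_zero_of_aSeries_eq_zero hn hc
  | hmul p b ih =>
    intro c hc
    have hp := pow_ne_zero n (ofA_ne_zero p.2.2.ne_zero)
    -- `c` minus `p^{-n}` times its trace is supported on the multiples of `p`
    have h1 := traceT_aSeries hϖ hn p c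
    rw [hc, traceT, transform_zero] at h1
    have h2 : aSeries n 0 (Function.extend p.toMonic.mul (fun a => c (p.toMonic.mul a)) 0) = 0 := by
      have h3 := aSeries_add n c
        fun a => -(ofA F p.1 ^ n)⁻¹ * if p.1 ∣ a.1 then 0 else ofA F p.1 ^ n * c a
      rw [← C_mul_aSeries, ← h1, hc, mul_zero, add_zero] at h3
      rw [h3]
      congr 1
      funext a
      by_cases ha : p.1 ∣ a.1
      · obtain ⟨a', ha'⟩ := ha
        have hm' : a'.Monic := p.2.1.of_mul_monic_left (ha' ▸ a.2)
        obtain rfl : a = p.toMonic.mul ⟨a', hm'⟩ := Subtype.ext ha'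
        rw [(mul_injective _).extend_apply, if_pos (Dvd.intro _ rfl), mul_zero, add_zero]
      · rw [Function.extend_apply', if_neg ha, Pi.zero_apply, neg_mul,
          inv_mul_cancel_left₀ hp, add_neg_cancel]
        rintro ⟨a', rfl⟩
        exact ha (Dvd.intro _ rfl)
    rw [← substT_aSeries hϖ] at h2
    exact ih _ (eq_zero_of_substT_eq_zero _ h2)

/-! ### Eigenforms with `A`-expansions -/

section Eigenforms

variable {ϖ : CInf F} {k : ℕ} {lam : MonicPrime F → CInf F} {f : Omega F → CInf F} {n : ℕ}
  {c : MonicPoly F → CInf F}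

open Classical in
/-- The Hecke eigenvalue equation in terms of the coefficients of the `A`-expansion. -/
lemma eigenvalue_mul_coeff (hϖ : IsCarlitzPeriod ϖ) (hn : 0 < n) (p : MonicPrime F) {l : CInf F}
    (hf : hecke k p f = l • f) (hS : Expands ϖ f (aSeries n 0 c)) (a : MonicPoly F) :
    l * c a = ofA F p.1 ^ k * Function.extend p.toMonic.mul c 0 a
      + if p.1 ∣ a.1 then 0 else ofA F p.1 ^ n * c a := by
  have h1 : Expands ϖ (hecke k p f) _ :=
    ((hS.substT hϖ p.toMonic).const_mul (ofA F p.1 ^ k)).add (hS.traceT hϖ p)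
  rw [hf] at h1
  have h2 := h1.unique hϖ (hS.const_mul l)
  rw [substT_aSeries hϖ, traceT_aSeries hϖ hn, C_mul_aSeries, C_mul_aSeries, aSeries_add] at h2
  have h3 := aSeries_add n (fun a => l * c a) fun a => -1 *
    (ofA F p.1 ^ k * Function.extend p.toMonic.mul c 0 a
      + if p.1 ∣ a.1 then 0 else ofA F p.1 ^ n * c a)
  rw [← C_mul_aSeries n (-1), h2, map_neg, map_one, neg_one_mul, add_neg_cancel] at h3
  have h4 := eq_zero_of_aSeries_eq_zero hϖ hn a _ h3.symm
  linear_combination h4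

lemma eigenvalue_mul_coeff_mul (hϖ : IsCarlitzPeriod ϖ) (hn : 0 < n) (p : MonicPrime F)
    {l : CInf F} (hf : hecke k p f = l • f) (hS : Expands ϖ f (aSeries n 0 c)) (b : MonicPoly F) :
    l * c (p.toMonic.mul b) = ofA F p.1 ^ k * c b := by
  classical
  have h := eigenvalue_mul_coeff hϖ hn p hf hS (p.toMonic.mul b)
  rwa [(mul_injective _).extend_apply, if_pos (Dvd.intro _ rfl), add_zero] at h

lemma eigenvalue_mul_coeff_one (hϖ : IsCarlitzPeriod ϖ) (hn : 0 < n) (p : MonicPrime F)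
    {l : CInf F} (hf : hecke k p f = l • f) (hS : Expands ϖ f (aSeries n 0 c)) :
    l * c (oneMonic F) = ofA F p.1 ^ n * c (oneMonic F) := by
  classical
  have h := eigenvalue_mul_coeff hϖ hn p hf hS (oneMonic F)
  have hp : ¬ p.1 ∣ (oneMonic F).1 := p.2.2.prime.not_dvd_one
  rwa [Function.extend_apply', if_neg hp, Pi.zero_apply, mul_zero, zero_add] at h
  rintro ⟨a', ha'⟩
  exact hp ⟨a'.1, (congrArg Subtype.val ha').symm⟩

/-- If `c_1 = 0`, the eigenvalue equations kill all coefficients, and `f` vanishes near infinity. -/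
lemma coeff_one_ne_zero (hϖ : IsCarlitzPeriod ϖ) (hn : 0 < n) (hhol : IsHolomorphic f)
    (hf : IsEigenform k lam f) (hS : HasTExpansion ϖ f (aSeries n 0 c)) :
    c (oneMonic F) ≠ 0 := by
  intro h1
  have hc : ∀ b, c b = 0 := by
    intro b
    induction b using MonicPoly.induction with
    | h1 => exact h1
    | hmul p b ih =>
      have h2 := eigenvalue_mul_coeff_mul hϖ hn p (hf.2 p) hS.expands
      have h3 := h2 b
      rw [ih, mul_zero] at h3
      rcases mul_eq_zero.1 h3 with hl | h4
      · -- if `λ_p = 0`, the equation at `p b` expresses `c_{pb}` through `λ_p c_{p²b} = 0`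
        have h4 := h2 (p.toMonic.mul b)
        rw [hl, zero_mul] at h4
        exact (mul_eq_zero.1 h4.symm).resolve_left (pow_ne_zero k (ofA_ne_zero p.2.2.ne_zero))
      · exact h4
  have hzero : aSeries n 0 c = 0 := by
    ext N
    rw [coeff_aSeries, map_zero]
    exact finsum_eq_zero_of_forall_eq_zero fun a => by rw [hc, zero_mul]
  obtain ⟨R, hR⟩ := hS
  refine hf.1 ?_
  rw [eq_smul_of_eq_near_infinity (μ := 0) hhol hhol (R := R) fun z hz => ?_, zero_smul]
  rw [zero_mul]
  refine (hR z hz).unique ?_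
  simp only [hzero, map_zero, zero_mul]
  exact hasSum_zero

lemma eigenvalue_eq (hϖ : IsCarlitzPeriod ϖ) (hn : 0 < n) (hhol : IsHolomorphic f)
    (hf : IsEigenform k lam f) (hS : HasTExpansion ϖ f (aSeries n 0 c)) (p : MonicPrime F) :
    lam p = ofA F p.1 ^ n :=
  mul_right_cancel₀ (coeff_one_ne_zero hϖ hn hhol hf hS)
    (eigenvalue_mul_coeff_one hϖ hn p (hf.2 p) hS.expands)

lemma coeff_eq_zpow_mul (hϖ : IsCarlitzPeriod ϖ) (hn : 0 < n) (hhol : IsHolomorphic f)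
    (hf : IsEigenform k lam f) (hS : HasTExpansion ϖ f (aSeries n 0 c)) (a : MonicPoly F) :
    c a = ofA F a.1 ^ ((k : ℤ) - (n : ℤ)) * c (oneMonic F) := by
  induction a using MonicPoly.induction with
  | h1 => rw [map_one, one_zpow, one_mul]
  | hmul p b ih =>
    have hp := ofA_ne_zero p.2.2.ne_zero
    have h := eigenvalue_mul_coeff_mul hϖ hn p (hf.2 p) hS.expands b
    rw [eigenvalue_eq hϖ hn hhol hf hS p] at h
    refine mul_left_cancel₀ (pow_ne_zero n hp) ?_
    rw [h, ih, MonicPoly.mul, map_mul, mul_zpow, zpow_sub₀ hp, zpow_natCast, zpow_natCast]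
    field_simp

lemma const_eq_zero {m : ℤ} (hϖ : IsCarlitzPeriod ϖ) (hf : IsCuspForm ϖ k m f) {c₀ : CInf F}
    (hS : HasTExpansion ϖ f (aSeries n c₀ c)) : c₀ = 0 := by
  obtain ⟨S, h1, h2⟩ := hf.vanishes_at_infinity
  rw [← constantCoeff_aSeries n c₀ c, hS.expands.unique hϖ h1.expands, h2]

lemma HasTExpansion.const_smul {S : PowerSeries (CInf F)} (h : HasTExpansion ϖ f S) (x : CInf F) :
    HasTExpansion ϖ (x • f) (PowerSeries.C x * S) := by
  obtain ⟨R, hR⟩ := h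
  refine ⟨R, fun z hz => ?_⟩
  simp only [PowerSeries.coeff_C_mul, mul_assoc]
  exact (hR z hz).mul_left x

/-- After normalization, the `A`-expansion of an eigenform depends only on `k` and `n`. -/
lemma hasTExpansion_normalized (hϖ : IsCarlitzPeriod ϖ) (hn : 0 < n) (hhol : IsHolomorphic f)
    (hf : IsEigenform k lam f) (hS : HasTExpansion ϖ f (aSeries n 0 c)) :
    HasTExpansion ϖ ((c (oneMonic F))⁻¹ • f)
      (aSeries n 0 fun a => ofA F a.1 ^ ((k : ℤ) - (n : ℤ))) := by
  have h := hS.const_smul (c (oneMonic F))⁻¹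
  rw [C_mul_aSeries] at h
  convert h using 3 with a
  rw [coeff_eq_zpow_mul hϖ hn hhol hf hS a, mul_comm,
    mul_inv_cancel_right₀ (coeff_one_ne_zero hϖ hn hhol hf hS)]

/-- The eigenvalue at the prime `T` determines the exponent. -/
lemma ofA_X_pow_injective : Function.Injective fun n : ℕ => ofA F X ^ n := fun n n' h => by
  have h' := congrArg norm h
  simp only [norm_pow, norm_ofA_X] at h'
  exact Nat.pow_right_injective (Fintype.one_lt_card (α := F)) (by exact_mod_cast h')

lemma HasTExpansion.eq_smul {f' : Omega F → CInf F} {S : PowerSeries (CInf F)} {x x' : CInf F}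
    (hhol : IsHolomorphic f) (hhol' : IsHolomorphic f') (hx' : x' ≠ 0)
    (h : HasTExpansion ϖ (x⁻¹ • f) S) (h' : HasTExpansion ϖ (x'⁻¹ • f') S) :
    f' = (x' * x⁻¹) • f := by
  obtain ⟨R, hR⟩ := h
  obtain ⟨R', hR'⟩ := h'
  refine eq_smul_of_eq_near_infinity hhol' hhol (R := max R R') fun z hz => ?_
  have h1 := (hR z ((le_max_left _ _).trans hz)).unique (hR' z ((le_max_right _ _).trans hz))
  simp only [Pi.smul_apply, smul_eq_mul] at h1
  rw [mul_assoc, h1, mul_inv_cancel_left₀ hx']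

end Eigenforms

end Drinfeld

end

theorem mainTheorem2 {F : Type*} [Field F] [Fintype F] (ϖ : Drinfeld.CInf F)
    (hϖ : Drinfeld.IsCarlitzPeriod ϖ) :
    (∀ (k : ℕ) (m : ℤ) (lam : Drinfeld.MonicPrime F → Drinfeld.CInf F)
        (f : Drinfeld.Omega F → Drinfeld.CInf F),
      Drinfeld.IsCuspForm ϖ k m f → Drinfeld.IsEigenform k lam f →
      ∀ (n : ℕ) (c₀ : Drinfeld.CInf F) (c : Drinfeld.MonicPoly F → Drinfeld.CInf F),
        Drinfeld.HasAExpansion ϖ f n c₀ c →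
        c₀ = 0 ∧
        c (Drinfeld.oneMonic F) ≠ 0 ∧
        (∀ a, c a = Drinfeld.ofA F a.1 ^ ((k : ℤ) - (n : ℤ)) * c (Drinfeld.oneMonic F)) ∧
        Drinfeld.HasAExpansion ϖ ((c (Drinfeld.oneMonic F))⁻¹ • f) n 0
          (fun a => Drinfeld.ofA F a.1 ^ ((k : ℤ) - (n : ℤ))) ∧
        ∀ p, lam p = Drinfeld.ofA F p.1 ^ n) ∧
    (∀ (k : ℕ) (m m' : ℤ) (lam : Drinfeld.MonicPrime F → Drinfeld.CInf F)
        (f f' : Drinfeld.Omega F → Drinfeld.CInf F),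
      Drinfeld.IsCuspForm ϖ k m f → Drinfeld.IsCuspForm ϖ k m' f' →
      Drinfeld.IsEigenform k lam f → Drinfeld.IsEigenform k lam f' →
      (∃ n c₀ c, Drinfeld.HasAExpansion ϖ f n c₀ c) →
      (∃ n c₀ c, Drinfeld.HasAExpansion ϖ f' n c₀ c) →
      ∃ μ : Drinfeld.CInf F, μ ≠ 0 ∧ f' = μ • f) := by
  refine ⟨fun k m lam f hcusp hf n c₀ c hA => ?_,
    fun k m m' lam f f' hcusp hcusp' hf hf' hA hA' => ?_⟩
  · obtain ⟨hn, hS⟩ := hA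
    have hhol := hcusp.holomorphic
    obtain rfl := Drinfeld.const_eq_zero hϖ hcusp hS
    exact ⟨rfl, Drinfeld.coeff_one_ne_zero hϖ hn hhol hf hS,
      Drinfeld.coeff_eq_zpow_mul hϖ hn hhol hf hS,
      ⟨hn, Drinfeld.hasTExpansion_normalized hϖ hn hhol hf hS⟩,
      Drinfeld.eigenvalue_eq hϖ hn hhol hf hS⟩
  · obtain ⟨n, c₀, c, hn, hS⟩ := hA
    obtain ⟨n', c₀', c', hn', hS'⟩ := hA'
    have hhol := hcusp.holomorphic
    have hhol' := hcusp'.holomorphic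
    obtain rfl := Drinfeld.const_eq_zero hϖ hcusp hS
    obtain rfl := Drinfeld.const_eq_zero hϖ hcusp' hS'
    obtain rfl : n = n' := Drinfeld.ofA_X_pow_injective (F := F) <|
      (Drinfeld.eigenvalue_eq hϖ hn hhol hf hS ⟨X, monic_X, irreducible_X⟩).symm.trans
        (Drinfeld.eigenvalue_eq hϖ hn' hhol' hf' hS' ⟨X, monic_X, irreducible_X⟩)
    have hc := Drinfeld.coeff_one_ne_zero hϖ hn hhol hf hS
    have hc' := Drinfeld.coeff_one_ne_zero hϖ hn' hhol' hf' hS'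
    exact ⟨_, mul_ne_zero hc' (inv_ne_zero hc), Drinfeld.HasTExpansion.eq_smul hhol hhol' hc'
      (Drinfeld.hasTExpansion_normalized hϖ hn hhol hf hS)
      (Drinfeld.hasTExpansion_normalized hϖ hn' hhol' hf' hS')⟩
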